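/- \textbf{Setting.} For a density operator $\rho$ on $\mathbb C^d$ let $\lambda_1(\rho)\ge\lambda_2(\rho)\ge\dots$ be its eigenvalues with multiplicity ($\lambda_2:=0$ if $d=1$). The memory consists of an ancilla qubit and two systems $S_1,S_2$, each made of one qubit and one qudit, so its state space is $\mathbb C^2\otimes(\mathbb C^2\otimes\mathbb C^d)\otimes(\mathbb C^2\otimes\mathbb C^d)$. For $r\ge 1$ and $t>0$ the \emph{fractional-swap circuit} with parameters $(r,t)$ prepares the ancilla in $|0\rangle$ and the qubit of $S_1$ in $|+\rangle$, keeping the qudit of $S_1$. It then repeats $r$ times: discard $S_2$, prepare it in $|1\rangle\langle 1|\otimes\rho_{\rm in}$ using a fresh copy of $\rho_{\rm in}$, and apply to the memory, in this order, $$e^{-i\theta_-X},\ \mathrm{C}\mathbb S,\ e^{-i\theta_+Y}Ze^{i\theta_+Y},\ \mathrm{C}\mathbb S,\ e^{-i\theta_-X}Ze^{i\theta_-X},\ \mathrm{C}\mathbb S,\ e^{i\theta_+Y},$$ where the single-qubit gates act on the ancilla, $\mathrm{C}\mathbb S$ is the swap of $S_1$ and $S_2$ controlled by the ancilla, and $\theta_\pm=\frac12\arccos\frac{\cos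 t-\sin t}{2}\pm\frac12\arccos\frac{\cos t+\sin t}{2}$. (This implements the fractional swap $e^{-it\mathbb S}$ of $S_1$ and $S_2$, up to a global sign.) Finally the qubit of $S_1$ is measured in the basis $|\pm\rangle$. A \emph{protocol} is a rule which, from the measurement outcomes obtained so far, either stops and outputs the qudit of $S_1$, or chooses $r$ and $t$ and runs the fractional-swap circuit on the current memory, optionally after restarting by replacing the qudit of $S_1$ with a fresh copy of $\rho_{\rm in}$. \textbf{Proposition.} There is a universal constant $C>0$ such that for all real $\gamma,\varepsilon_{\rm dist},\alpha\in(0,1)$ with $\varepsilon_{\rm dist}<1-\gamma$ there is a protocol, depending only on $\gamma,\varepsilon_{\rm dist},\alpha$, with the following property. For every $d$ and every density operator $\rho_{\rm in}$ on $\mathbb C^d$ with $\lambda_1(\rho_{\rm in})\ge\gamma$ and $\lambda_2(\rho_{\rm in})\le\alpha\gamma$, and for every initial state of the memory, the protocol stops with probability one, and its output state $\rho_{\rm out}$ is a density operator such that $$[\rho_{\rm in},\rho_{\rm out}]=0\qquad\text{and}\qquad \langle\Xi|\rho_{\rm out}|\Xi\rangle\ge 1-\varepsilon_{\rm dist}$$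 for every unit eigenvector $|\Xi\rangle$ of $\rho_{\rm in}$ with eigenvalue $\lambda_1(\rho_{\rm in})$. The expected number of copies of $\rho_{\rm in}$ consumed, the expected number of controlled swaps $\mathrm{C}\mathbb S$ and the expected number of single-qubit gates are each at most $$C\cdot\frac{1-\gamma}{(1-\alpha)^2\gamma^2}\Big(\frac1{\varepsilon_{\rm dist}}+\frac1\gamma\Big).$$ The protocol stores only the memory described above, that is, two qudits and three qubits. -/

import Mathlib

open scoped Kronecker ENNReal ComplexOrder

noncomputable section

namespace FracSwapDistillation

/-! ## Density operators and their spectrum -/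

/-- A density operator on `ℂᵈ`: positive semidefinite with trace one. -/
structure IsDensityOperator {ι : Type*} [Fintype ι] (ρ : Matrix ι ι ℂ) : Prop where
  posSemidef : ρ.PosSemidef
  trace_eq_one : ρ.trace = 1

/-- The `(k+1)`-st largest eigenvalue of a Hermitian `d × d` matrix, counted with multiplicity
(`k = 0` is the largest, `k = 1` the second largest); it is `0` if `d ≤ k`. -/
def sortedEigenvalue {d : ℕ} {A : Matrix (Fin d) (Fin d) ℂ} (hA : A.IsHermitian) (k : ℕ) : ℝ :=
  if h : k < Fintype.card (Fin d) then hA.eigenvalues₀ ⟨k, h⟩ else 0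

/-! ## Single-qubit gates -/

def pauliX : Matrix (Fin 2) (Fin 2) ℂ := !![0, 1; 1, 0]

def pauliY : Matrix (Fin 2) (Fin 2) ℂ := !![0, -Complex.I; Complex.I, 0]

def pauliZ : Matrix (Fin 2) (Fin 2) ℂ := !![1, 0; 0, -1]

def hadamard : Matrix (Fin 2) (Fin 2) ℂ :=
  ((√2 : ℝ) : ℂ)⁻¹ • !![1, 1; 1, -1]

/-- `exp(-i θ P) = cos θ · 1 - i sin θ · P`, for a matrix `P` with `P² = 1`. -/
def expPauli (P : Matrix (Fin 2) (Fin 2) ℂ) (θ : ℝ) : Matrix (Fin 2) (Fin 2) ℂ :=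
  ((Real.cos θ : ℝ) : ℂ) • (1 : Matrix (Fin 2) (Fin 2) ℂ) -
    (Complex.I * ((Real.sin θ : ℝ) : ℂ)) • P

abbrev U2 := Matrix.unitaryGroup (Fin 2) ℂ

theorem expPauli_mem {P : Matrix (Fin 2) (Fin 2) ℂ} (hP : P.conjTranspose = P)
    (hP2 : P * P = 1) (θ : ℝ) : expPauli P θ ∈ Matrix.unitaryGroup (Fin 2) ℂ := by
  rw [Matrix.mem_unitaryGroup_iff, Matrix.star_eq_conjTranspose]
  have h : ((Real.cos θ : ℝ) : ℂ) ^ 2 + ((Real.sin θ : ℝ) : ℂ) ^ 2 = 1 := by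
    rw [← Complex.ofReal_pow, ← Complex.ofReal_pow, ← Complex.ofReal_add,
      Real.cos_sq_add_sin_sq, Complex.ofReal_one]
  have hc : (expPauli P θ).conjTranspose =
      ((Real.cos θ : ℝ) : ℂ) • (1 : Matrix (Fin 2) (Fin 2) ℂ) +
        (Complex.I * ((Real.sin θ : ℝ) : ℂ)) • P := by
    simp only [expPauli, Matrix.conjTranspose_sub, Matrix.conjTranspose_smul, hP,
      Matrix.conjTranspose_one, star_mul', RCLike.star_def, Complex.conj_ofReal, Complex.conj_I,
      neg_mul, neg_smul, sub_neg_eq_add]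
  rw [hc, expPauli]
  simp only [sub_mul, mul_add, Matrix.smul_mul, Matrix.mul_smul, hP2, Matrix.one_mul,
    Matrix.mul_one, smul_smul]
  set c : ℂ := ((Real.cos θ : ℝ) : ℂ)
  set s : ℂ := ((Real.sin θ : ℝ) : ℂ)
  have e : c * c + -(Complex.I * s * (Complex.I * s)) = 1 := by
    linear_combination h - s ^ 2 * Complex.I_sq
  calc _ = (c * c + -(Complex.I * s * (Complex.I * s))) • (1 : Matrix (Fin 2) (Fin 2) ℂ) := by
        rw [mul_comm (Complex.I * s) c]; module
    _ = 1 := by rw [e, one_smul]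

def gateX : U2 := ⟨pauliX, by
  rw [Matrix.mem_unitaryGroup_iff]; ext i j
  fin_cases i <;> fin_cases j <;> simp [pauliX, Matrix.mul_apply, Matrix.star_apply]⟩

def gateZ : U2 := ⟨pauliZ, by
  rw [Matrix.mem_unitaryGroup_iff]; ext i j
  fin_cases i <;> fin_cases j <;> simp [pauliZ, Matrix.mul_apply, Matrix.star_apply]⟩

def gateH : U2 := ⟨hadamard, by
  have h : ((√2 : ℝ) : ℂ)⁻¹ * ((√2 : ℝ) : ℂ)⁻¹ = 1 / 2 := by
    rw [← mul_inv, ← Complex.ofReal_mul, Real.mul_self_sqrt (by norm_num)]; norm_num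
  rw [Matrix.mem_unitaryGroup_iff]; ext i j
  fin_cases i <;> fin_cases j <;>
    simp [hadamard, Matrix.mul_apply, Matrix.star_apply, h] <;> norm_num⟩

/-- The gate `exp(-i θ X)`. -/
def gateExpX (θ : ℝ) : U2 := ⟨expPauli pauliX θ, expPauli_mem
  (by ext i j; fin_cases i <;> fin_cases j <;> simp [pauliX])
  (by ext i j; fin_cases i <;> fin_cases j <;> simp [pauliX, Matrix.mul_apply]) θ⟩

/-- The gate `exp(-i θ Y)`. -/
def gateExpY (θ : ℝ) : U2 := ⟨expPauli pauliY θ, expPauli_mem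
  (by ext i j; fin_cases i <;> fin_cases j <;> simp [pauliY])
  (by ext i j; fin_cases i <;> fin_cases j <;> simp [pauliY, Matrix.mul_apply]) θ⟩

/-! ## The quantum memory: three qubits and two qudits

The whole memory is `ℂ² ⊗ (ℂ² ⊗ ℂᵈ) ⊗ (ℂ² ⊗ ℂᵈ)`: an ancilla qubit, and two systems `S₁`, `S₂`
each of which consists of a qubit and a qudit. -/

/-- Index set of a system consisting of a qubit and a qudit. -/
abbrev Site (d : ℕ) := Fin 2 × Fin d

/-- Index set of the whole memory (ancilla qubit, `S₁`, `S₂`). -/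
abbrev Memory (d : ℕ) := Fin 2 × Site d × Site d

/-- Operators on the memory. -/
abbrev MemOp (d : ℕ) := Matrix (Memory d) (Memory d) ℂ

/-- The three qubits: the ancilla, the qubit of `S₁` and the qubit of `S₂`. -/
inductive QubitReg
  | ancilla
  | first
  | second

/-- The two qudits: the qudit of `S₁` and the qudit of `S₂`. -/
inductive QuditReg
  | first
  | second

/-- The operator on the memory which is `A` on the given qubit and the identity elsewhere. -/
def onQubit {d : ℕ} (q : QubitReg) (A : Matrix (Fin 2) (Fin 2) ℂ) : MemOp d :=
  match q with
  | .ancilla => A ⊗ₖ (1 : Matrix (Site d × Site d) (Site d × Site d) ℂ)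
  | .first => (1 : Matrix (Fin 2) (Fin 2) ℂ) ⊗ₖ
      ((A ⊗ₖ (1 : Matrix (Fin d) (Fin d) ℂ)) ⊗ₖ (1 : Matrix (Site d) (Site d) ℂ))
  | .second => (1 : Matrix (Fin 2) (Fin 2) ℂ) ⊗ₖ
      ((1 : Matrix (Site d) (Site d) ℂ) ⊗ₖ (A ⊗ₖ (1 : Matrix (Fin d) (Fin d) ℂ)))

/-- The swap operator of `S₁` and `S₂`. -/
def swapSites (d : ℕ) : Matrix (Site d × Site d) (Site d × Site d) ℂ :=
  Matrix.of fun p p' => if p.1 = p'.2 ∧ p.2 = p'.1 then 1 else 0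

/-- The controlled swap `|0⟩⟨0| ⊗ 1 + |1⟩⟨1| ⊗ SWAP`, controlled by the ancilla. -/
def controlledSwap (d : ℕ) : MemOp d :=
  Matrix.single (0 : Fin 2) (0 : Fin 2) (1 : ℂ) ⊗ₖ
      (1 : Matrix (Site d × Site d) (Site d × Site d) ℂ) +
    Matrix.single (1 : Fin 2) (1 : Fin 2) (1 : ℂ) ⊗ₖ swapSites d

/-- `K X K†`. -/
def conjBy {d : ℕ} (K X : MemOp d) : MemOp d := K * X * K.conjTranspose

/-- Discard (trace out) the content of a qubit and replace it by `|0⟩`. -/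
def resetQubit {d : ℕ} (q : QubitReg) (X : MemOp d) : MemOp d :=
  ∑ k : Fin 2, conjBy (onQubit q (Matrix.single 0 k 1)) X

/-- Discard (trace out) the content of a qudit and replace it by a fresh copy of `ρ`. -/
def loadQudit {d : ℕ} (ρ : Matrix (Fin d) (Fin d) ℂ) (s : QuditReg) (X : MemOp d) : MemOp d :=
  match s with
  | .first => Matrix.of fun (a, (c, x), s₂) (a', (c', x'), s₂') =>
      (∑ z : Fin d, X (a, (c, z), s₂) (a', (c', z), s₂')) * ρ x x'
  | .second => Matrix.of fun (a, s₁, (b, y)) (a', s₁', (b', y')) =>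
      (∑ z : Fin d, X (a, s₁, (b, z)) (a', s₁', (b', z))) * ρ y y'

/-- The (subnormalised) reduced operator on the qudit of `S₁`. -/
def readQudit {d : ℕ} (X : MemOp d) : Matrix (Fin d) (Fin d) ℂ :=
  Matrix.of fun x x' =>
    ∑ a : Fin 2, ∑ c : Fin 2, ∑ s₂ : Site d, X (a, (c, x), s₂) (a, (c, x'), s₂)

/-- Project the qubit of `S₁` onto the outcome of a measurement in the basis `|0⟩` (`false`),
`|1⟩` (`true`), without renormalising. -/
def measureFirst {d : ℕ} (outcome : Bool) (X : MemOp d) : MemOp d :=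
  conjBy (onQubit .first
    (if outcome then Matrix.single 1 1 1 else Matrix.single 0 0 1)) X

/-! ## Instructions, circuits and their costs -/

/-- Elementary instructions. -/
inductive Instr
  | gate (q : QubitReg) (U : U2)
  | cswap
  | reset (q : QubitReg)
  | load (s : QuditReg)

/-- The action of an instruction on the state of the memory, if the copies that can be requested
are copies of `ρ`. -/
def Instr.apply {d : ℕ} (ρ : Matrix (Fin d) (Fin d) ℂ) : Instr → MemOp d → MemOp d
  | .gate q U, X => conjBy (onQubit q (U : Matrix (Fin 2) (Fin 2) ℂ)) X
  | .cswap, X => conjBy (controlledSwap d) X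
  | .reset q, X => resetQubit q X
  | .load s, X => loadQudit ρ s X

/-- Execute a list of instructions, from left to right. -/
def execute {d : ℕ} (ρ : Matrix (Fin d) (Fin d) ℂ) (prog : List Instr) (X : MemOp d) : MemOp d :=
  prog.foldl (fun Y i => i.apply ρ Y) X

/-- Number of copies of the input state consumed by an instruction. -/
def copyCost : Instr → ℕ
  | .load _ => 1
  | _ => 0

/-- Number of controlled qudit swaps of an instruction. -/
def cswapCost : Instr → ℕ
  | .cswap => 1
  | _ => 0

/-- Number of single-qubit gates of an instruction. -/
def oneQubitCost : Instr → ℕ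
  | .gate _ _ => 1
  | _ => 0

/-- `θ₊ = (arccos((cos t - sin t)/2) + arccos((cos t + sin t)/2))/2`. -/
def thetaPlus (t : ℝ) : ℝ :=
  (Real.arccos ((Real.cos t - Real.sin t) / 2) + Real.arccos ((Real.cos t + Real.sin t) / 2)) / 2

/-- `θ₋ = (arccos((cos t - sin t)/2) - arccos((cos t + sin t)/2))/2`. -/
def thetaMinus (t : ℝ) : ℝ :=
  (Real.arccos ((Real.cos t - Real.sin t) / 2) - Real.arccos ((Real.cos t + Real.sin t) / 2)) / 2

/-- One iteration of the circuit: `S₂` is discarded and replaced by a fresh `|1⟩⟨1| ⊗ ρ`, and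
the fractional swap `exp(-i t SWAP)` of `S₁` and `S₂` is applied, implemented by three controlled
swaps and four gates on the ancilla qubit (which returns to `|0⟩`). -/
def fracSwapStep (t : ℝ) : List Instr :=
  [ .reset .second,
    .gate .second gateX,
    .load .second,
    .gate .ancilla (gateExpX (thetaMinus t)),
    .cswap,
    .gate .ancilla (gateExpY (thetaPlus t) * gateZ * gateExpY (-thetaPlus t)),
    .cswap,
    .gate .ancilla (gateExpX (thetaMinus t) * gateZ * gateExpX (-thetaMinus t)),
    .cswap,
    .gate .ancilla (gateExpY (-thetaPlus t)) ]

/-- The fractional-swap circuit with `r` iterations of step length `t`: prepare the ancilla in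
`|0⟩` and the qubit of `S₁` in `|+⟩`, apply `r` fractional swaps with fresh copies, and
rotate the qubit of `S₁` so that the subsequent measurement in the computational basis
(`measureFirst`) is a measurement in the basis `|+⟩` (`false`), `|-⟩` (`true`). -/
def fracSwapCircuit (r : ℕ) (t : ℝ) : List Instr :=
  [.reset .ancilla, .reset .first, .gate .first gateH] ++
    (List.replicate r (fracSwapStep t)).flatten ++ [.gate .first gateH]

/-! ## Adaptive protocols -/

/-- One round of a protocol: if `fresh`, the qudit of `S₁` is first discarded and replaced by a
fresh copy of the input state (a restart); then the fractional-swap circuit with `r` iterations of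
step length `t` is run and the qubit of `S₁` is measured. -/
structure Round where
  fresh : Bool
  r : ℕ
  t : ℝ
  r_pos : 0 < r
  t_pos : 0 < t

/-- The instructions of a round, up to the measurement. -/
def Round.program (R : Round) : List Instr :=
  (if R.fresh then [.load .first] else []) ++ fracSwapCircuit R.r R.t

/-- A protocol that iterates the fractional-swap circuit: given all the measurement outcomes so far
(most recent first), it either stops (`none`), and then its output is the qudit of `S₁`, or it
executes a further round. -/
abbrev Protocol := List Bool → Option Round

namespace Protocol

variable {d : ℕ}

/-- The subnormalised state of the memory after the outcomes `h` (most recent first) were observed,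
starting from `σ`; its trace is the probability of observing `h`. It is `0` if the protocol
stops before all these outcomes are produced. -/
def state (P : Protocol) (ρ : Matrix (Fin d) (Fin d) ℂ) (σ : MemOp d) : List Bool → MemOp d
  | [] => σ
  | outcome :: h =>
    match P h with
    | none => 0
    | some R => measureFirst outcome (execute ρ R.program (state P ρ σ h))

/-- The outcome sequences after which the protocol stops. -/
abbrev Final (P : Protocol) := {h : List Bool // P h = none}

/-- The probability that the outcomes `h` are observed. -/
def prob (P : Protocol) (ρ : Matrix (Fin d) (Fin d) ℂ) (σ : MemOp d) (h : List Bool) : ℝ≥0∞ :=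
  ENNReal.ofReal (P.state ρ σ h).trace.re

/-- The total cost of all rounds executed along the outcomes `h`. -/
def totalCost (P : Protocol) (cost : Instr → ℕ) : List Bool → ℕ
  | [] => 0
  | _ :: h => totalCost P cost h +
    match P h with
    | none => 0
    | some R => (R.program.map cost).sum

/-- The probability that the protocol stops. -/
def stopProb (P : Protocol) (ρ : Matrix (Fin d) (Fin d) ℂ) (σ : MemOp d) : ℝ≥0∞ :=
  ∑' h : P.Final, P.prob ρ σ h.1

/-- The expected total cost (for a protocol that stops almost surely). -/
def expectedCost (P : Protocol) (cost : Instr → ℕ) (ρ : Matrix (Fin d) (Fin d) ℂ)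
    (σ : MemOp d) : ℝ≥0∞ :=
  ∑' h : P.Final, P.prob ρ σ h.1 * (P.totalCost cost h.1 : ℝ≥0∞)

/-- `ρout` is the state of the output qudit when the protocol stops. -/
def HasOutput (P : Protocol) (ρ : Matrix (Fin d) (Fin d) ℂ) (σ : MemOp d)
    (ρout : Matrix (Fin d) (Fin d) ℂ) : Prop :=
  HasSum (fun h : P.Final => readQudit (P.state ρ σ h.1)) ρout

end Protocol

end FracSwapDistillation

end

noncomputable section

namespace FracSwapDistillation

/-! ## Strategies: finite decision trees of rounds -/

/-! The problem becomes classical. Once the state of `S₁` is diagonal in the eigenbasis of ρ it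
stays so. A fractional swap with a fresh |1⟩⟨1| ⊗ ρ multiplies the coherence between |0⟩ and |1⟩ on
an eigenvector with eigenvalue x by cos t (cos t + i x sin t) = e^{ixt} + O(t²), and with weight at
most sin² t the qudit is replaced by a fresh copy. So a round acts on eigenvectors as the kernel
`roundKernel` (`readQudit_round`): a ±1 measurement with mean close to cos(x r t), disturbed by O(r
t²). The disturbance of a decision tree is bounded in `Strategy.eval_le_ideal_add`. Since a
replacement is drawn from ρ itself, it leaves the top eigenvector only with the additional factor 1
- λ₁ (`Strategy.eval_le_mul_maxCost`); this is the source of the factor 1 - γ in the cost.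

A threshold test separating x ≥ γ from x ≤ αγ is a noisy binary search for x
(`exists_threshold_test`). Resolving width W takes evolution time of order 1/W, hence of order 1/(W²
d) iterations for disturbance d. The finest level dominates, so the cost is M²/(δ (1-α)² γ²) up to a
constant, for failure probability 128/M and total disturbance δ, without logarithms.

An attempt (`exists_attempt`) is a chain of K tests with disturbances δₙ proportional to 2⁻ⁿ. Let gₙ
and bₙ be the weights on and off the top eigenvector after n acceptances. Each test multiplies bₙ by
at most 1/32 and adds at most (1-γ) δₙ gₙ, so bₙ/gₙ is at most (1-γ)(16⁻ⁿ/γ + 2⁻ⁿ), and 2^K of order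
(1-γ)(1/ε + 1/γ) suffices. The numbers of repetitions grow away from both ends of the chain: the
failures are then summable, so gₙ ≤ 2 g_K throughout, while the early tests (many wrong candidates)
and the late ones (expensive) stay cheap. The mean cost is therefore proportional to g_K times the
claimed bound.

Finally the attempt is repeated with fresh copies until acceptance. A value function satisfying a
one-step balance equation (`valueAt_eq`, `hasSum_value`) yields termination, the output spectrum,
and the expected cost as cost per attempt divided by acceptance probability, which cancels g_K. The
output is diagonal in an eigenbasis of ρ, hence commutes with it. -/

/-- A finite decision tree whose inner nodes are rounds and whose leaves carry a result. -/
inductive Strategy (A : Type) : Type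
  | done (a : A) : Strategy A
  | run (R : Round) (next : Bool → Strategy A) : Strategy A

/-- The value `+1` or `-1` of a measurement outcome. -/
def outcomeSign (o : Bool) : ℝ := if o then -1 else 1

@[simp] theorem outcomeSign_false : outcomeSign false = 1 := rfl

@[simp] theorem outcomeSign_true : outcomeSign true = -1 := rfl

/-- `cos(t)^(2r)`: the weight with which the qudit survives a round. -/
def Round.damping (R : Round) : ℝ := Real.cos R.t ^ (2 * R.r)

/-- The interference term of a round at eigenvalue `x`. -/
def Round.interference (R : Round) (x : ℝ) : ℝ :=
  (((Real.cos R.t : ℂ) * (Real.cos R.t + Complex.I * x * Real.sin R.t)) ^ R.r).re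

/-- Transition kernel of a round without restart between the eigenvectors of a density operator
with eigenvalues `lam`, jointly with the outcome `o`. -/
def stepKernel {ι : Type*} [DecidableEq ι] (lam : ι → ℝ) (R : Round) (o : Bool) : Matrix ι ι ℝ :=
  Matrix.of fun j j' => ((if j = j' then R.damping + outcomeSign o * R.interference (lam j) else 0) +
    (1 - R.damping) * lam j') / 2

/-- Transition kernel of a round. -/
def roundKernel {ι : Type*} [Fintype ι] [DecidableEq ι] (lam : ι → ℝ) (R : Round) (o : Bool) :
    Matrix ι ι ℝ :=
  if R.fresh then Matrix.of fun _ j' => ∑ k, lam k * stepKernel lam R o k j'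
  else stepKernel lam R o

/-- An upper bound for the deviation of a round from an ideal measurement. -/
def Round.deviation (R : Round) : ℝ := 6 * R.r * R.t ^ 2

theorem Round.deviation_nonneg (R : Round) : 0 ≤ R.deviation := by
  unfold Round.deviation; positivity

/-- The probability of the outcome `o` in an ideal measurement of `cos(x r t)`. -/
def Round.idealProb (R : Round) (x : ℝ) (o : Bool) : ℝ :=
  (1 + outcomeSign o * Real.cos (x * (R.r * R.t))) / 2

theorem Round.idealProb_nonneg (R : Round) (x : ℝ) (o : Bool) : 0 ≤ R.idealProb x o := by
  have h1 := Real.cos_le_one (x * (R.r * R.t))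
  have h2 := Real.neg_one_le_cos (x * (R.r * R.t))
  cases o <;> simp only [Round.idealProb, outcomeSign_false, outcomeSign_true] <;> linarith

theorem Round.idealProb_add (R : Round) (x : ℝ) :
    R.idealProb x true + R.idealProb x false = 1 := by
  simp only [Round.idealProb, outcomeSign_false, outcomeSign_true]; ring

namespace Strategy

variable {A B : Type}

/-- Continue with a strategy that depends on the result. -/
def bind : Strategy A → (A → Strategy B) → Strategy B
  | done a, s => s a
  | run R f, s => run R fun o => (f o).bind s

/-- The maximal total cost along a branch. -/
def maxCost (c : Round → ℝ) : Strategy A → ℝ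
  | done _ => 0
  | run R f => c R + max ((f true).maxCost c) ((f false).maxCost c)

/-- All rounds of the strategy satisfy `p`. -/
def All (p : Round → Prop) : Strategy A → Prop
  | done _ => True
  | run R f => p R ∧ ∀ o, (f o).All p

/-- The expectation of `φ` under ideal measurements on an eigenvector with eigenvalue `x`. -/
def ideal (x : ℝ) (φ : A → ℝ) : Strategy A → ℝ
  | done a => φ a
  | run R f => ∑ o, R.idealProb x o * (f o).ideal x φ

/-- The expectation of the total cost plus `φ`, as a function of the initial eigenvector. -/
def eval {ι : Type*} [Fintype ι] [DecidableEq ι] (lam : ι → ℝ) (c : Round → ℝ)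
    (φ : A → ι → ℝ) : Strategy A → ι → ℝ
  | done a => φ a
  | run R f => fun j => c R + ∑ o, (roundKernel lam R o).mulVec ((f o).eval lam c φ) j

theorem maxCost_nonneg {c : Round → ℝ} (hc : ∀ R, 0 ≤ c R) (t : Strategy A) : 0 ≤ t.maxCost c := by
  induction t with
  | done a => simp [maxCost]
  | run R f ih => simp only [maxCost]; exact add_nonneg (hc R) (le_max_of_le_left (ih true))

theorem maxCost_bind_le {c : Round → ℝ} (t : Strategy A) (s : A → Strategy B) {b : ℝ}
    (h : ∀ a, (s a).maxCost c ≤ b) : (t.bind s).maxCost c ≤ t.maxCost c + b := by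
  induction t with
  | done a => simpa [maxCost, bind] using h a
  | run R f ih =>
    simp only [maxCost, bind, add_assoc]
    gcongr
    rw [← max_add_add_right]
    exact max_le_max (ih true) (ih false)

theorem All.bind {p : Round → Prop} {t : Strategy A} {s : A → Strategy B} (ht : t.All p)
    (hs : ∀ a, (s a).All p) : (t.bind s).All p := by
  induction t with
  | done a => exact hs a
  | run R f ih => exact ⟨ht.1, fun o => ih o (ht.2 o)⟩

theorem ideal_bind (x : ℝ) (φ : B → ℝ) (t : Strategy A) (s : A → Strategy B) :
    (t.bind s).ideal x φ = t.ideal x fun a => (s a).ideal x φ := by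
  induction t with
  | done a => rfl
  | run R f ih => simp only [ideal, Strategy.bind, ih]

theorem ideal_mono {x : ℝ} {φ ψ : A → ℝ} (h : ∀ a, φ a ≤ ψ a) (t : Strategy A) :
    t.ideal x φ ≤ t.ideal x ψ := by
  induction t with
  | done a => exact h a
  | run R f ih =>
    exact Finset.sum_le_sum fun o _ => mul_le_mul_of_nonneg_left (ih o) (R.idealProb_nonneg x o)

theorem ideal_const (x b : ℝ) (t : Strategy A) : t.ideal x (fun _ => b) = b := by
  induction t with
  | done a => rfl
  | run R f ih =>
    simp only [ideal, ih, ← Finset.sum_mul, Fintype.sum_bool, R.idealProb_add, one_mul]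

theorem ideal_add (x : ℝ) (φ ψ : A → ℝ) (t : Strategy A) :
    t.ideal x (fun a => φ a + ψ a) = t.ideal x φ + t.ideal x ψ := by
  induction t with
  | done a => rfl
  | run R f ih => simp only [ideal, ih, mul_add, Finset.sum_add_distrib]

theorem ideal_mul_left (x b : ℝ) (φ : A → ℝ) (t : Strategy A) :
    t.ideal x (fun a => b * φ a) = b * t.ideal x φ := by
  induction t with
  | done a => rfl
  | run R f ih => simp only [ideal, ih, Finset.mul_sum]; congr! 1; ring

section eval

variable {ι : Type*} [Fintype ι] [DecidableEq ι] {lam : ι → ℝ}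

theorem eval_bind (c : Round → ℝ) (φ : B → ι → ℝ) (t : Strategy A) (s : A → Strategy B) :
    (t.bind s).eval lam c φ = t.eval lam c fun a => (s a).eval lam c φ := by
  induction t with
  | done a => rfl
  | run R f ih => simp only [eval, Strategy.bind, ih]

theorem eval_add (c c' : Round → ℝ) (φ φ' : A → ι → ℝ) (t : Strategy A) :
    t.eval lam (c + c') (φ + φ') = t.eval lam c φ + t.eval lam c' φ' := by
  induction t with
  | done a => rfl
  | run R f ih =>
    ext j
    simp only [eval, ih, Matrix.mulVec_add, Pi.add_apply, Finset.sum_add_distrib]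
    ring

theorem eval_smul (b : ℝ) (c : Round → ℝ) (φ : A → ι → ℝ) (t : Strategy A) :
    t.eval lam (b • c) (b • φ) = b • t.eval lam c φ := by
  induction t with
  | done a => rfl
  | run R f ih =>
    ext j
    simp only [eval, ih, Matrix.mulVec_smul, Pi.smul_apply, smul_eq_mul, mul_add, Finset.mul_sum]

end eval

end Strategy

/-! ## Estimates for the transition kernels -/

theorem Round.damping_le_one (R : Round) : R.damping ≤ 1 := by
  rw [Round.damping, pow_mul]
  exact pow_le_one₀ (sq_nonneg _) (Real.cos_sq_le_one _)

/-- Convexity of the r-th power along the segment from x to 1. -/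
theorem mix_pow_le {x l : ℝ} (hx : 0 ≤ x) (hx1 : x ≤ 1) (hl : 0 ≤ l) (hl1 : l ≤ 1) (r : ℕ) :
    (x + l * (1 - x)) ^ r ≤ x ^ r + l * (1 - x ^ r) := by
  induction r with
  | zero => simp
  | succ r ih =>
    have hp : 0 ≤ x ^ r := by positivity
    have hp1 : x ^ r ≤ 1 := pow_le_one₀ hx hx1
    have h0 : 0 ≤ x + l * (1 - x) := by nlinarith
    rw [pow_succ]
    refine (mul_le_mul_of_nonneg_right ih h0).trans ?_
    have : 0 ≤ l * (1 - l) * ((1 - x) * (1 - x ^ r)) :=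
      mul_nonneg (mul_nonneg hl (by linarith)) (mul_nonneg (by linarith) (by linarith))
    rw [pow_succ]
    nlinarith

theorem Round.norm_interference_base_sq (R : Round) (x : ℝ) :
    ‖(Real.cos R.t : ℂ) * (Real.cos R.t + Complex.I * x * Real.sin R.t)‖ ^ 2 =
      Real.cos R.t ^ 2 * (Real.cos R.t ^ 2 + x ^ 2 * Real.sin R.t ^ 2) := by
  rw [← Complex.normSq_eq_norm_sq, Complex.normSq_apply]
  simp [-Complex.ofReal_cos, -Complex.ofReal_sin]
  ring

/-- With c = cos t and s = sin t, the squares of the two sides are c⁴ + x² c² s² and c⁴ + 2x c² s² +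
x² s⁴, and x² ≤ 2x. -/
theorem Round.norm_interference_base_le (R : Round) {x : ℝ} (hx : 0 ≤ x) (hx1 : x ≤ 1) :
    ‖(Real.cos R.t : ℂ) * (Real.cos R.t + Complex.I * x * Real.sin R.t)‖ ≤
      Real.cos R.t ^ 2 + x * (1 - Real.cos R.t ^ 2) := by
  have h := Real.sin_sq_add_cos_sq R.t
  have h1 : 1 - Real.cos R.t ^ 2 = Real.sin R.t ^ 2 := by linarith
  rw [h1]
  refine le_of_sq_le_sq ?_ (by positivity)
  rw [R.norm_interference_base_sq]
  have : 0 ≤ x * (2 - x) * (Real.cos R.t ^ 2 * Real.sin R.t ^ 2) :=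
    mul_nonneg (mul_nonneg hx (by linarith)) (by positivity)
  nlinarith [sq_nonneg (x * Real.sin R.t ^ 2)]

/-- This is exactly what makes the diagonal entries of `stepKernel` nonnegative for both outcomes:
the replacement term covers any excess of the interference over the damping. -/
theorem Round.abs_interference_le (R : Round) {x : ℝ} (hx : 0 ≤ x) (hx1 : x ≤ 1) :
    |R.interference x| ≤ R.damping + x * (1 - R.damping) := by
  refine (Complex.abs_re_le_norm _).trans ?_
  rw [norm_pow, Round.damping, pow_mul]
  exact (pow_le_pow_left₀ (norm_nonneg _) (R.norm_interference_base_le hx hx1) _).trans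
    (mix_pow_le (sq_nonneg _) (Real.cos_sq_le_one _) hx hx1 _)

/-- Bernoulli's inequality for (1 - sin² t)^r. -/
theorem Round.one_sub_damping_le (R : Round) : 1 - R.damping ≤ R.r * R.t ^ 2 := by
  have h := one_add_mul_le_pow (a := -(Real.sin R.t ^ 2)) (by nlinarith [Real.sin_sq_le_one R.t]) R.r
  have h1 : 1 + -(Real.sin R.t ^ 2) = Real.cos R.t ^ 2 := by
    have := Real.sin_sq_add_cos_sq R.t; linarith
  rw [h1, ← pow_mul] at h
  have h2 : Real.sin R.t ^ 2 ≤ R.t ^ 2 := sq_le_sq.2 (by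
    rw [abs_of_pos R.t_pos]; simpa [abs_of_pos R.t_pos] using Real.abs_sin_le_abs (x := R.t))
  have h3 : (R.r : ℝ) * Real.sin R.t ^ 2 ≤ R.r * R.t ^ 2 := by gcongr
  rw [Round.damping]
  linarith

theorem norm_pow_sub_pow_le {a b : ℂ} (ha : ‖a‖ ≤ 1) (hb : ‖b‖ ≤ 1) (r : ℕ) :
    ‖a ^ r - b ^ r‖ ≤ r * ‖a - b‖ := by
  induction r with
  | zero => simp
  | succ r ih =>
    have : a ^ (r + 1) - b ^ (r + 1) = a ^ r * (a - b) + (a ^ r - b ^ r) * b := by ring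
    rw [this]
    refine (norm_add_le _ _).trans ?_
    rw [norm_mul, norm_mul, norm_pow]
    have h1 : ‖a‖ ^ r * ‖a - b‖ ≤ 1 * ‖a - b‖ := by
      gcongr; exact pow_le_one₀ (norm_nonneg _) ha
    have h2 : ‖a ^ r - b ^ r‖ * ‖b‖ ≤ ‖a ^ r - b ^ r‖ * 1 := by gcongr
    push_cast
    linarith

theorem abs_sin_sub_self_le {x : ℝ} (hx : 0 ≤ x) : |Real.sin x - x| ≤ x ^ 2 := by
  have h1 := Real.sin_le hx
  rw [abs_of_nonpos (by linarith)]
  by_cases h : x ≤ 1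
  · rcases hx.eq_or_lt with rfl | hx0
    · simp
    have := Real.sin_gt_sub_cube hx0
    nlinarith
  · have := Real.neg_one_le_sin x
    push Not at h
    -- For x > 1 either sin x ≥ 0 and x ≤ x² suffices, or x ≥ 2 and 1 + x ≤ x².
    have h2 : 0 ≤ Real.sin x ∨ 2 ≤ x := by
      by_cases h3 : x ≤ 2
      · left; exact Real.sin_nonneg_of_nonneg_of_le_pi hx (by linarith [Real.pi_gt_three])
      · right; linarith
    rcases h2 with h2 | h2 <;> nlinarith

/-- One iteration differs from the exact phase e^{ixt} by at most 4t². Both factors lie in the unit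
disc, so the errors of r iterations merely add up. -/
theorem Round.abs_interference_sub_cos_le (R : Round) {x : ℝ} (hx : 0 ≤ x) (hx1 : x ≤ 1) :
    |R.interference x - Real.cos (x * (R.r * R.t))| ≤ 4 * (R.r * R.t ^ 2) := by
  set a : ℂ := (Real.cos R.t : ℂ) * (Real.cos R.t + Complex.I * x * Real.sin R.t) with ha
  set b : ℂ := Complex.exp ((x * R.t : ℝ) * Complex.I) with hb
  have hb' : b ^ R.r = Complex.exp ((x * (R.r * R.t) : ℝ) * Complex.I) := by
    rw [hb, ← Complex.exp_nat_mul]; congr 1; push_cast; ring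
  have hbre : (b ^ R.r).re = Real.cos (x * (R.r * R.t)) := by
    rw [hb', Complex.exp_ofReal_mul_I_re]
  have ha1 : ‖a‖ ≤ 1 := by
    refine (R.norm_interference_base_le hx hx1).trans ?_
    nlinarith [Real.cos_sq_le_one R.t]
  have hb1 : ‖b‖ ≤ 1 := by rw [hb, Complex.norm_exp_ofReal_mul_I]
  have ht := R.t_pos
  have hab : ‖a - b‖ ≤ 4 * R.t ^ 2 := by
    refine (Complex.norm_le_abs_re_add_abs_im _).trans ?_
    have hre : (a - b).re = Real.cos R.t ^ 2 - Real.cos (x * R.t) := by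
      rw [Complex.sub_re, hb, Complex.exp_ofReal_mul_I_re]; simp [ha, -Complex.ofReal_cos, -Complex.ofReal_sin]; ring
    have him : (a - b).im = x * (Real.sin R.t * Real.cos R.t) - Real.sin (x * R.t) := by
      rw [Complex.sub_im, hb, Complex.exp_ofReal_mul_I_im]; simp [ha, -Complex.ofReal_cos, -Complex.ofReal_sin]; ring
    have hxt : x * R.t ≤ R.t := by nlinarith
    have hxt0 : 0 ≤ x * R.t := by positivity
    have hxt2 : (x * R.t) ^ 2 ≤ R.t ^ 2 := by gcongr
    have hs : Real.sin R.t ^ 2 ≤ R.t ^ 2 := sq_le_sq.2 (by simpa using Real.abs_sin_le_abs (x := R.t))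
    have h1 : |(a - b).re| ≤ R.t ^ 2 := by
      rw [hre, abs_le]
      have e1 := Real.one_sub_sq_div_two_le_cos (x := x * R.t)
      have e2 := Real.cos_le_one (x * R.t)
      have e3 := Real.sin_sq_add_cos_sq R.t
      have e4 := Real.cos_sq_le_one R.t
      constructor <;> nlinarith
    have h2 : |(a - b).im| ≤ 3 * R.t ^ 2 := by
      rw [him]
      -- As sin t cos t = sin(2t)/2, the estimate at 2t contributes 2t², and the one at xt
      -- contributes t².
      have e1 := abs_sin_sub_self_le (x := 2 * R.t) (by positivity)
      have e2 := abs_sin_sub_self_le hxt0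
      rw [Real.sin_two_mul] at e1
      rw [abs_le] at e1 e2 ⊢
      constructor <;> nlinarith
    linarith
  calc |R.interference x - Real.cos (x * (R.r * R.t))| = |(a ^ R.r - b ^ R.r).re| := by
        rw [Complex.sub_re, hbre]; rfl
    _ ≤ ‖a ^ R.r - b ^ R.r‖ := Complex.abs_re_le_norm _
    _ ≤ R.r * ‖a - b‖ := norm_pow_sub_pow_le ha1 hb1 _
    _ ≤ R.r * (4 * R.t ^ 2) := by gcongr
    _ = _ := by ring

/-- `lam` is a probability distribution. -/
structure IsDistribution {ι : Type*} [Fintype ι] (lam : ι → ℝ) : Prop where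
  nonneg : ∀ j, 0 ≤ lam j
  sum_eq_one : ∑ j, lam j = 1

section kernel

variable {ι : Type*} [Fintype ι] {lam : ι → ℝ}

theorem IsDistribution.le_one (h : IsDistribution lam) (j : ι) : lam j ≤ 1 := by
  rw [← h.sum_eq_one]
  exact Finset.single_le_sum (fun i _ => h.nonneg i) (Finset.mem_univ j)

theorem mulVec_mono_of_nonneg {K : Matrix ι ι ℝ} (hK : ∀ j j', 0 ≤ K j j') {u v : ι → ℝ}
    (huv : u ≤ v) : K.mulVec u ≤ K.mulVec v := fun j =>
  Finset.sum_le_sum fun j' _ => mul_le_mul_of_nonneg_left (huv j') (hK j j')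

variable [DecidableEq ι]

theorem stepKernel_nonneg (h : IsDistribution lam) (R : Round) (o : Bool) (j j' : ι) :
    0 ≤ stepKernel lam R o j j' := by
  have h1 := R.damping_le_one
  have h2 := h.nonneg j'
  have h3 : 0 ≤ (1 - R.damping) * lam j' := mul_nonneg (by linarith) h2
  simp only [stepKernel, Matrix.of_apply]
  split_ifs with hj
  · subst hj
    have := abs_le.1 (R.abs_interference_le (h.nonneg j) (h.le_one j))
    cases o <;> simp only [outcomeSign_true, outcomeSign_false] <;> linarith
  · linarith

theorem roundKernel_nonneg (h : IsDistribution lam) (R : Round) (o : Bool) (j j' : ι) :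
    0 ≤ roundKernel lam R o j j' := by
  unfold roundKernel
  split_ifs
  · exact Finset.sum_nonneg fun k _ => mul_nonneg (h.nonneg k) (stepKernel_nonneg h R o k j')
  · exact stepKernel_nonneg h R o j j'

theorem stepKernel_mulVec (R : Round) (o : Bool) (u : ι → ℝ) (j : ι) :
    (stepKernel lam R o).mulVec u j = ((R.damping + outcomeSign o * R.interference (lam j)) * u j +
      (1 - R.damping) * ∑ k, lam k * u k) / 2 := by
  simp only [Matrix.mulVec, dotProduct, stepKernel, Matrix.of_apply, div_mul_eq_mul_div, add_mul,
    ← Finset.sum_div, Finset.sum_add_distrib, ite_mul, zero_mul, Finset.sum_ite_eq,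
    Finset.mem_univ, if_true, Finset.mul_sum, mul_assoc]

theorem roundKernel_mulVec_fresh {R : Round} (hR : R.fresh = true) (o : Bool) (u : ι → ℝ) (j : ι) :
    (roundKernel lam R o).mulVec u j = ∑ k, lam k * (stepKernel lam R o).mulVec u k := by
  simp only [roundKernel, hR, if_true, Matrix.mulVec, dotProduct, Matrix.of_apply, Finset.sum_mul,
    Finset.mul_sum]
  rw [Finset.sum_comm]
  simp only [mul_assoc]

theorem sum_stepKernel_mulVec_const (h : IsDistribution lam) (R : Round) (b : ℝ) (j : ι) :
    ∑ o, (stepKernel lam R o).mulVec (fun _ => b) j = b := by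
  simp only [stepKernel_mulVec, Fintype.sum_bool, outcomeSign_true, outcomeSign_false,
    ← Finset.sum_mul, h.sum_eq_one]
  ring

theorem sum_roundKernel_mulVec_const (h : IsDistribution lam) (R : Round) (b : ℝ) (j : ι) :
    ∑ o, (roundKernel lam R o).mulVec (fun _ => b) j = b := by
  by_cases hR : R.fresh = true
  · simp only [roundKernel_mulVec_fresh hR]
    rw [Finset.sum_comm]
    simp only [← Finset.mul_sum, sum_stepKernel_mulVec_const h, ← Finset.sum_mul, h.sum_eq_one,
      one_mul]
  · simp only [roundKernel, hR]
    exact sum_stepKernel_mulVec_const h R b j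

namespace Strategy

variable {A : Type}

theorem eval_mono (h : IsDistribution lam) {c c' : Round → ℝ} {φ ψ : A → ι → ℝ}
    (hc : ∀ R, c R ≤ c' R) (hφ : ∀ a, φ a ≤ ψ a) (t : Strategy A) :
    t.eval lam c φ ≤ t.eval lam c' ψ := by
  induction t with
  | done a => exact hφ a
  | run R f ih =>
    intro j
    exact add_le_add (hc R) (Finset.sum_le_sum fun o _ =>
      mulVec_mono_of_nonneg (roundKernel_nonneg h R o) (ih o) j)

theorem eval_zero_const (h : IsDistribution lam) (b : ℝ) (t : Strategy A) :
    t.eval lam 0 (fun _ _ => b) = fun _ => b := by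
  induction t with
  | done a => rfl
  | run R f ih =>
    ext j
    simp only [eval, ih, sum_roundKernel_mulVec_const h, Pi.zero_apply, zero_add]

theorem eval_nonneg (h : IsDistribution lam) {c : Round → ℝ} {φ : A → ι → ℝ}
    (hc : ∀ R, 0 ≤ c R) (hφ : ∀ a j, 0 ≤ φ a j) (t : Strategy A) (j : ι) :
    0 ≤ t.eval lam c φ j := by
  have := t.eval_mono h (c := 0) (φ := fun _ _ => 0) hc hφ
  rw [eval_zero_const h] at this
  exact this j

theorem eval_le_of_le (h : IsDistribution lam) {b : ℝ} {φ : A → ι → ℝ}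
    (hφ : ∀ a j, φ a j ≤ b) (t : Strategy A) (j : ι) :
    t.eval lam 0 φ j ≤ b := by
  have := t.eval_mono h (c := 0) (fun _ => le_rfl) hφ
  rw [eval_zero_const h] at this
  exact this j

theorem eval_zero_le_maxCost (h : IsDistribution lam) (c : Round → ℝ) (t : Strategy A) (j : ι) :
    t.eval lam c 0 j ≤ t.maxCost c := by
  induction t generalizing j with
  | done a => exact le_rfl
  | run R f ih =>
    set m := max ((f true).maxCost c) ((f false).maxCost c) with hm
    have : ∀ o, (f o).eval lam c 0 ≤ fun _ => m := by
      intro o k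
      refine (ih o k).trans ?_
      cases o
      exacts [le_max_right _ _, le_max_left _ _]
    simp only [eval, maxCost]
    gcongr
    rw [← hm, ← sum_roundKernel_mulVec_const h R m j]
    exact Finset.sum_le_sum fun o _ =>
      mulVec_mono_of_nonneg (roundKernel_nonneg h R o) (this o) j

/-- The actual probability of a result differs from the ideal one by at most the total
deviation. -/
theorem eval_le_ideal_add (h : IsDistribution lam) {φ : A → ι → ℝ} {ψ : A → ℝ}
    (h0 : ∀ a j, 0 ≤ φ a j) (h1 : ∀ a j, φ a j ≤ 1) {j : ι} (hψ : ∀ a, φ a j ≤ ψ a)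
    {t : Strategy A} (ht : t.All fun R => R.fresh = false) :
    t.eval lam 0 φ j ≤ t.ideal (lam j) ψ + t.maxCost Round.deviation := by
  induction t with
  | done a => simpa [eval, ideal, maxCost] using hψ a
  | run R f ih =>
    set m := max ((f true).maxCost Round.deviation) ((f false).maxCost Round.deviation) with hm
    have key : ∀ o, (roundKernel lam R o).mulVec ((f o).eval lam 0 φ) j ≤
        R.idealProb (lam j) o * ((f o).ideal (lam j) ψ + m) + R.deviation / 2 := by
      intro o
      have hR : R.fresh = false := ht.1
      simp only [roundKernel, hR, Bool.false_eq_true, if_false]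
      rw [stepKernel_mulVec]
      set u := (f o).eval lam 0 φ
      have hu0 : ∀ k, 0 ≤ u k := fun k => eval_nonneg h (fun _ => le_rfl) h0 _ k
      have hu1 : ∀ k, u k ≤ 1 := fun k => eval_le_of_le h h1 _ k
      have hs : ∑ k, lam k * u k ≤ 1 := by
        rw [← h.sum_eq_one]
        exact Finset.sum_le_sum fun k _ => mul_le_of_le_one_right (h.nonneg k) (hu1 k)
      have hd := R.damping_le_one
      have hd' := R.one_sub_damping_le
      have hi := abs_le.1 (R.abs_interference_sub_cos_le (h.nonneg j) (h.le_one j))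
      have hu : u j ≤ (f o).ideal (lam j) ψ + m := by
        refine (ih o (ht.2 o)).trans ?_
        gcongr
        cases o
        exacts [le_max_right _ _, le_max_left _ _]
      have hp := R.idealProb_nonneg (lam j) o
      have e1 : R.damping + outcomeSign o * R.interference (lam j) ≤
          2 * R.idealProb (lam j) o + 4 * (R.r * R.t ^ 2) := by
        unfold Round.idealProb
        cases o <;> simp only [outcomeSign_true, outcomeSign_false] <;> linarith
      have e2 : (R.damping + outcomeSign o * R.interference (lam j)) * u j ≤
          2 * (R.idealProb (lam j) o * u j) + 4 * (R.r * R.t ^ 2) := by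
        have q : 0 ≤ 4 * (R.r * R.t ^ 2) := by positivity
        have := mul_le_mul_of_nonneg_right e1 (hu0 j)
        nlinarith [mul_le_mul_of_nonneg_left (hu1 j) q]
      have e3 : (1 - R.damping) * ∑ k, lam k * u k ≤ R.r * R.t ^ 2 := by
        nlinarith
      have e4 := mul_le_mul_of_nonneg_left hu hp
      have q : 0 ≤ R.r * R.t ^ 2 := by positivity
      -- Per outcome the loss is (4 + 1) r t² / 2: interference error plus replacement. The constant
      -- 6 in the deviation leaves slack.
      unfold Round.deviation
      linarith
    have := Finset.sum_le_sum fun o (_ : o ∈ Finset.univ) => key o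
    simp only [eval, ideal, maxCost, ← hm, Pi.zero_apply, zero_add]
    refine this.trans (le_of_eq ?_)
    have hp := R.idealProb_add (lam j)
    simp only [Fintype.sum_bool]
    linear_combination m * hp

/-- An eigenvector with eigenvalue `lam i` is replaced by another one with a probability that is
smaller than the total deviation by a factor `1 - lam i`. -/
theorem eval_le_mul_maxCost (h : IsDistribution lam) {φ : A → ι → ℝ} {i : ι}
    (h1 : ∀ a j, φ a j ≤ 1) (hi : ∀ a, φ a i = 0)
    {t : Strategy A} (ht : t.All fun R => R.fresh = false) :
    t.eval lam 0 φ i ≤ (1 - lam i) * t.maxCost Round.deviation := by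
  induction t with
  | done a => simp [eval, maxCost, hi]
  | run R f ih =>
    set m := max ((f true).maxCost Round.deviation) ((f false).maxCost Round.deviation) with hm
    have hl : 0 ≤ 1 - lam i := by linarith [h.le_one i]
    have hd := R.damping_le_one
    have key : ∀ o, (roundKernel lam R o).mulVec ((f o).eval lam 0 φ) i ≤
        stepKernel lam R o i i * ((1 - lam i) * m) + (1 - R.damping) * (1 - lam i) / 2 := by
      intro o
      have hR : R.fresh = false := ht.1
      simp only [roundKernel, hR, Bool.false_eq_true, if_false]
      rw [Matrix.mulVec, dotProduct, ← Finset.add_sum_erase _ _ (Finset.mem_univ i)]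
      set u := (f o).eval lam 0 φ
      have hu1 : ∀ k, u k ≤ 1 := fun k => eval_le_of_le h h1 _ k
      gcongr
      · exact stepKernel_nonneg h R o i i
      · refine (ih o (ht.2 o)).trans ?_
        gcongr
        cases o
        exacts [le_max_right _ _, le_max_left _ _]
      -- A replacement is a sample from `lam`, so it misses `i` with probability exactly 1 - lam i.
      · have hs : ∑ k ∈ Finset.univ.erase i, lam k = 1 - lam i := by
          rw [← h.sum_eq_one, ← Finset.add_sum_erase _ _ (Finset.mem_univ i)]; ring
        rw [← hs, Finset.mul_sum, Finset.sum_div]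
        refine Finset.sum_le_sum fun k hk => ?_
        have hki : i ≠ k := (Finset.ne_of_mem_erase hk).symm
        refine (mul_le_of_le_one_right (stepKernel_nonneg h R o i k) (hu1 k)).trans (le_of_eq ?_)
        simp [stepKernel, hki]
    have := Finset.sum_le_sum fun o (_ : o ∈ Finset.univ) => key o
    simp only [eval, maxCost, ← hm, Pi.zero_apply, zero_add]
    refine this.trans ?_
    have hm0 : 0 ≤ m := le_max_of_le_left (maxCost_nonneg Round.deviation_nonneg _)
    have e1 : stepKernel lam R true i i + stepKernel lam R false i i ≤ 1 := by
      simp only [stepKernel, Matrix.of_apply, if_true, outcomeSign_true, outcomeSign_false]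
      nlinarith [h.le_one i]
    have e2 : 1 - R.damping ≤ R.deviation := by
      have q : 0 ≤ R.r * R.t ^ 2 := by positivity
      have := R.one_sub_damping_le
      unfold Round.deviation; linarith
    have e3 := mul_le_mul_of_nonneg_right e1 (mul_nonneg hl hm0)
    have e4 := mul_le_mul_of_nonneg_right e2 hl
    simp only [Fintype.sum_bool]
    linarith

/-- Total mass one splits into ψ at `i`, ψ away from `i`, and 1 - ψ. The last two have upper bounds,
each costing at most one deviation; hence the factor 2. -/
theorem ideal_sub_le_eval (h : IsDistribution lam) {ψ : A → ℝ} {i : ι}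
    (h0 : ∀ a, 0 ≤ ψ a) (h1 : ∀ a, ψ a ≤ 1)
    {t : Strategy A} (ht : t.All fun R => R.fresh = false) :
    t.ideal (lam i) ψ - 2 * t.maxCost Round.deviation ≤
      t.eval lam 0 (fun a j => if j = i then ψ a else 0) i := by
  have e1 := eval_le_ideal_add h (φ := fun a _ => 1 - ψ a) (ψ := fun a => 1 - ψ a) (j := i)
    (fun a _ => by linarith [h1 a]) (fun a _ => by linarith [h0 a]) (fun a => le_rfl) ht
  have e2 := eval_le_mul_maxCost h (φ := fun a j => if j = i then 0 else ψ a) (i := i)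
    (fun a j => by split_ifs; exacts [zero_le_one, h1 a]) (fun a => by simp) ht
  have e3 : t.ideal (lam i) ψ + t.ideal (lam i) (fun a => 1 - ψ a) = 1 := by
    rw [← ideal_add]; simp [ideal_const]
  have e4 := eval_zero_const h 1 t
  have e5 : (fun (_ : A) (_ : ι) => (1 : ℝ)) = ((fun a j => if j = i then ψ a else 0) +
      (fun a j => if j = i then 0 else ψ a)) + fun a _ => 1 - ψ a := by
    ext a j; simp only [Pi.add_apply]; split_ifs <;> ring
  rw [e5, show (0 : Round → ℝ) = 0 + 0 + 0 by simp, eval_add, eval_add] at e4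
  have e6 := congrFun e4 i
  simp only [Pi.add_apply] at e6
  have hm := maxCost_nonneg Round.deviation_nonneg t
  nlinarith [h.nonneg i]

end Strategy

end kernel

/-! ## Repeated rounds -/

/-- Repeat a round `n` times and add the sum of the outcomes to `s`. -/
def vote (R : Round) : ℕ → ℝ → Strategy ℝ
  | 0, s => .done s
  | n + 1, s => .run R fun o => vote R n (s + outcomeSign o)

/-- The outcomes are independent signs with mean c = cos(x r t) and variance 1 - c². -/
theorem vote_ideal_sq (R : Round) (x b : ℝ) (n : ℕ) (s : ℝ) :
    (vote R n s).ideal x (fun S => (S - b) ^ 2) =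
      (s + n * Real.cos (x * (R.r * R.t)) - b) ^ 2 +
        n * (1 - Real.cos (x * (R.r * R.t)) ^ 2) := by
  induction n generalizing s with
  | zero => simp [vote, Strategy.ideal]
  | succ n ih =>
    simp only [vote, Strategy.ideal, ih, Fintype.sum_bool, Round.idealProb, outcomeSign_true,
      outcomeSign_false]
    push_cast
    ring

theorem vote_all {p : Round → Prop} {R : Round} (hR : p R) (n : ℕ) (s : ℝ) :
    (vote R n s).All p := by
  induction n generalizing s with
  | zero => trivial
  | succ n ih => exact ⟨hR, fun o => ih _⟩

theorem vote_maxCost (c : Round → ℝ) (R : Round) (n : ℕ) (s : ℝ) :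
    (vote R n s).maxCost c = n * c R := by
  induction n generalizing s with
  | zero => simp [vote, Strategy.maxCost]
  | succ n ih => simp only [vote, Strategy.maxCost, ih, max_self]; push_cast; ring

/-- Chebyshev's inequality for the sum of `n` outcomes. -/
theorem vote_ideal_le (R : Round) {x : ℝ} {n : ℕ} (hn : 0 < n) {φ : ℝ → ℝ}
    (h : ∀ S, φ S ≤ 64 / n ^ 2 * (S - n * Real.cos (x * (R.r * R.t))) ^ 2) :
    (vote R n 0).ideal x φ ≤ 64 / n := by
  refine (Strategy.ideal_mono h _).trans ?_
  rw [Strategy.ideal_mul_left, vote_ideal_sq]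
  have hn' : (0 : ℝ) < n := by exact_mod_cast hn
  have : (64 : ℝ) / n = 64 / n ^ 2 * n := by field_simp
  rw [this]
  gcongr
  nlinarith [sq_nonneg (Real.cos (x * (R.r * R.t)))]

/-! ## Binary search for the eigenvalue -/

/-- The number of half turns at the midpoint of the window `[a, a + w]`. -/
def probeIndex (a w : ℝ) : ℕ := ⌊(a + w / 2) / (2 * w)⌋₊

/-- The evolution time for which the midpoint of the window `[a, a + w]` acquires the phase
`(m + 1/2) π`. -/
def probeTime (a w : ℝ) : ℝ := (2 * probeIndex a w + 1) * Real.pi / (2 * (a + w / 2))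

/-- The time is of order 1/w: the upper bound keeps the phases of the window within a quarter turn
of the midpoint phase, where the sine is monotone, and the lower bound gives the outcomes a definite
bias. With μ the midpoint and m the probe index, both follow from 2wm ≤ μ < 2w(m + 1). -/
theorem probeTime_bounds {a w : ℝ} (ha : 0 ≤ a) (hw : 0 < w) :
    0 < probeTime a w ∧ Real.pi / 4 ≤ w * probeTime a w ∧ w * probeTime a w ≤ Real.pi := by
  set μ := a + w / 2 with hμ
  have hμ0 : 0 < μ := by positivity
  have hpi := Real.pi_pos
  have h1 : (probeIndex a w : ℝ) ≤ μ / (2 * w) := Nat.floor_le (by positivity)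
  have h2 : μ / (2 * w) < probeIndex a w + 1 := Nat.lt_floor_add_one _
  rw [le_div_iff₀ (by positivity)] at h1
  rw [div_lt_iff₀ (by positivity)] at h2
  have hm : (0 : ℝ) ≤ probeIndex a w := by positivity
  refine ⟨by unfold probeTime; positivity, ?_, ?_⟩
  · rw [probeTime, ← hμ, mul_div_assoc', div_le_div_iff₀ (by norm_num) (by positivity)]
    nlinarith [mul_nonneg hm hw.le]
  · rw [probeTime, ← hμ, mul_div_assoc', div_le_iff₀ (by positivity)]
    have : (2 * (probeIndex a w : ℝ) + 1) * w ≤ 2 * μ := by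
      -- For m = 0 the floor gives nothing, but μ ≥ w/2 because a ≥ 0.
      rcases Nat.eq_zero_or_pos (probeIndex a w) with hz | hz
      · rw [hz]; push_cast; linarith
      · have : (1 : ℝ) ≤ probeIndex a w := by exact_mod_cast hz
        nlinarith
    nlinarith

theorem abs_probe_phase_le {a w x : ℝ} (ha : 0 ≤ a) (hw : 0 < w) (hx : a ≤ x) (hx' : x ≤ a + w) :
    |x - (a + w / 2)| * probeTime a w ≤ Real.pi / 2 := by
  obtain ⟨h0, -, h2⟩ := probeTime_bounds ha hw
  have : |x - (a + w / 2)| ≤ w / 2 := abs_le.2 ⟨by linarith, by linarith⟩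
  nlinarith

/-- The orientation of the outcomes relative to the midpoint of the window. -/
def probeSign (a w : ℝ) : ℝ := -(-1) ^ probeIndex a w

/-- The midpoint has phase (m + 1/2)π, which turns the cosine into the sine of the offset, up to the
sign (-1)^(m+1). -/
theorem probeSign_mul_cos {a w : ℝ} (ha : 0 ≤ a) (hw : 0 < w) (x : ℝ) :
    probeSign a w * Real.cos (x * probeTime a w) =
      Real.sin ((x - (a + w / 2)) * probeTime a w) := by
  have e : x * probeTime a w =
      ((x - (a + w / 2)) * probeTime a w + Real.pi / 2) + probeIndex a w * Real.pi := by
    have : (a + w / 2) * probeTime a w = (probeIndex a w + 1 / 2) * Real.pi := by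
      have : 0 < a + w / 2 := by positivity
      rw [probeTime]; field_simp
    linear_combination this
  rw [e, Real.cos_add_nat_mul_pi, Real.cos_add_pi_div_two, probeSign]
  have : ((-1 : ℝ) ^ probeIndex a w) * (-1) ^ probeIndex a w = 1 := by
    rw [← mul_pow]; simp
  linear_combination Real.sin ((x - (a + w / 2)) * probeTime a w) * this

theorem probeSign_mul_self (a w : ℝ) : probeSign a w * probeSign a w = 1 := by
  rw [probeSign, neg_mul_neg, ← mul_pow]; simp

/-- An offset of w/4 has phase at least π/16, and Jordan's inequality sin y ≥ 2y/π gives 1/8.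
Nothing is claimed in the middle half of the window. -/
theorem probe_bias {a w x : ℝ} (ha : 0 ≤ a) (hw : 0 < w) (hx : a ≤ x) (hx' : x ≤ a + w) :
    (w / 4 ≤ x - (a + w / 2) → 1 / 8 ≤ probeSign a w * Real.cos (x * probeTime a w)) ∧
    (x - (a + w / 2) ≤ -(w / 4) → probeSign a w * Real.cos (x * probeTime a w) ≤ -(1 / 8)) := by
  obtain ⟨h0, h1, h2⟩ := probeTime_bounds ha hw
  have h3 := abs_probe_phase_le ha hw hx hx'
  have hpi := Real.pi_pos
  have key : ∀ y, w / 4 ≤ y → y * probeTime a w ≤ Real.pi / 2 →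
      1 / 8 ≤ Real.sin (y * probeTime a w) := by
    intro y hy hy2
    have e1 : Real.pi / 16 ≤ y * probeTime a w := by nlinarith
    refine le_trans ?_ (Real.mul_le_sin (by linarith) hy2)
    rw [div_mul_eq_mul_div, le_div_iff₀ hpi]
    linarith
  rw [probeSign_mul_cos ha hw]
  constructor
  · intro h
    rw [abs_of_nonneg (by linarith)] at h3
    exact key _ h h3
  · intro h
    rw [abs_of_nonpos (by linarith)] at h3
    have := key _ (by linarith) h3
    rw [neg_mul, Real.sin_neg] at this
    linarith

/-- A round of total evolution time `T` without restart. -/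
def probeRound (T : ℝ) (r : ℕ) : Round where
  fresh := false
  r := r + 1
  -- The value 1 only ensures a positive step length; the search uses positive `T`.
  t := if 0 < T then T / (r + 1) else 1
  r_pos := r.succ_pos
  t_pos := by split_ifs <;> positivity

theorem probeRound_time {T : ℝ} (hT : 0 < T) (r : ℕ) :
    ((probeRound T r).r : ℝ) * (probeRound T r).t = T := by
  simp only [probeRound, hT, if_true]
  push_cast
  field_simp

theorem probeRound_deviation {T : ℝ} (hT : 0 < T) (r : ℕ) :
    (probeRound T r).deviation = 6 * T ^ 2 / (r + 1) := by
  simp only [Round.deviation, probeRound, hT, if_true]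
  push_cast
  field_simp

/-- The width of the window when `j` levels of the search are left. -/
def windowWidth (w : ℝ) (j : ℕ) : ℝ := w * (4 / 3) ^ j

theorem windowWidth_succ (w : ℝ) (j : ℕ) : windowWidth w (j + 1) = 4 / 3 * windowWidth w j := by
  rw [windowWidth, windowWidth, pow_succ]; ring

theorem windowWidth_pos {w : ℝ} (hw : 0 < w) (j : ℕ) : 0 < windowWidth w j := by
  unfold windowWidth; positivity

/-- Search for the eigenvalue in a window with lower end `a`, on `j` levels; in every level the
window shrinks by a factor `3/4`, by a majority vote of `M j²` rounds with `r j` iterations. -/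
def search (w : ℝ) (M : ℕ) (r : ℕ → ℕ) : ℕ → ℝ → Strategy ℝ
  | 0, a => .done a
  | j + 1, a =>
    (vote (probeRound (probeTime a (windowWidth w (j + 1))) (r j)) (M * (j + 1) ^ 2) 0).bind
      fun S => search w M r j
        (if 0 < probeSign a (windowWidth w (j + 1)) * S then a + windowWidth w (j + 1) / 4 else a)

theorem search_all (w : ℝ) (M : ℕ) (r : ℕ → ℕ) (j : ℕ) (a : ℝ) :
    (search w M r j a).All fun R => R.fresh = false := by
  induction j generalizing a with
  | zero => trivial
  | succ j ih => exact (vote_all (p := fun R => R.fresh = false) rfl _ _).bind fun S => ih _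

/-- The index counts the levels left, so j = 0 is the finest one. The cost is arbitrary because the
bound is needed both for the deviation and for the number of iterations. -/
theorem search_maxCost_le {w : ℝ} (hw : 0 < w) (M : ℕ) (r : ℕ → ℕ) (c : Round → ℝ) (b : ℕ → ℝ)
    {J : ℕ} (h : ∀ j < J, ∀ a, 0 ≤ a → c (probeRound (probeTime a (windowWidth w (j + 1))) (r j)) ≤ b j)
    {a : ℝ} (ha : 0 ≤ a) :
    (search w M r J a).maxCost c ≤ ∑ j ∈ Finset.range J, M * (j + 1) ^ 2 * b j := by
  induction J generalizing a with
  | zero => simp [search, Strategy.maxCost]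
  | succ J ih =>
    rw [Finset.sum_range_succ, search, add_comm (∑ _ ∈ _, _)]
    have hw' := windowWidth_pos hw (J + 1)
    refine (Strategy.maxCost_bind_le _ _ fun S =>
      ih (fun j hj => h j (hj.trans J.lt_succ_self)) ?_).trans ?_
    · split_ifs <;> positivity
    · gcongr
      rw [vote_maxCost]
      push_cast
      gcongr
      exact h J J.lt_succ_self a ha

/-- The two candidate windows overlap in the middle half, so either decision is right there. In an
outer quarter the outcomes have bias 1/8, and a wrong decision forces the sum at least n/8 away from
its mean. -/
theorem vote_majority_ideal_le {a w x : ℝ} (ha : 0 ≤ a) (hw : 0 < w) (hx : a ≤ x)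
    (hx' : x ≤ a + w) {n : ℕ} (hn : 0 < n) (r : ℕ) :
    (vote (probeRound (probeTime a w) r) n 0).ideal x (fun S =>
      if (if 0 < probeSign a w * S then a + w / 4 else a) ≤ x ∧
        x ≤ (if 0 < probeSign a w * S then a + w / 4 else a) + 3 / 4 * w then 0 else 1) ≤
      64 / n := by
  have hT := (probeTime_bounds ha hw).1
  obtain ⟨h1, h2⟩ := probe_bias ha hw hx hx'
  have hs := probeSign_mul_self a w
  have hn' : (0 : ℝ) < n := by exact_mod_cast hn
  refine vote_ideal_le _ hn fun S => ?_
  rw [probeRound_time hT]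
  set c := Real.cos (x * probeTime a w)
  set κ := probeSign a w
  have hsq : (S - n * c) ^ 2 = (κ * S - n * (κ * c)) ^ 2 := by
    have : (κ * S - n * (κ * c)) ^ 2 = (κ * κ) * (S - n * c) ^ 2 := by ring
    rw [this, hs, one_mul]
  -- The factor 64 = 8² turns a deviation of n/8 into at least 1, as Chebyshev requires.
  have key : ∀ d : ℝ, n / 8 ≤ |d| → 1 ≤ 64 / (n : ℝ) ^ 2 * d ^ 2 := by
    intro d hd
    rw [div_mul_eq_mul_div, le_div_iff₀ (by positivity), ← sq_abs d]
    nlinarith [abs_nonneg d]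
  rw [hsq]
  by_cases hS : 0 < κ * S
  · simp only [hS, if_true]
    split_ifs with hc
    · positivity
    · refine key _ ?_
      have hlt : x < a + w / 4 := by
        by_contra hcon
        exact hc ⟨not_lt.1 hcon, by linarith⟩
      have := h2 (by linarith)
      rw [abs_of_nonneg] <;> nlinarith
  · simp only [hS, if_false]
    split_ifs with hc
    · positivity
    · refine key _ ?_
      have hlt : a + 3 / 4 * w < x := by
        by_contra hcon
        exact hc ⟨hx, not_lt.1 hcon⟩
      have := h1 (by linarith)
      push Not at hS
      rw [abs_of_nonpos] <;> nlinarith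

/-- A union bound over the levels: as long as no vote fails, the eigenvalue stays in the current
window. -/
theorem search_ideal_le {w : ℝ} (hw : 0 < w) {M : ℕ} (hM : 0 < M) (r : ℕ → ℕ) {x : ℝ} (J : ℕ)
    {a : ℝ} (ha : 0 ≤ a) (hx : a ≤ x) (hx' : x ≤ a + windowWidth w J) :
    (search w M r J a).ideal x (fun b => if b ≤ x ∧ x ≤ b + w then 0 else 1) ≤
      ∑ j ∈ Finset.range J, 64 / (M * ((j : ℝ) + 1) ^ 2) := by
  induction J generalizing a with
  | zero =>
    have : x ≤ a + w := by simpa [windowWidth] using hx'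
    simp [search, Strategy.ideal, hx, this]
  | succ J ih =>
    have hw' := windowWidth_pos hw (J + 1)
    rw [search, Strategy.ideal_bind, Finset.sum_range_succ, add_comm (∑ _ ∈ _, _)]
    set W := windowWidth w (J + 1)
    have hW : windowWidth w J = 3 / 4 * W := by simp only [W, windowWidth_succ]; ring
    have h1 := vote_majority_ideal_le ha hw' hx hx' (n := M * (J + 1) ^ 2) (by positivity) (r J)
    have h2 := Strategy.ideal_const x (∑ j ∈ Finset.range J, 64 / (M * ((j : ℝ) + 1) ^ 2))
      (vote (probeRound (probeTime a W) (r J)) (M * (J + 1) ^ 2) 0)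
    have h3 : ((M * (J + 1) ^ 2 : ℕ) : ℝ) = M * ((J : ℝ) + 1) ^ 2 := by push_cast; ring
    rw [h3] at h1
    refine le_trans ?_ (add_le_add h1 h2.le)
    rw [← Strategy.ideal_add]
    refine Strategy.ideal_mono (fun S => ?_) _
    have hs0 : 0 ≤ ∑ j ∈ Finset.range J, 64 / (M * ((j : ℝ) + 1) ^ 2) :=
      Finset.sum_nonneg fun j _ => by positivity
    set a' := if 0 < probeSign a W * S then a + W / 4 else a with ha'
    have ha0 : 0 ≤ a' := by rw [ha']; split_ifs <;> positivity
    split_ifs with hc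
    · rw [zero_add]
      exact ih ha0 hc.1 (by rw [hW]; exact hc.2)
    · have := (search w M r J a').ideal_mono (x := x)
        (φ := fun b => if b ≤ x ∧ x ≤ b + w then 0 else 1) (ψ := fun _ => 1)
        (fun b => by split_ifs <;> norm_num)
      rw [Strategy.ideal_const] at this
      linarith

theorem sum_inv_sq_le (n : ℕ) : ∑ j ∈ Finset.range n, 1 / ((j : ℝ) + 1) ^ 2 ≤ 2 := by
  have : ∑ j ∈ Finset.range (n + 1), 1 / ((j : ℝ) + 1) ^ 2 ≤ 2 - 1 / ((n : ℝ) + 1) := by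
    induction n with
    | zero => norm_num
    | succ n ih =>
      rw [Finset.sum_range_succ]
      have h1 : 1 / (((n + 1 : ℕ) : ℝ) + 1) ^ 2 ≤ 1 / ((n : ℝ) + 1) - 1 / (((n + 1 : ℕ) : ℝ) + 1) := by
        push_cast
        rw [div_sub_div _ _ (by positivity) (by positivity),
          div_le_div_iff₀ (by positivity) (by positivity)]
        nlinarith [Nat.cast_nonneg (α := ℝ) n]
      linarith
  rw [Finset.sum_range_succ] at this
  have h1 : (0 : ℝ) ≤ 1 / ((n : ℝ) + 1) ^ 2 := by positivity
  have h2 : (0 : ℝ) ≤ 1 / ((n : ℝ) + 1) := by positivity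
  linarith

/-- The full series Σ k² (3/4)^k equals 84; the partial sums have a closed form. -/
theorem sum_sq_mul_geometric_le (J : ℕ) :
    ∑ j ∈ Finset.range J, ((j : ℝ) + 1) ^ 2 * (3 / 4) ^ (j + 1) ≤ 84 := by
  have : ∑ j ∈ Finset.range J, ((j : ℝ) + 1) ^ 2 * (3 / 4) ^ (j + 1) =
      84 - (3 / 4) ^ J * (3 * (J : ℝ) ^ 2 + 24 * J + 84) := by
    induction J with
    | zero => norm_num
    | succ J ih => rw [Finset.sum_range_succ, ih]; push_cast; ring
  rw [this]
  have : (0 : ℝ) ≤ (3 / 4) ^ J * (3 * (J : ℝ) ^ 2 + 24 * J + 84) := by positivity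
  linarith

/-- A test that accepts eigenvalues `≥ γ` and rejects eigenvalues `≤ α γ`. -/
theorem exists_threshold_test {γ α δ : ℝ} (hγ : 0 < γ) (hγ1 : γ < 1) (hα : 0 < α) (hα1 : α < 1)
    (hδ : 0 < δ) (hδ1 : δ ≤ 1) {M : ℕ} (hM : 0 < M) :
    ∃ s : Strategy Bool, s.All (fun R => R.fresh = false) ∧ s.maxCost Round.deviation ≤ δ ∧
      s.maxCost (fun R => (R.r : ℝ)) ≤ 1806336 * (M ^ 2 / (δ * ((1 - α) ^ 2 * γ ^ 2))) ∧
      (∀ x, γ ≤ x → x ≤ 1 → 1 - 128 / M ≤ s.ideal x fun b => if b then 1 else 0) ∧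
      ∀ x, 0 ≤ x → x ≤ α * γ → (s.ideal x fun b => if b then 1 else 0) ≤ 128 / M := by
  have hM' : (0 : ℝ) < M := by exact_mod_cast hM
  have hM1 : (1 : ℝ) ≤ M := by exact_mod_cast hM
  have hα' : 0 < 1 - α := by linarith
  have hαγ : (1 - α) * γ < 1 := by nlinarith
  -- Half the spectral gap: a final window containing x then has its midpoint within a quarter gap
  -- of x, hence on the correct side of the threshold (1 + α)γ/2.
  set w : ℝ := (1 - α) * γ / 2 with hw_def
  have hw : 0 < w := by positivity
  have hw1 : w < 1 := by rw [hw_def]; linarith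
  obtain ⟨n, hn1, hn2⟩ := exists_nat_pow_near (x := 1 / w) (y := 4 / 3)
    (by rw [le_div_iff₀ hw]; linarith) (by norm_num)
  rw [le_div_iff₀ hw] at hn1
  rw [div_lt_iff₀ hw] at hn2
  -- Just enough levels for the initial window [0, W] to contain [0, 1], with W at most 4/3.
  set J := n + 1 with hJ
  have hJ1 : 1 ≤ windowWidth w J := by rw [windowWidth]; linarith
  have hJ2 : ∀ j < J, windowWidth w (j + 1) ≤ 4 / 3 := by
    intro j hj
    rw [windowWidth_succ, windowWidth]
    have : (4 / 3 : ℝ) ^ j ≤ (4 / 3) ^ n := pow_le_pow_right₀ (by norm_num) (by omega)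
    nlinarith
  -- The disturbance allowed per round. It halves less than quadratically: its decay (3/4)^(j+1)
  -- beats the (j+1)² repetitions, yet is slower than the decay (9/16)^(j+1) of 1/W², so both total
  -- deviation and total cost are convergent sums with value at most 84.
  set d : ℕ → ℝ := fun j => δ * (3 / 4) ^ (j + 1) / (84 * M) with hd
  have hd0 : ∀ j, 0 < d j := fun j => by simp only [hd]; positivity
  have hd1 : ∀ j, d j ≤ 1 := by
    intro j
    simp only [hd]
    rw [div_le_one (by positivity)]
    have : (3 / 4 : ℝ) ^ (j + 1) ≤ 1 := pow_le_one₀ (by norm_num) (by norm_num)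
    nlinarith
  -- The deviation is 6T²/(r + 1) with (WT)² ≤ π² ≤ 10; hence 60.
  set r : ℕ → ℕ := fun j => ⌈60 / (windowWidth w (j + 1) ^ 2 * d j)⌉₊ with hr
  have hdev : ∀ j < J, ∀ a, 0 ≤ a →
      (probeRound (probeTime a (windowWidth w (j + 1))) (r j)).deviation ≤ d j := by
    intro j _ a ha
    have hW := windowWidth_pos hw (j + 1)
    obtain ⟨h0, -, h2⟩ := probeTime_bounds ha hW
    rw [probeRound_deviation h0, div_le_iff₀ (by positivity)]
    have h3 : 60 / (windowWidth w (j + 1) ^ 2 * d j) ≤ r j := Nat.le_ceil _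
    rw [div_le_iff₀ (mul_pos (by positivity) (hd0 j))] at h3
    have h4 : (windowWidth w (j + 1) * probeTime a (windowWidth w (j + 1))) ^ 2 ≤ 10 := by
      have := Real.pi_lt_d2
      have := Real.pi_pos
      have : Real.pi ^ 2 ≤ 10 := by nlinarith
      refine le_trans ?_ this
      gcongr
    have h5 : windowWidth w (j + 1) ^ 2 * (6 * probeTime a (windowWidth w (j + 1)) ^ 2) ≤
        windowWidth w (j + 1) ^ 2 * (d j * (r j + 1)) := by
      have := mul_pos (pow_pos hW 2) (hd0 j)
      nlinarith
    exact le_of_mul_le_mul_left h5 (by positivity)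
  have hcost : ∀ j < J, ∀ a, 0 ≤ a →
      ((probeRound (probeTime a (windowWidth w (j + 1))) (r j)).r : ℝ) ≤
        64 / (windowWidth w (j + 1) ^ 2 * d j) := by
    intro j hj a _
    have hW := windowWidth_pos hw (j + 1)
    have hWd := mul_pos (pow_pos hW 2) (hd0 j)
    have h1 : (r j : ℝ) < 60 / (windowWidth w (j + 1) ^ 2 * d j) + 1 :=
      Nat.ceil_lt_add_one (by positivity)
    have h2 : 2 ≤ 4 / (windowWidth w (j + 1) ^ 2 * d j) := by
      rw [le_div_iff₀ hWd]
      have := hJ2 j hj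
      have := hd1 j
      have := hd0 j
      have : windowWidth w (j + 1) ^ 2 ≤ 16 / 9 := by nlinarith
      nlinarith [pow_pos hW 2]
    have h3 : (60 : ℝ) / (windowWidth w (j + 1) ^ 2 * d j) + 4 / (windowWidth w (j + 1) ^ 2 * d j) =
        64 / (windowWidth w (j + 1) ^ 2 * d j) := by rw [← add_div]; norm_num
    simp only [probeRound]
    push_cast
    linarith
  set s : Strategy Bool := (search w M r J 0).bind fun a =>
    .done (decide ((1 + α) * γ / 2 ≤ a + w / 2)) with hs
  have hs_cost : ∀ c, s.maxCost c ≤ (search w M r J 0).maxCost c := fun c => by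
    have := Strategy.maxCost_bind_le (c := c) (search w M r J 0) (b := 0)
      (fun a => Strategy.done (decide ((1 + α) * γ / 2 ≤ a + w / 2))) (fun a => le_rfl)
    simpa using this
  have herr : ∀ x, 0 ≤ x → x ≤ 1 →
      (search w M r J 0).ideal x (fun b => if b ≤ x ∧ x ≤ b + w then 0 else 1) ≤ 128 / M := by
    intro x hx hx1
    refine (search_ideal_le hw hM r J le_rfl hx (by linarith)).trans ?_
    have : ∀ j : ℕ, 64 / (M * ((j : ℝ) + 1) ^ 2) = 64 / M * (1 / ((j : ℝ) + 1) ^ 2) := fun j => by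
      field_simp
    simp only [this, ← Finset.mul_sum]
    have h2 := sum_inv_sq_le J
    have h3 : (128 : ℝ) / M = 64 / M * 2 := by ring
    rw [h3]
    gcongr
  refine ⟨s, (search_all _ _ _ _ _).bind fun a => trivial, ?_, ?_, ?_, ?_⟩
  · refine (hs_cost _).trans ((search_maxCost_le hw M r _ d hdev le_rfl).trans ?_)
    have : ∀ j : ℕ, (M : ℝ) * (j + 1) ^ 2 * d j = δ / 84 * (((j : ℝ) + 1) ^ 2 * (3 / 4) ^ (j + 1)) :=
      fun j => by simp only [hd]; field_simp
    simp only [this, ← Finset.mul_sum]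
    have h2 := sum_sq_mul_geometric_le J
    calc δ / 84 * _ ≤ δ / 84 * 84 := by gcongr
      _ = δ := by ring
  · refine (hs_cost _).trans ((search_maxCost_le hw M r _ _ hcost le_rfl).trans ?_)
    have : ∀ j : ℕ, (M : ℝ) * (j + 1) ^ 2 * (64 / (windowWidth w (j + 1) ^ 2 * d j)) =
        5376 * M ^ 2 / (δ * w ^ 2) * (((j : ℝ) + 1) ^ 2 * (3 / 4) ^ (j + 1)) := fun j => by
      have e : ((3 : ℝ) / 4) ^ (j + 1) = ((4 / 3) ^ (j + 1))⁻¹ := by rw [← inv_pow]; norm_num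
      simp only [hd, windowWidth, e]
      field_simp
      norm_num
    simp only [this, ← Finset.mul_sum]
    have h2 := sum_sq_mul_geometric_le J
    calc _ ≤ 5376 * (M : ℝ) ^ 2 / (δ * w ^ 2) * 84 := by gcongr
      _ = _ := by rw [hw_def]; field_simp; norm_num
  · intro x hx hx1
    have h1 := herr x (by linarith) hx1
    have h2 : 1 ≤ s.ideal x (fun b => if b then 1 else 0) +
        (search w M r J 0).ideal x (fun b => if b ≤ x ∧ x ≤ b + w then 0 else 1) := by
      rw [hs, Strategy.ideal_bind, ← Strategy.ideal_add]
      refine le_of_eq_of_le (Strategy.ideal_const x 1 (search w M r J 0)).symm ?_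
      refine Strategy.ideal_mono (fun a => ?_) _
      simp only [Strategy.ideal, decide_eq_true_eq]
      split_ifs with q1 q2 q2
      · norm_num
      · norm_num
      · exact absurd (by rw [hw_def] at *; nlinarith) q1
      · norm_num
    linarith
  · intro x hx hx1
    refine le_trans ?_ (herr x hx (by nlinarith))
    rw [hs, Strategy.ideal_bind]
    refine Strategy.ideal_mono (fun a => ?_) _
    simp only [Strategy.ideal, decide_eq_true_eq]
    split_ifs with q1 q2 q2
    · exact absurd (by rw [hw_def] at *; nlinarith) (not_lt.2 q1)
    · norm_num
    · norm_num
    · norm_num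

/-! ## Chains of tests -/

/-- Run the tests `s 0, …, s (n - 1)`, and accept if all of them accept. -/
def testChain (s : ℕ → Strategy Bool) : ℕ → Strategy Bool
  | 0 => .done true
  | n + 1 => (testChain s n).bind fun b => if b then s n else .done false

section acceptance

variable {ι : Type*} [Fintype ι] [DecidableEq ι] {lam : ι → ℝ}

/-- The terminal value `u` on acceptance, and `0` on rejection. -/
def onAccept (u : ι → ℝ) (b : Bool) : ι → ℝ := if b then u else 0

/-- The expectation of `u` in the subnormalised state after acceptance, if the initial state has
the spectrum `lam`. -/
def Strategy.accepted (t : Strategy Bool) (lam u : ι → ℝ) : ℝ :=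
  ∑ j, lam j * t.eval lam 0 (onAccept u) j

/-- The expected cost, if the initial state has the spectrum `lam`. -/
def Strategy.meanCost (t : Strategy Bool) (lam : ι → ℝ) (c : Round → ℝ) : ℝ :=
  ∑ j, lam j * t.eval lam c 0 j

theorem Strategy.accepted_mono (h : IsDistribution lam) (t : Strategy Bool) {u v : ι → ℝ}
    (huv : u ≤ v) : t.accepted lam u ≤ t.accepted lam v := by
  refine Finset.sum_le_sum fun j _ => mul_le_mul_of_nonneg_left ?_ (h.nonneg j)
  refine Strategy.eval_mono h (fun _ => le_rfl) (fun b => ?_) t j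
  cases b
  exacts [le_rfl, huv]

theorem onAccept_add {ι : Type*} (u v : ι → ℝ) : onAccept (u + v) = onAccept u + onAccept v := by
  ext b j; cases b <;> simp [onAccept]

theorem onAccept_smul {ι : Type*} (b : ℝ) (u : ι → ℝ) : onAccept (b • u) = b • onAccept u := by
  ext b j; cases b <;> simp [onAccept]

theorem Strategy.accepted_add (t : Strategy Bool) (u v : ι → ℝ) :
    t.accepted lam (u + v) = t.accepted lam u + t.accepted lam v := by
  have := Strategy.eval_add (lam := lam) 0 0 (onAccept u) (onAccept v) t
  rw [add_zero] at this
  simp only [Strategy.accepted, onAccept_add, this, Pi.add_apply, mul_add, Finset.sum_add_distrib]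

theorem Strategy.accepted_smul (t : Strategy Bool) (b : ℝ) (u : ι → ℝ) :
    t.accepted lam (b • u) = b * t.accepted lam u := by
  have := Strategy.eval_smul (lam := lam) b 0 (onAccept u) t
  rw [smul_zero] at this
  simp only [Strategy.accepted, onAccept_smul, this, Pi.smul_apply, smul_eq_mul, Finset.mul_sum]
  exact Finset.sum_congr rfl fun j _ => by ring

theorem Strategy.accepted_nonneg (h : IsDistribution lam) (t : Strategy Bool) {u : ι → ℝ}
    (hu : 0 ≤ u) : 0 ≤ t.accepted lam u :=
  Finset.sum_nonneg fun j _ => mul_nonneg (h.nonneg j) (Strategy.eval_nonneg h (fun _ => le_rfl)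
    (fun b j => by cases b; exacts [le_rfl, hu j]) t j)

/-- The last test is absorbed into the terminal value, so a bound on one test yields a recursion
along the chain. -/
theorem testChain_eval_succ (s : ℕ → Strategy Bool) (n : ℕ) (c : Round → ℝ) (u : ι → ℝ) :
    (testChain s (n + 1)).eval lam c (onAccept u) =
      (testChain s n).eval lam c (onAccept ((s n).eval lam c (onAccept u))) := by
  rw [testChain, Strategy.eval_bind]
  congr 1
  ext b j
  cases b <;> simp [onAccept, Strategy.eval]

theorem testChain_accepted_succ (s : ℕ → Strategy Bool) (n : ℕ) (u : ι → ℝ) :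
    (testChain s (n + 1)).accepted lam u =
      (testChain s n).accepted lam ((s n).eval lam 0 (onAccept u)) := by
  simp only [Strategy.accepted, testChain_eval_succ]

theorem onAccept_zero {ι : Type*} : onAccept (0 : ι → ℝ) = 0 := by
  ext b j; cases b <;> rfl

/-- Test `n` is paid for only if all earlier tests accept, whence the acceptance weight. -/
theorem testChain_meanCost_succ_le (h : IsDistribution lam) (s : ℕ → Strategy Bool) (n : ℕ)
    (c : Round → ℝ) :
    (testChain s (n + 1)).meanCost lam c ≤
      (testChain s n).meanCost lam c + (s n).maxCost c * (testChain s n).accepted lam 1 := by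
  rw [← Strategy.accepted_smul]
  have e : (testChain s (n + 1)).meanCost lam c = (testChain s n).meanCost lam c +
      (testChain s n).accepted lam ((s n).eval lam c 0) := by
    have h1 := testChain_eval_succ (lam := lam) s n c 0
    rw [onAccept_zero] at h1
    have h2 := Strategy.eval_add (lam := lam) c 0 0 (onAccept ((s n).eval lam c 0)) (testChain s n)
    rw [add_zero, zero_add] at h2
    simp only [Strategy.meanCost, Strategy.accepted, h1, h2, Pi.add_apply, mul_add,
      Finset.sum_add_distrib]
  rw [e]
  gcongr
  refine Strategy.accepted_mono h _ fun j => ?_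
  simpa using Strategy.eval_zero_le_maxCost h c (s n) j

/-- The indicator function of the complement of `{i}`. -/
def offIndicator (i : ι) : ι → ℝ := fun j => if j = i then 0 else 1

theorem single_add_offIndicator {ι : Type*} [DecidableEq ι] (i : ι) : Pi.single i 1 + offIndicator i = (1 : ι → ℝ) := by
  ext j
  by_cases h : j = i
  · subst h; simp [offIndicator]
  · simp [offIndicator, h]

theorem testChain_accepted_single_succ (h : IsDistribution lam) (s : ℕ → Strategy Bool) (n : ℕ)
    (i : ι) {η : ℝ} (hη : 1 - η ≤ (s n).eval lam 0 (onAccept (Pi.single i 1)) i) :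
    (1 - η) * (testChain s n).accepted lam (Pi.single i 1) ≤
      (testChain s (n + 1)).accepted lam (Pi.single i 1) := by
  rw [testChain_accepted_succ, ← Strategy.accepted_smul]
  refine Strategy.accepted_mono h _ fun j => ?_
  by_cases hj : j = i
  · subst hj; simpa using hη
  · have : 0 ≤ (s n).eval lam 0 (onAccept (Pi.single i 1)) j :=
      Strategy.eval_nonneg h (fun _ => le_rfl) (fun b k => by
        cases b
        · exact le_rfl
        · simp only [onAccept, if_true, Pi.single_apply]; split_ifs <;> norm_num) _ _
    simpa [hj] using this

/-- Wrong weight after a test comes either from wrong eigenvectors that slip through, at rate `a`,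
or from the right one when it is disturbed, at rate `b`. -/
theorem testChain_accepted_off_succ (h : IsDistribution lam) (s : ℕ → Strategy Bool) (n : ℕ)
    (i : ι) {a b : ℝ} (ha : ∀ j ≠ i, (s n).eval lam 0 (onAccept (offIndicator i)) j ≤ a)
    (hb : (s n).eval lam 0 (onAccept (offIndicator i)) i ≤ b) :
    (testChain s (n + 1)).accepted lam (offIndicator i) ≤
      a * (testChain s n).accepted lam (offIndicator i) +
        b * (testChain s n).accepted lam (Pi.single i 1) := by
  rw [testChain_accepted_succ, ← Strategy.accepted_smul, ← Strategy.accepted_smul,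
    ← Strategy.accepted_add]
  refine Strategy.accepted_mono h _ fun j => ?_
  by_cases hj : j = i
  · subst hj; simpa [offIndicator] using hb
  · simpa [offIndicator, hj] using ha j hj

end acceptance

/-! ## Elementary estimates -/

/-- The product of the factors 1 - ηᵢ is at least 1 - Σ ηᵢ ≥ 1/2. -/
theorem le_two_mul_of_slow_decay {K : ℕ} {g η : ℕ → ℝ} (hg : ∀ n, 0 ≤ g n) (hη : ∀ n, 0 ≤ η n)
    (h : ∀ n < K, (1 - η n) * g n ≤ g (n + 1)) (h1 : ∀ n, η n ≤ 1)
    (hs : ∑ n ∈ Finset.range K, η n ≤ 1 / 2) {n : ℕ} (hn : n ≤ K) : g n ≤ 2 * g K := by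
  have key : ∀ m, n ≤ m → m ≤ K → (1 - ∑ i ∈ Finset.Ico n m, η i) * g n ≤ g m := by
    intro m hm
    induction m, hm using Nat.le_induction with
    | base => simp
    | succ m hm ih =>
      intro hK
      have i1 := ih (by omega)
      have i2 := h m (by omega)
      rw [Finset.sum_Ico_succ_top hm]
      have i3 := mul_le_mul_of_nonneg_left i1 (sub_nonneg.2 (h1 m))
      have i4 : 0 ≤ ∑ i ∈ Finset.Ico n m, η i := Finset.sum_nonneg fun i _ => hη i
      have i5 := mul_nonneg (mul_nonneg i4 (hη m)) (hg n)
      nlinarith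
  have k1 := key K hn le_rfl
  have k2 : ∑ i ∈ Finset.Ico n K, η i ≤ ∑ i ∈ Finset.range K, η i := by
    refine Finset.sum_le_sum_of_subset_of_nonneg (fun i hi => ?_) fun i _ _ => hη i
    simp only [Finset.mem_Ico, Finset.mem_range] at *
    omega
  nlinarith [hg n]

/-- The quotient b/g is contracted by 1/31 up to a source of order 2⁻ⁿ. The initial impurity is
therefore forgotten at least as fast as 16⁻ⁿ, and the rest follows the source. -/
theorem ratio_le_of_recursion {K : ℕ} {g b : ℕ → ℝ} {γ : ℝ} (hγ : 0 < γ) (hγ1 : γ < 1)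
    (hg : ∀ n < K, 31 / 32 * g n ≤ g (n + 1))
    (hb : ∀ n < K, b (n + 1) ≤ 1 / 32 * b n + (1 - γ) * ((1 / 2) ^ n / 256) * g n)
    (h0 : b 0 ≤ (1 - γ) / γ * g 0) (hg0 : ∀ n, 0 ≤ g n) {n : ℕ} (hn : n ≤ K) :
    b n ≤ (1 - γ) * ((1 / 16) ^ n / γ + (1 / 2) ^ n) * g n := by
  have h1 : 0 < 1 - γ := by linarith
  induction n with
  | zero =>
    refine h0.trans (mul_le_mul_of_nonneg_right ?_ (hg0 0))
    rw [div_eq_mul_one_div]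
    gcongr
    simp
  | succ n ih =>
    have i1 := ih (by omega)
    have i2 := hb n (by omega)
    have i3 := hg n (by omega)
    set p : ℝ := (1 / 16) ^ n / γ with hp
    set q : ℝ := (1 / 2) ^ n with hq
    have hp0 : 0 ≤ p := by positivity
    have hq0 : 0 ≤ q := by positivity
    have e1 : (1 / 16 : ℝ) ^ (n + 1) / γ = p / 16 := by rw [hp, pow_succ]; ring
    have e2 : (1 / 2 : ℝ) ^ (n + 1) = q / 2 := by rw [hq, pow_succ]; ring
    rw [e1, e2]
    have i4 : b (n + 1) ≤ (1 - γ) * ((p + q) / 32 + q / 256) * g n := by nlinarith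
    refine i4.trans ?_
    have i5 : (1 - γ) * ((p + q) / 32 + q / 256) * g n ≤
        (1 - γ) * (p / 16 + q / 2) * (31 / 32 * g n) := by
      have : (p + q) / 32 + q / 256 ≤ (p / 16 + q / 2) * (31 / 32) := by linarith
      have := mul_le_mul_of_nonneg_right (mul_le_mul_of_nonneg_left this h1.le) (hg0 n)
      linarith
    exact i5.trans (mul_le_mul_of_nonneg_left i3 (by positivity))

theorem sum_range_sub_eq (f : ℕ → ℝ) (K : ℕ) :
    ∑ i ∈ Finset.range K, f (K - 1 - i + 1) = ∑ i ∈ Finset.range K, f (i + 1) :=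
  Finset.sum_range_reflect (fun i => f (i + 1)) K

theorem sum_pow_four_mul_geometric_le (K : ℕ) :
    ∑ i ∈ Finset.range K, ((i : ℝ) + 1) ^ 4 * (1 / 2) ^ (i + 1) ≤ 150 := by
  have : ∑ i ∈ Finset.range K, ((i : ℝ) + 1) ^ 4 * (1 / 2) ^ (i + 1) =
      150 - (1 / 2) ^ K * ((K : ℝ) ^ 4 + 8 * K ^ 3 + 36 * K ^ 2 + 104 * K + 150) := by
    induction K with
    | zero => norm_num
    | succ K ih => rw [Finset.sum_range_succ, ih]; push_cast; ring
  rw [this]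
  have : (0 : ℝ) ≤ (1 / 2) ^ K * ((K : ℝ) ^ 4 + 8 * K ^ 3 + 36 * K ^ 2 + 104 * K + 150) := by
    positivity
  linarith

/-- The (normalised) number of repetitions in the `i`-th of `K` tests. -/
def repetitions (K i : ℕ) : ℕ := min (i + 1) (K - 1 - i + 1) ^ 2

theorem repetitions_pos (K i : ℕ) : 0 < repetitions K i := by
  unfold repetitions; positivity

/-- The inverse square of a minimum is at most the sum of both inverse squares, and reflection makes
the two sums equal. -/
theorem sum_inv_repetitions_le (K : ℕ) :
    ∑ i ∈ Finset.range K, 1 / (repetitions K i : ℝ) ≤ 4 := by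
  have h1 := sum_inv_sq_le K
  have h2 := sum_range_sub_eq (fun k => 1 / (k : ℝ) ^ 2) K
  push_cast at h2
  have h3 : ∀ i ∈ Finset.range K, 1 / (repetitions K i : ℝ) ≤
      1 / ((i : ℝ) + 1) ^ 2 + 1 / (((K - 1 - i : ℕ) : ℝ) + 1) ^ 2 := by
    intro i _
    have a1 : 0 ≤ 1 / ((i : ℝ) + 1) ^ 2 := by positivity
    have a2 : 0 ≤ 1 / (((K - 1 - i : ℕ) : ℝ) + 1) ^ 2 := by positivity
    rcases min_choice (i + 1) (K - 1 - i + 1) with h | h <;>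
      · rw [repetitions, h]; push_cast; linarith
  refine (Finset.sum_le_sum h3).trans ?_
  rw [Finset.sum_add_distrib]
  linarith

/-- This controls the cost on the right eigenvector. Counted from the end, k = K - i, the summand is
at most k⁴ 2⁻ᵏ 2^K; Σ k⁴ 2⁻ᵏ = 150. -/
theorem sum_repetitions_sq_mul_le (K : ℕ) :
    ∑ i ∈ Finset.range K, (repetitions K i : ℝ) ^ 2 * 2 ^ i ≤ 150 * 2 ^ K := by
  have h1 := sum_pow_four_mul_geometric_le K
  have h2 := sum_range_sub_eq (fun k => (k : ℝ) ^ 4 * (1 / 2) ^ k) K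
  push_cast at h2
  rw [← h2] at h1
  calc _ ≤ ∑ i ∈ Finset.range K,
        (((K - 1 - i : ℕ) : ℝ) + 1) ^ 4 * (1 / 2) ^ (K - 1 - i + 1) * 2 ^ K := by
        refine Finset.sum_le_sum fun i hi => ?_
        have hi' := Finset.mem_range.1 hi
        have e : (2 : ℝ) ^ K = 2 ^ (K - 1 - i + 1) * 2 ^ i := by
          rw [← pow_add]; congr 1; omega
        have e2 : (1 / 2 : ℝ) ^ (K - 1 - i + 1) * 2 ^ K = 2 ^ i := by
          rw [e, ← mul_assoc, ← mul_pow]; norm_num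
        rw [mul_assoc, e2]
        gcongr
        have : repetitions K i ≤ (K - 1 - i + 1) ^ 2 :=
          Nat.pow_le_pow_left (min_le_right _ _) 2
        have h : (repetitions K i : ℝ) ≤ (((K - 1 - i : ℕ) : ℝ) + 1) ^ 2 := by exact_mod_cast this
        calc (repetitions K i : ℝ) ^ 2 ≤ ((((K - 1 - i : ℕ) : ℝ) + 1) ^ 2) ^ 2 := by gcongr
          _ = _ := by ring
    _ ≤ _ := by rw [← Finset.sum_mul]; gcongr

/-- This controls the cost on wrong eigenvectors, whose weight falls like 16⁻ⁱ; here the bound of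
the repetitions from the start of the chain is used. -/
theorem sum_repetitions_sq_mul_geometric_le (K : ℕ) :
    ∑ i ∈ Finset.range K, (repetitions K i : ℝ) ^ 2 * 2 ^ i * (1 / 16) ^ i ≤ 300 := by
  have h1 := sum_pow_four_mul_geometric_le K
  calc _ ≤ ∑ i ∈ Finset.range K, 2 * (((i : ℝ) + 1) ^ 4 * (1 / 2) ^ (i + 1)) := by
        refine Finset.sum_le_sum fun i _ => ?_
        have e : (2 : ℝ) ^ i * (1 / 16) ^ i ≤ 2 * (1 / 2) ^ (i + 1) := by
          rw [← mul_pow, pow_succ]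
          have : (2 * (1 / 16) : ℝ) ^ i ≤ (1 / 2) ^ i := by gcongr; norm_num
          linarith
        have : repetitions K i ≤ (i + 1) ^ 2 := Nat.pow_le_pow_left (min_le_left _ _) 2
        have h : (repetitions K i : ℝ) ≤ ((i : ℝ) + 1) ^ 2 := by exact_mod_cast this
        calc _ = (repetitions K i : ℝ) ^ 2 * (2 ^ i * (1 / 16) ^ i) := by ring
          _ ≤ (((i : ℝ) + 1) ^ 2) ^ 2 * (2 * (1 / 2) ^ (i + 1)) := by gcongr
          _ = _ := by ring
    _ ≤ _ := by rw [← Finset.mul_sum]; linarith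

/-! ## A single distillation attempt -/

theorem threshold_test_bounds {d : ℕ} {lam : Fin d → ℝ} (h : IsDistribution lam) {γ α : ℝ}
    {i : Fin d} (hi : γ ≤ lam i) (hj : ∀ j ≠ i, lam j ≤ α * γ) {s : Strategy Bool} {δ e : ℝ}
    (hs : s.All fun R => R.fresh = false) (hδ : s.maxCost Round.deviation ≤ δ)
    (h1 : ∀ x, γ ≤ x → x ≤ 1 → 1 - e ≤ s.ideal x fun b => if b then 1 else 0)
    (h2 : ∀ x, 0 ≤ x → x ≤ α * γ → (s.ideal x fun b => if b then 1 else 0) ≤ e) :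
    1 - (e + 2 * δ) ≤ s.eval lam 0 (onAccept (Pi.single i 1)) i ∧
    (∀ j ≠ i, s.eval lam 0 (onAccept (offIndicator i)) j ≤ e + δ) ∧
    s.eval lam 0 (onAccept (offIndicator i)) i ≤ (1 - γ) * δ := by
  have o0 : ∀ (b : Bool) (j : Fin d), 0 ≤ onAccept (offIndicator i) b j := fun b j => by
    cases b
    · exact le_rfl
    · simp only [onAccept, offIndicator, if_true]; split_ifs <;> norm_num
  have o1 : ∀ (b : Bool) (j : Fin d), onAccept (offIndicator i) b j ≤ 1 := fun b j => by
    cases b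
    · simp [onAccept]
    · simp only [onAccept, offIndicator, if_true]; split_ifs <;> norm_num
  refine ⟨?_, fun j hji => ?_, ?_⟩
  · have k1 := Strategy.ideal_sub_le_eval h (ψ := fun b : Bool => if b then 1 else 0) (i := i)
      (fun b => by cases b <;> norm_num) (fun b => by cases b <;> norm_num) hs
    have k2 : (fun (b : Bool) (j : Fin d) => if j = i then (if b then (1 : ℝ) else 0) else 0) =
        onAccept (Pi.single i 1) := by
      ext b j
      cases b <;> simp [onAccept, Pi.single_apply]
    rw [k2] at k1
    have := h1 (lam i) hi (h.le_one i)
    linarith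
  · have k1 := Strategy.eval_le_ideal_add h (φ := onAccept (offIndicator i))
      (ψ := fun b => if b then 1 else 0) (j := j) o0 o1 (fun b => by
        cases b <;> simp [onAccept, offIndicator, hji]) hs
    have := h2 (lam j) (h.nonneg j) (hj j hji)
    linarith
  · have k1 := Strategy.eval_le_mul_maxCost h (φ := onAccept (offIndicator i)) (i := i) o1
      (fun b => by cases b <;> simp [onAccept, offIndicator]) hs
    refine k1.trans ?_
    have := Strategy.maxCost_nonneg Round.deviation_nonneg s
    have := h.le_one i
    have : 0 ≤ 1 - γ := by linarith
    gcongr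

theorem testChain_zero_accepted {d : ℕ} {lam : Fin d → ℝ} (s : ℕ → Strategy Bool)
    (u : Fin d → ℝ) : (testChain s 0).accepted lam u = ∑ j, lam j * u j := by
  simp [testChain, Strategy.accepted, Strategy.eval, onAccept]

/-- With Y = (1-γ)(1/ε + 1/γ), the power 2^K is taken in (4Y, 8Y]. For q = 2⁻ᴷ this gives (1-γ) q ≤
ε/4, and the term q⁴/γ is at most 2q, for a total of 3ε/4. -/
theorem exists_number_of_tests {γ ε : ℝ} (hγ : 0 < γ) (hγ1 : γ < 1) (hε : 0 < ε)
    (hεγ : ε < 1 - γ) :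
    ∃ K : ℕ, (2 : ℝ) ^ K ≤ 8 * ((1 - γ) * (1 / ε + 1 / γ)) ∧
      (1 - γ) * ((1 / 16) ^ K / γ + (1 / 2) ^ K) ≤ ε := by
  have h1 : 0 < 1 - γ := by linarith
  set Y := (1 - γ) * (1 / ε + 1 / γ) with hY
  have hY1 : (1 - γ) / ε ≤ Y := by
    rw [hY, mul_add, mul_one_div]
    have : 0 ≤ (1 - γ) * (1 / γ) := by positivity
    linarith
  have hY2 : (1 - γ) / γ ≤ Y := by
    rw [hY, mul_add, mul_one_div (1 - γ) γ]
    have : 0 ≤ (1 - γ) * (1 / ε) := by positivity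
    linarith
  have hY3 : 1 ≤ Y := le_trans (by rw [le_div_iff₀ hε]; linarith) hY1
  obtain ⟨n, hn1, hn2⟩ := exists_nat_pow_near (x := 4 * Y) (y := 2) (by linarith) (by norm_num)
  refine ⟨n + 1, by rw [pow_succ]; linarith, ?_⟩
  set q : ℝ := (1 / 2) ^ (n + 1) with hq
  have hq0 : 0 < q := by positivity
  have hq1 : q ≤ 1 := pow_le_one₀ (by norm_num) (by norm_num)
  have hq2 : q * (4 * Y) ≤ 1 := by
    have : q * 2 ^ (n + 1) = 1 := by rw [hq, ← mul_pow]; norm_num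
    rw [← this]; gcongr
  have e16 : (1 / 16 : ℝ) ^ (n + 1) = q ^ 4 := by rw [hq, ← pow_mul, mul_comm, pow_mul]; norm_num
  rw [e16]
  have k1 : (1 - γ) * q ≤ ε / 4 := by
    rw [div_le_iff₀ hε] at hY1
    nlinarith
  have k2 : q ≤ 2 * γ := by
    -- For γ > 1/2 the bound is trivial; otherwise 1 - γ ≥ 1/2 and (1-γ)/γ ≤ Y apply.
    by_cases hg : γ ≤ 1 / 2
    · rw [div_le_iff₀ hγ] at hY2
      nlinarith
    · linarith
  have k3 : q ^ 4 / γ ≤ 2 * q := by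
    rw [div_le_iff₀ hγ]
    have : q ^ 4 ≤ q * q := by nlinarith [pow_le_one₀ hq0.le hq1 (n := 2), sq_nonneg q]
    nlinarith
  nlinarith

theorem exists_attempt :
    ∃ C : ℝ, 0 < C ∧
      ∀ γ ε α : ℝ, 0 < γ → γ < 1 → 0 < ε → 0 < α → α < 1 → ε < 1 - γ →
        ∃ t : Strategy Bool, t.All (fun R => R.fresh = false) ∧
          ∀ (d : ℕ) (lam : Fin d → ℝ) (i : Fin d), IsDistribution lam → γ ≤ lam i →
            (∀ j ≠ i, lam j ≤ α * γ) →
            0 < t.accepted lam 1 ∧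
            t.accepted lam (offIndicator i) ≤ ε * t.accepted lam 1 ∧
            2 + t.meanCost lam (fun R => (R.r : ℝ)) ≤
              C * ((1 - γ) / ((1 - α) ^ 2 * γ ^ 2) * (1 / ε + 1 / γ)) * t.accepted lam 1 := by
  -- The constant of a single test, times the square of the repetition scale 8192, times the 256 in
  -- the denominator of δ.
  set A : ℝ := 1806336 * 8192 ^ 2 * 256 with hA
  refine ⟨4 + 5400 * A, by positivity, ?_⟩
  intro γ ε α hγ hγ1 hε hα hα1 hεγ
  have h1γ : 0 < 1 - γ := by linarith
  have h1α : 0 < 1 - α := by linarith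
  obtain ⟨K, hK1, hK2⟩ := exists_number_of_tests hγ hγ1 hε hεγ
  set Y := (1 - γ) * (1 / ε + 1 / γ) with hY
  have hY2 : (1 - γ) / γ ≤ Y := by
    rw [hY, mul_add, mul_one_div (1 - γ) γ]
    have : 0 ≤ (1 - γ) * (1 / ε) := by positivity
    linarith
  have hY1 : 1 ≤ Y := by
    have : 1 ≤ (1 - γ) / ε := by rw [le_div_iff₀ hε]; linarith
    rw [hY, mul_add, mul_one_div]
    have : 0 ≤ (1 - γ) * (1 / γ) := by positivity
    linarith
  set W := (1 - α) ^ 2 * γ ^ 2 with hW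
  have hW0 : 0 < W := by positivity
  have hW1 : W ≤ γ := by
    have : (1 - α) ^ 2 ≤ 1 := pow_le_one₀ h1α.le (by linarith)
    have : (1 - α) ^ 2 * γ ^ 2 ≤ 1 * γ ^ 2 := by gcongr
    nlinarith
  set δ : ℕ → ℝ := fun n => (1 / 2) ^ n / 256 with hδ
  have hδ0 : ∀ n, 0 < δ n := fun n => by simp only [hδ]; positivity
  have hδ1 : ∀ n, δ n ≤ 1 / 256 := fun n => by
    simp only [hδ]
    gcongr
    exact pow_le_one₀ (by norm_num) (by norm_num)
  have hM : ∀ n, 0 < 8192 * repetitions K n := fun n => by have := repetitions_pos K n; omega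
  choose s hs1 hs2 hs3 hs4 hs5 using fun n =>
    exists_threshold_test hγ hγ1 hα hα1 (hδ0 n) ((hδ1 n).trans (by norm_num)) (hM n)
  set e : ℕ → ℝ := fun n => 1 / 64 * (1 / (repetitions K n : ℝ)) with he
  have hrep : ∀ n, (1 : ℝ) ≤ repetitions K n := fun n => by exact_mod_cast repetitions_pos K n
  have hee : ∀ n, 128 / ((8192 * repetitions K n : ℕ) : ℝ) = e n := fun n => by
    have := hrep n
    simp only [he]
    push_cast
    field_simp
    norm_num
  have he0 : ∀ n, 0 ≤ e n := fun n => by simp only [he]; positivity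
  have he1 : ∀ n, e n ≤ 1 / 64 := fun n => by
    simp only [he]
    have : 1 / (repetitions K n : ℝ) ≤ 1 := by
      rw [div_le_one (by linarith [hrep n])]; exact hrep n
    linarith
  have hcost : ∀ n, (s n).maxCost (fun R => (R.r : ℝ)) ≤
      A / W * ((repetitions K n : ℝ) ^ 2 * 2 ^ n) := fun n => by
    refine (hs3 n).trans (le_of_eq ?_)
    have e2 : ((1 : ℝ) / 2) ^ n = (2 ^ n)⁻¹ := by rw [one_div, inv_pow]
    simp only [hδ, e2, hA]
    push_cast
    field_simp
    rw [hW]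
    ring
  refine ⟨testChain s K, ?_, ?_⟩
  · have : ∀ n, (testChain s n).All fun R => R.fresh = false := by
      intro n
      induction n with
      | zero => trivial
      | succ n ih => exact ih.bind fun b => by cases b; exacts [trivial, hs1 n]
    exact this K
  intro d lam i hlam hi hj
  have hb := fun n => threshold_test_bounds hlam hi hj (hs1 n) (hs2 n)
    (fun x hx hx1 => hee n ▸ hs4 n x hx hx1) (fun x hx hx1 => hee n ▸ hs5 n x hx hx1)
  set g : ℕ → ℝ := fun n => (testChain s n).accepted lam (Pi.single i 1) with hg
  set b : ℕ → ℝ := fun n => (testChain s n).accepted lam (offIndicator i) with hbdef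
  have hgb : ∀ n, (testChain s n).accepted lam 1 = g n + b n := fun n => by
    rw [← single_add_offIndicator i, Strategy.accepted_add]
  have hg0 : ∀ n, 0 ≤ g n := fun n => Strategy.accepted_nonneg hlam _ (by simp)
  have hb0 : ∀ n, 0 ≤ b n := fun n => Strategy.accepted_nonneg hlam _ fun j => by
    simp only [offIndicator, Pi.zero_apply]; split_ifs <;> norm_num
  have hgs : ∀ n, (1 - (e n + 2 * δ n)) * g n ≤ g (n + 1) := fun n =>
    testChain_accepted_single_succ hlam s n i (hb n).1
  have hbs : ∀ n, b (n + 1) ≤ (e n + δ n) * b n + (1 - γ) * δ n * g n := fun n =>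
    testChain_accepted_off_succ hlam s n i (hb n).2.1 (hb n).2.2
  have hg_zero : g 0 = lam i := by
    simp only [hg, testChain_zero_accepted]
    simp [Pi.single_apply]
  have hb_zero : b 0 = 1 - lam i := by
    have := hgb 0
    rw [testChain_zero_accepted, hg_zero] at this
    simp only [Pi.one_apply, mul_one, hlam.sum_eq_one] at this
    linarith
  have hi0 : 0 < lam i := hγ.trans_le hi
  have hratio : ∀ n ≤ K, b n ≤ (1 - γ) * ((1 / 16) ^ n / γ + (1 / 2) ^ n) * g n := by
    intro n hn
    refine ratio_le_of_recursion hγ hγ1 (fun n _ => ?_) (fun n _ => ?_) ?_ hg0 hn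
    · refine le_trans (mul_le_mul_of_nonneg_right ?_ (hg0 n)) (hgs n)
      linarith [he1 n, hδ1 n]
    · refine (hbs n).trans ?_
      gcongr
      · exact hb0 n
      · linarith [he1 n, hδ1 n]
    · rw [hg_zero, hb_zero, div_mul_eq_mul_div, le_div_iff₀ hγ]
      nlinarith
  have hgK : ∀ n ≤ K, g n ≤ 2 * g K := by
    intro n hn
    refine le_two_mul_of_slow_decay (η := fun n => e n + 2 * δ n) hg0
      (fun n => by linarith [he0 n, hδ0 n]) (fun n _ => hgs n)
      (fun n => by linarith [he1 n, hδ1 n]) ?_ hn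
    have q0 : ∑ n ∈ Finset.range K, 2 * δ n = 2 * ∑ n ∈ Finset.range K, δ n :=
      (Finset.mul_sum _ _ _).symm
    rw [Finset.sum_add_distrib, q0]
    have q1 : ∑ n ∈ Finset.range K, e n ≤ 1 / 64 * 4 := by
      simp only [he, ← Finset.mul_sum]
      gcongr
      exact sum_inv_repetitions_le K
    have q2 : ∑ n ∈ Finset.range K, δ n ≤ 2 / 256 := by
      simp only [hδ, ← Finset.sum_div]
      gcongr
      have := geom_sum_eq (x := (1 / 2 : ℝ)) (by norm_num) K
      rw [this]
      have : (0 : ℝ) ≤ (1 / 2) ^ K := by positivity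
      rw [div_le_iff_of_neg (by norm_num)]
      linarith
    linarith
  have hgKpos : 0 < g K := by
    have := hgK 0 (Nat.zero_le K)
    rw [hg_zero] at this
    linarith
  have hp : g K ≤ (testChain s K).accepted lam 1 := by rw [hgb]; linarith [hb0 K]
  refine ⟨hgKpos.trans_le hp, ?_, ?_⟩
  · calc b K ≤ (1 - γ) * ((1 / 16) ^ K / γ + (1 / 2) ^ K) * g K := hratio K le_rfl
      _ ≤ ε * g K := by gcongr
      _ ≤ _ := by gcongr
  · have hmean : ∀ n ≤ K, (testChain s n).meanCost lam (fun R => (R.r : ℝ)) ≤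
        ∑ m ∈ Finset.range n, A / W * ((repetitions K m : ℝ) ^ 2 * 2 ^ m) * (g m + b m) := by
      intro n hn
      induction n with
      | zero => simp [testChain, Strategy.meanCost, Strategy.eval]
      | succ n ih =>
        rw [Finset.sum_range_succ]
        refine (testChain_meanCost_succ_le hlam s n _).trans ?_
        rw [hgb]
        have q1 := ih (by omega)
        have q2 : 0 ≤ g n + b n := add_nonneg (hg0 n) (hb0 n)
        exact add_le_add q1 (mul_le_mul_of_nonneg_right (hcost n) q2)
    have hterm : ∀ m ∈ Finset.range K, A / W * ((repetitions K m : ℝ) ^ 2 * 2 ^ m) * (g m + b m) ≤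
        A / W * (4 * ((repetitions K m : ℝ) ^ 2 * 2 ^ m) +
          2 * Y * ((repetitions K m : ℝ) ^ 2 * 2 ^ m * (1 / 16) ^ m)) * g K := by
      intro m hm
      have hm' := (Finset.mem_range.1 hm).le
      have q1 := hratio m hm'
      have q2 := hgK m hm'
      have q3 : (1 - γ) * ((1 / 16) ^ m / γ + (1 / 2) ^ m) ≤ 1 + Y * (1 / 16) ^ m := by
        have r1 : (1 - γ) * (1 / 2 : ℝ) ^ m ≤ 1 := by
          have : (1 / 2 : ℝ) ^ m ≤ 1 := pow_le_one₀ (by norm_num) (by norm_num)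
          have : (0 : ℝ) < (1 / 2) ^ m := by positivity
          nlinarith
        have r2 : (1 - γ) * ((1 / 16 : ℝ) ^ m / γ) = (1 - γ) / γ * (1 / 16) ^ m := by ring
        have r3 : (1 - γ) / γ * (1 / 16 : ℝ) ^ m ≤ Y * (1 / 16) ^ m := by gcongr
        linarith
      have hx0 : 0 ≤ 2 + Y * (1 / 16 : ℝ) ^ m := by positivity
      have q4 : g m + b m ≤ (2 + Y * (1 / 16) ^ m) * (2 * g K) := by
        have r1 := mul_le_mul_of_nonneg_right q3 (hg0 m)
        have r2 := mul_le_mul_of_nonneg_left q2 hx0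
        linarith
      have hc : 0 ≤ A / W * ((repetitions K m : ℝ) ^ 2 * 2 ^ m) := by positivity
      refine (mul_le_mul_of_nonneg_left q4 hc).trans (le_of_eq ?_)
      ring
    have hsum := (hmean K le_rfl).trans (Finset.sum_le_sum hterm)
    rw [← Finset.sum_mul, ← Finset.mul_sum, Finset.sum_add_distrib, ← Finset.mul_sum,
      ← Finset.mul_sum] at hsum
    have r1 := sum_repetitions_sq_mul_le K
    have r2 := sum_repetitions_sq_mul_geometric_le K
    -- Here 4 · 150 · 2^K ≤ 4800 Y, and 2Y · 300 = 600 Y.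
    have r3 : 4 * ∑ m ∈ Finset.range K, (repetitions K m : ℝ) ^ 2 * 2 ^ m +
        2 * Y * ∑ m ∈ Finset.range K, (repetitions K m : ℝ) ^ 2 * 2 ^ m * (1 / 16) ^ m ≤
        5400 * Y := by nlinarith
    have r4 : (testChain s K).meanCost lam (fun R => (R.r : ℝ)) ≤ A / W * (5400 * Y) * g K := by
      refine hsum.trans ?_
      gcongr
    -- The overhead of a restart is absorbed because Y ≥ 1, which is where ε < 1 - γ enters, and W ≤
    -- γ ≤ 2 g K.
    have r5 : 2 ≤ 4 * (Y / W) * g K := by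
      have := hgK 0 (Nat.zero_le K)
      rw [hg_zero] at this
      have : γ ≤ 2 * g K := hi.trans this
      have : 1 ≤ Y / W * (2 * g K) := by
        rw [div_mul_eq_mul_div, le_div_iff₀ hW0]
        nlinarith
      linarith
    have r6 : (1 - γ) / W * (1 / ε + 1 / γ) = Y / W := by rw [hY]; ring
    rw [r6]
    calc 2 + (testChain s K).meanCost lam (fun R => (R.r : ℝ)) ≤
        (4 + 5400 * A) * (Y / W) * g K := by
          have : A / W * (5400 * Y) * g K = 5400 * A * (Y / W) * g K := by ring
          linarith
      _ ≤ _ := by gcongr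

/-! ## The fractional-swap circuit -/

section circuit

variable {d : ℕ}

/-- Partial trace over `S₂`. -/
def traceSecond (Y : Matrix (Site d × Site d) (Site d × Site d) ℂ) : Matrix (Site d) (Site d) ℂ :=
  Matrix.of fun s s' => ∑ q, Y (s, q) (s', q)

/-- The memory with ancilla in `|0⟩`. -/
def withAncilla (Y : Matrix (Site d × Site d) (Site d × Site d) ℂ) : MemOp d :=
  Matrix.single 0 0 1 ⊗ₖ Y

/-- The operator on a site with the given blocks with respect to the qubit. -/
def ofBlocks (Z : Fin 2 → Fin 2 → Matrix (Fin d) (Fin d) ℂ) : Matrix (Site d) (Site d) ℂ :=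
  Matrix.of fun s s' => Z s.1 s'.1 s.2 s'.2

theorem one_kronecker_mul_apply {m n l : Type*} [Fintype m] [Fintype n] [DecidableEq m]
    (B : Matrix n n ℂ) (M : Matrix (m × n) l ℂ) (p : m × n) (q : l) :
    (((1 : Matrix m m ℂ) ⊗ₖ B) * M) p q = ∑ k, B p.2 k * M (p.1, k) q := by
  simp [Matrix.mul_apply, Fintype.sum_prod_type, Matrix.kroneckerMap_apply, Matrix.one_apply,
    ite_mul]

theorem kronecker_one_mul_apply {m n l : Type*} [Fintype m] [Fintype n] [DecidableEq n]
    (A : Matrix m m ℂ) (M : Matrix (m × n) l ℂ) (p : m × n) (q : l) :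
    ((A ⊗ₖ (1 : Matrix n n ℂ)) * M) p q = ∑ k, A p.1 k * M (k, p.2) q := by
  simp [Matrix.mul_apply, Fintype.sum_prod_type, Matrix.kroneckerMap_apply, Matrix.one_apply,
    ite_mul]

theorem mul_one_kronecker_apply {m n l : Type*} [Fintype m] [Fintype n] [DecidableEq m]
    (B : Matrix n n ℂ) (M : Matrix l (m × n) ℂ) (p : l) (q : m × n) :
    (M * ((1 : Matrix m m ℂ) ⊗ₖ B)) p q = ∑ k, M p (q.1, k) * B k q.2 := by
  simp [Matrix.mul_apply, Fintype.sum_prod_type, Matrix.kroneckerMap_apply, Matrix.one_apply,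
    mul_ite]

theorem mul_kronecker_one_apply {m n l : Type*} [Fintype m] [Fintype n] [DecidableEq n]
    (A : Matrix m m ℂ) (M : Matrix l (m × n) ℂ) (p : l) (q : m × n) :
    (M * (A ⊗ₖ (1 : Matrix n n ℂ))) p q = ∑ k, M p (k, q.2) * A k q.1 := by
  simp [Matrix.mul_apply, Fintype.sum_prod_type, Matrix.kroneckerMap_apply, Matrix.one_apply,
    mul_ite]

theorem conjBy_conjBy (K L X : MemOp d) : conjBy K (conjBy L X) = conjBy (K * L) X := by
  simp only [conjBy, Matrix.conjTranspose_mul, Matrix.mul_assoc]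

theorem conjBy_withAncilla (F Y : Matrix (Site d × Site d) (Site d × Site d) ℂ) :
    conjBy ((1 : Matrix (Fin 2) (Fin 2) ℂ) ⊗ₖ F) (withAncilla Y) =
      withAncilla (F * Y * F.conjTranspose) := by
  simp only [conjBy, withAncilla, Matrix.conjTranspose_kronecker, ← Matrix.mul_kronecker_mul,
    Matrix.conjTranspose_one, Matrix.one_mul, Matrix.mul_one]

theorem traceSecond_conj (A : Matrix (Site d) (Site d) ℂ)
    (Y : Matrix (Site d × Site d) (Site d × Site d) ℂ) :
    traceSecond ((A ⊗ₖ (1 : Matrix (Site d) (Site d) ℂ)) * Y *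
      (A ⊗ₖ (1 : Matrix (Site d) (Site d) ℂ)).conjTranspose) =
      A * traceSecond Y * A.conjTranspose := by
  rw [Matrix.conjTranspose_kronecker, Matrix.conjTranspose_one]
  ext s s'
  simp only [traceSecond, Matrix.of_apply, mul_kronecker_one_apply, kronecker_one_mul_apply]
  rw [Finset.sum_comm, Matrix.mul_apply]
  refine Finset.sum_congr rfl fun k _ => ?_
  rw [← Finset.sum_mul, Finset.sum_comm, Matrix.mul_apply]
  simp only [Matrix.of_apply, Finset.mul_sum]

theorem resetQubit_ancilla (X : MemOp d) :
    resetQubit .ancilla X = withAncilla (Matrix.of fun p p' => ∑ k, X (k, p) (k, p')) := by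
  ext ⟨a, p⟩ ⟨a', p'⟩
  simp only [resetQubit, conjBy, onQubit, withAncilla, Matrix.conjTranspose_kronecker,
    Matrix.conjTranspose_one, Matrix.sum_apply, mul_kronecker_one_apply, kronecker_one_mul_apply,
    Matrix.kroneckerMap_apply, Matrix.of_apply, Fin.sum_univ_two]
  fin_cases a <;> fin_cases a' <;> simp

/-- The matrix of a qubit gate on a site. -/
def onSite (A : Matrix (Fin 2) (Fin 2) ℂ) : Matrix (Site d) (Site d) ℂ :=
  A ⊗ₖ (1 : Matrix (Fin d) (Fin d) ℂ)

theorem onSite_conj_ofBlocks (A : Matrix (Fin 2) (Fin 2) ℂ)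
    (Z : Fin 2 → Fin 2 → Matrix (Fin d) (Fin d) ℂ) :
    onSite A * ofBlocks Z * (onSite A).conjTranspose =
      ofBlocks fun c c' => ∑ k, ∑ l, (A c k * star (A c' l)) • Z k l := by
  ext ⟨c, x⟩ ⟨c', x'⟩
  rw [onSite, Matrix.conjTranspose_kronecker, Matrix.conjTranspose_one, mul_kronecker_one_apply]
  simp only [kronecker_one_mul_apply, ofBlocks, Matrix.of_apply, Fin.sum_univ_two,
    Matrix.conjTranspose_apply, Matrix.add_apply, Matrix.smul_apply, smul_eq_mul]
  ring

theorem conjBy_onQubit_first (A : Matrix (Fin 2) (Fin 2) ℂ)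
    (Y : Matrix (Site d × Site d) (Site d × Site d) ℂ) :
    conjBy (onQubit .first A) (withAncilla Y) =
      withAncilla ((onSite A ⊗ₖ (1 : Matrix (Site d) (Site d) ℂ)) * Y *
        (onSite A ⊗ₖ (1 : Matrix (Site d) (Site d) ℂ)).conjTranspose) :=
  conjBy_withAncilla _ _

theorem withAncilla_add (Y Y' : Matrix (Site d × Site d) (Site d × Site d) ℂ) :
    withAncilla (Y + Y') = withAncilla Y + withAncilla Y' :=
  Matrix.kronecker_add _ _ _

theorem traceSecond_add (Y Y' : Matrix (Site d × Site d) (Site d × Site d) ℂ) :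
    traceSecond (Y + Y') = traceSecond Y + traceSecond Y' := by
  ext s s'
  simp [traceSecond, Finset.sum_add_distrib]

theorem traceSecond_smul (a : ℂ) (Y : Matrix (Site d × Site d) (Site d × Site d) ℂ) :
    traceSecond (a • Y) = a • traceSecond Y := by
  ext s s'
  simp [traceSecond, Finset.mul_sum]

theorem readQudit_withAncilla (Y : Matrix (Site d × Site d) (Site d × Site d) ℂ)
    {Z : Fin 2 → Fin 2 → Matrix (Fin d) (Fin d) ℂ} (hY : traceSecond Y = ofBlocks Z) :
    readQudit (withAncilla Y) = Z 0 0 + Z 1 1 := by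
  ext x x'
  have h0 := congrFun (congrFun hY (0, x)) (0, x')
  have h1 := congrFun (congrFun hY (1, x)) (1, x')
  simp only [traceSecond, ofBlocks, Matrix.of_apply] at h0 h1
  simp [readQudit, withAncilla, Matrix.kroneckerMap_apply, Fin.sum_univ_two, h0, h1]

theorem readQudit_eq_traceSecond (X : MemOp d) (x x' : Fin d) :
    readQudit X x x' = ∑ c, traceSecond (Matrix.of fun p p' => ∑ k, X (k, p) (k, p')) (c, x) (c, x') := by
  simp only [readQudit, traceSecond, Matrix.of_apply]
  rw [Finset.sum_comm]
  refine Finset.sum_congr rfl fun c _ => ?_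
  rw [Finset.sum_comm]

theorem exists_ofBlocks (M : Matrix (Site d) (Site d) ℂ) : ∃ Z, M = ofBlocks Z :=
  ⟨fun c c' => Matrix.of fun x x' => M (c, x) (c', x'), rfl⟩

theorem hadamard_apply (i j : Fin 2) :
    hadamard i j = ((√2 : ℝ) : ℂ)⁻¹ * (if i = 1 ∧ j = 1 then -1 else 1) := by
  fin_cases i <;> fin_cases j <;> simp [hadamard]

theorem inv_sqrt_two_mul_self : ((√2 : ℝ) : ℂ)⁻¹ * ((√2 : ℝ) : ℂ)⁻¹ = 1 / 2 := by
  rw [← mul_inv, ← Complex.ofReal_mul, Real.mul_self_sqrt (by norm_num)]; norm_num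

/-- The preparation of the ancilla and of the qubit of `S₁`. -/
theorem execute_preparation (ρ : Matrix (Fin d) (Fin d) ℂ) (X : MemOp d) :
    ∃ Y, execute ρ [.reset .ancilla, .reset .first, .gate .first gateH] X = withAncilla Y ∧
      traceSecond Y = ofBlocks fun _ _ => (1 / 2 : ℂ) • readQudit X := by
  simp only [execute, List.foldl_cons, List.foldl_nil, Instr.apply]
  rw [resetQubit_ancilla]
  set Y₀ : Matrix (Site d × Site d) (Site d × Site d) ℂ :=
    Matrix.of fun p p' => ∑ k, X (k, p) (k, p') with hY₀
  obtain ⟨Z, hZ⟩ := exists_ofBlocks (traceSecond Y₀)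
  have hread : readQudit X = Z 0 0 + Z 1 1 := by
    ext x x'
    rw [readQudit_eq_traceSecond, ← hY₀, hZ]
    simp [ofBlocks, Fin.sum_univ_two]
  simp only [resetQubit, Fin.sum_univ_two, conjBy_onQubit_first, ← withAncilla_add]
  refine ⟨_, rfl, ?_⟩
  rw [traceSecond_conj, traceSecond_add, traceSecond_conj, traceSecond_conj, hZ,
    onSite_conj_ofBlocks, onSite_conj_ofBlocks]
  have : (ofBlocks (d := d) fun c c' => ∑ k, ∑ l,
        ((Matrix.single 0 0 1 : Matrix (Fin 2) (Fin 2) ℂ) c k *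
          star ((Matrix.single 0 0 1 : Matrix (Fin 2) (Fin 2) ℂ) c' l)) • Z k l) +
      (ofBlocks fun c c' => ∑ k, ∑ l,
        ((Matrix.single 0 1 1 : Matrix (Fin 2) (Fin 2) ℂ) c k *
          star ((Matrix.single 0 1 1 : Matrix (Fin 2) (Fin 2) ℂ) c' l)) • Z k l) =
      ofBlocks fun c c' => if c = 0 ∧ c' = 0 then readQudit X else 0 := by
    ext ⟨c, x⟩ ⟨c', x'⟩
    rw [hread]
    fin_cases c <;> fin_cases c' <;> simp [ofBlocks, Matrix.single_apply, Fin.sum_univ_two]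
  rw [this, onSite_conj_ofBlocks]
  congr 1
  ext c c' : 2
  have h2 := inv_sqrt_two_mul_self
  simp [gateH, hadamard_apply, h2]

/-- The measurement of the qubit of `S₁` in the basis `|±⟩`. -/
theorem readQudit_measure (ρ : Matrix (Fin d) (Fin d) ℂ) (o : Bool)
    (Y : Matrix (Site d × Site d) (Site d × Site d) ℂ)
    {Z : Fin 2 → Fin 2 → Matrix (Fin d) (Fin d) ℂ} (hY : traceSecond Y = ofBlocks Z) :
    readQudit (measureFirst o (execute ρ [.gate .first gateH] (withAncilla Y))) =
      (1 / 2 : ℂ) • (Z 0 0 + Z 1 1 + (outcomeSign o : ℂ) • (Z 0 1 + Z 1 0)) := by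
  simp only [execute, List.foldl_cons, List.foldl_nil, Instr.apply, measureFirst,
    conjBy_onQubit_first]
  have h2 := inv_sqrt_two_mul_self
  cases o <;>
  · rw [readQudit_withAncilla (hY := by
      rw [traceSecond_conj, traceSecond_conj, hY, onSite_conj_ofBlocks, onSite_conj_ofBlocks])]
    simp [Matrix.single_apply, Fin.sum_univ_two, gateH, hadamard_apply, h2, outcomeSign]
    module

end circuit

/-! ### Synthesis of the fractional swap and its channel on `S₁` -/

section fractionalSwap

variable {d : ℕ}

/-- The operator `A ⊗ 1 + B ⊗ SWAP` on the memory. -/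
def pairOp (A B : Matrix (Fin 2) (Fin 2) ℂ) : MemOp d :=
  A ⊗ₖ (1 : Matrix (Site d × Site d) (Site d × Site d) ℂ) + B ⊗ₖ swapSites d

theorem mul_swapSites_apply (M : Matrix (Site d × Site d) (Site d × Site d) ℂ)
    (p p' : Site d × Site d) : (M * swapSites d) p p' = M p (p'.2, p'.1) := by
  rw [Matrix.mul_apply, Finset.sum_eq_single (p'.2, p'.1)]
  · simp [swapSites]
  · intro q _ hq
    simp only [swapSites, Matrix.of_apply, mul_ite, mul_one, mul_zero, ite_eq_right_iff]
    exact fun h => absurd (Prod.ext h.1 h.2) hq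
  · simp

theorem swapSites_mul_apply (M : Matrix (Site d × Site d) (Site d × Site d) ℂ)
    (p p' : Site d × Site d) : (swapSites d * M) p p' = M (p.2, p.1) p' := by
  rw [Matrix.mul_apply, Finset.sum_eq_single (p.2, p.1)]
  · simp [swapSites]
  · intro q _ hq
    simp only [swapSites, Matrix.of_apply, ite_mul, one_mul, zero_mul, ite_eq_right_iff]
    exact fun h => absurd (Prod.ext h.2.symm h.1.symm) hq
  · simp

theorem swapSites_mul_self : swapSites d * swapSites d = 1 := by
  ext p p'
  rw [swapSites_mul_apply]
  simp only [swapSites, Matrix.of_apply, Matrix.one_apply, Prod.ext_iff]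
  congr 1
  simp only [and_comm]

theorem swapSites_conjTranspose : (swapSites d).conjTranspose = swapSites d := by
  ext p p'
  simp only [swapSites, Matrix.conjTranspose_apply, Matrix.of_apply]
  split_ifs with h1 h2 h2
  · simp
  · exact absurd ⟨h1.2.symm, h1.1.symm⟩ h2
  · exact absurd ⟨h2.2.symm, h2.1.symm⟩ h1
  · simp

theorem onQubit_ancilla_mul_pairOp (G A B : Matrix (Fin 2) (Fin 2) ℂ) :
    onQubit .ancilla G * pairOp (d := d) A B = pairOp (G * A) (G * B) := by
  simp only [onQubit, pairOp, mul_add, ← Matrix.mul_kronecker_mul, Matrix.one_mul]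

/-- Since SWAP² = 1, the operators A ⊗ 1 + B ⊗ SWAP are closed under the gates of the circuit, and
the synthesis reduces to 2 × 2 matrices. A controlled swap exchanges the lower rows of A and B. -/
theorem controlledSwap_mul_pairOp (A B : Matrix (Fin 2) (Fin 2) ℂ) :
    controlledSwap d * pairOp A B =
      pairOp (Matrix.single 0 0 1 * A + Matrix.single 1 1 1 * B)
        (Matrix.single 0 0 1 * B + Matrix.single 1 1 1 * A) := by
  simp only [controlledSwap, pairOp, mul_add, add_mul, ← Matrix.mul_kronecker_mul, Matrix.one_mul,
    Matrix.mul_one, swapSites_mul_self, Matrix.add_kronecker]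
  abel

/-- The angles θ₊ ± θ₋ are the two arccosines, so the addition formulas turn their sum and
difference into these products. -/
theorem two_mul_cos_theta (t : ℝ) :
    2 * (Real.cos (thetaPlus t) * Real.cos (thetaMinus t)) = Real.cos t ∧
    2 * (Real.sin (thetaPlus t) * Real.sin (thetaMinus t)) = Real.sin t := by
  have h := Real.sin_sq_add_cos_sq t
  have b1 := abs_le.1 (Real.abs_cos_le_one t)
  have b2 := abs_le.1 (Real.abs_sin_le_one t)
  have e1 := Real.cos_arccos (x := (Real.cos t - Real.sin t) / 2) (by linarith) (by linarith)
  have e2 := Real.cos_arccos (x := (Real.cos t + Real.sin t) / 2) (by linarith) (by linarith)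
  set A := Real.arccos ((Real.cos t - Real.sin t) / 2) with hA
  set B := Real.arccos ((Real.cos t + Real.sin t) / 2) with hB
  have f1 : A = thetaPlus t + thetaMinus t := by
    rw [thetaPlus, thetaMinus, ← hA, ← hB]; ring
  have f2 : B = thetaPlus t - thetaMinus t := by
    rw [thetaPlus, thetaMinus, ← hA, ← hB]; ring
  rw [f1, Real.cos_add] at e1
  rw [f2, Real.cos_sub] at e2
  constructor <;> linarith

theorem expPauli_X (θ : ℝ) : expPauli pauliX θ =
    !![(Real.cos θ : ℂ), -Complex.I * Real.sin θ; -Complex.I * Real.sin θ, Real.cos θ] := by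
  ext i j
  fin_cases i <;> fin_cases j <;> simp [expPauli, pauliX]

theorem expPauli_Y (θ : ℝ) : expPauli pauliY θ =
    !![(Real.cos θ : ℂ), -Real.sin θ; (Real.sin θ : ℂ), Real.cos θ] := by
  ext i j
  fin_cases i <;> fin_cases j <;> simp [expPauli, pauliY, -Complex.ofReal_sin, -Complex.ofReal_cos]
  · linear_combination (Real.sin θ : ℂ) * Complex.I_sq
  · linear_combination -(Real.sin θ : ℂ) * Complex.I_sq

/-- The polynomial identities behind the synthesis of the fractional swap; `p`, `q` are cosine and
sine of one angle and `u`, `v` of the other. -/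
theorem synthesis_identity {p q u v : ℂ} (hp : p ^ 2 + q ^ 2 = 1) (hu : u ^ 2 + v ^ 2 = 1)
    (h : 4 * (p ^ 2 * u ^ 2) + 4 * (q ^ 2 * v ^ 2) = 1) :
    (2 * p ^ 2 - 1) * (4 * u ^ 2 - 3) = -(2 * p ^ 2) := by
  linear_combination h + 4 * (u ^ 2 - 1) * hp - 4 * q ^ 2 * hu

/-- The factor |0⟩⟨0| on the right encodes that the ancilla starts in |0⟩, so only first columns
matter. The vanishing lower entries say that it returns to |0⟩. -/
theorem ancilla_product {p q u v : ℂ} (hp : p ^ 2 + q ^ 2 = 1) (hu : u ^ 2 + v ^ 2 = 1)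
    (h : 4 * (p ^ 2 * u ^ 2) + 4 * (q ^ 2 * v ^ 2) = 1)
    {G₁ G₃ G₅ G₇ : Matrix (Fin 2) (Fin 2) ℂ}
    (h₁ : G₁ = !![u, -Complex.I * v; -Complex.I * v, u])
    (h₃ : G₃ = !![p, -q; q, p] * pauliZ * !![p, q; -q, p])
    (h₅ : G₅ = !![u, -Complex.I * v; -Complex.I * v, u] * pauliZ *
      !![u, Complex.I * v; Complex.I * v, u])
    (h₇ : G₇ = !![p, q; -q, p]) :
    onQubit .ancilla G₇ * (controlledSwap d * (onQubit .ancilla G₅ * (controlledSwap d *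
      (onQubit .ancilla G₃ * (controlledSwap d * (onQubit .ancilla G₁ *
        pairOp (Matrix.single 0 0 1) 0)))))) =
      pairOp (-(2 * (p * u)) • Matrix.single 0 0 1)
        ((Complex.I * (2 * (q * v))) • Matrix.single 0 0 1) := by
  have K := synthesis_identity hp hu h
  have K2 : (2 * p ^ 2 - 1) * (4 * u ^ 2 - 1) = 2 * p ^ 2 - 2 := by linear_combination K
  have hI : Complex.I ^ 2 = -1 := Complex.I_sq
  have e₃ : G₃ = !![2 * p ^ 2 - 1, 2 * (p * q); 2 * (p * q), 1 - 2 * p ^ 2] := by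
    rw [h₃]
    ext i j
    fin_cases i <;> fin_cases j <;> simp [pauliZ, Matrix.mul_apply, Fin.sum_univ_two]
    · linear_combination -hp
    · ring
    · ring
    · linear_combination hp
  have e₅ : G₅ = !![2 * u ^ 2 - 1, 2 * (Complex.I * (u * v));
      -(2 * (Complex.I * (u * v))), 1 - 2 * u ^ 2] := by
    rw [h₅]
    ext i j
    fin_cases i <;> fin_cases j <;> simp [pauliZ, Matrix.mul_apply, Fin.sum_univ_two]
    · linear_combination v ^ 2 * hI - hu
    · ring
    · ring
    · linear_combination -v ^ 2 * hI + hu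
  have s0 : (Matrix.single 0 0 1 : Matrix (Fin 2) (Fin 2) ℂ) = !![1, 0; 0, 0] := by
    ext i j; fin_cases i <;> fin_cases j <;> simp
  have s1 : (Matrix.single 1 1 1 : Matrix (Fin 2) (Fin 2) ℂ) = !![0, 0; 0, 1] := by
    ext i j; fin_cases i <;> fin_cases j <;> simp
  simp only [onQubit_ancilla_mul_pairOp, controlledSwap_mul_pairOp, s0, s1]
  rw [h₁, e₃, e₅, h₇]
  congr 1
  · ext i j
    fin_cases i <;> fin_cases j <;> simp [Matrix.mul_apply, Fin.sum_univ_two]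
    · linear_combination (-2 * p * u * v ^ 2 * (1 - 2 * p ^ 2) + 4 * p * q ^ 2 * u * v ^ 2) * hI +
        (2 * p * u * (1 - 2 * p ^ 2) - 4 * q ^ 2 * p * u) * hu + p * u * K - 2 * p * u * hp
    · linear_combination (2 * q * u * v ^ 2 * (1 - 2 * p ^ 2) + 4 * p ^ 2 * q * u * v ^ 2) * hI +
        (-2 * q * u * (1 - 2 * p ^ 2) - 4 * p ^ 2 * q * u) * hu - q * u * K
  · ext i j
    fin_cases i <;> fin_cases j <;> simp [Matrix.mul_apply, Fin.sum_univ_two]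
    · linear_combination -Complex.I * q * v * K2
    · linear_combination -Complex.I * p * v * K2 - 2 * p * Complex.I * v * hp

/-- The operator `-exp(-i t SWAP)`. -/
def swapRotation (t : ℝ) : Matrix (Site d × Site d) (Site d × Site d) ℂ :=
  (-(Real.cos t : ℂ)) • 1 + (Complex.I * Real.sin t) • swapSites d

/-- The state of a fresh system `S₂`. -/
def freshSite (ρ : Matrix (Fin d) (Fin d) ℂ) : Matrix (Site d) (Site d) ℂ :=
  Matrix.single 1 1 1 ⊗ₖ ρ

theorem conjBy_onQubit_second (A : Matrix (Fin 2) (Fin 2) ℂ)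
    (Y : Matrix (Site d × Site d) (Site d × Site d) ℂ) :
    conjBy (onQubit .second A) (withAncilla Y) =
      withAncilla (((1 : Matrix (Site d) (Site d) ℂ) ⊗ₖ onSite A) * Y *
        ((1 : Matrix (Site d) (Site d) ℂ) ⊗ₖ onSite A).conjTranspose) :=
  conjBy_withAncilla _ _

theorem onQubit_second_mul (A B : Matrix (Fin 2) (Fin 2) ℂ) :
    onQubit (d := d) .second A * onQubit .second B = onQubit .second (A * B) := by
  simp only [onQubit, ← Matrix.mul_kronecker_mul, Matrix.one_mul]

theorem conjBy_add (K X X' : MemOp d) : conjBy K (X + X') = conjBy K X + conjBy K X' := by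
  simp only [conjBy, mul_add, add_mul]

theorem onSite_mul_apply (A : Matrix (Fin 2) (Fin 2) ℂ) (q q' : Site d) :
    onSite A q q' = if q.2 = q'.2 then A q.1 q'.1 else 0 := by
  simp [onSite, Matrix.kroneckerMap_apply, Matrix.one_apply]

theorem onSite_single_conj_apply (k : Fin 2)
    (Y : Matrix (Site d × Site d) (Site d × Site d) ℂ) (s s' : Site d) (b b' : Fin 2) (y y' : Fin d) :
    (((1 : Matrix (Site d) (Site d) ℂ) ⊗ₖ onSite (Matrix.single 1 k 1)) * Y *
      ((1 : Matrix (Site d) (Site d) ℂ) ⊗ₖ onSite (Matrix.single 1 k 1)).conjTranspose :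
        Matrix (Site d × Site d) (Site d × Site d) ℂ) (s, (b, y)) (s', (b', y')) =
      if b = 1 ∧ b' = 1 then Y (s, (k, y)) (s', (k, y')) else 0 := by
  rw [Matrix.conjTranspose_kronecker, Matrix.conjTranspose_one, mul_one_kronecker_apply]
  simp only [one_kronecker_mul_apply, Matrix.conjTranspose_apply, onSite_mul_apply,
    Fintype.sum_prod_type, ite_mul, zero_mul, apply_ite star, star_zero, mul_ite, mul_zero,
    Finset.sum_ite_eq, Finset.mem_univ, if_true]
  fin_cases b <;> fin_cases b' <;> fin_cases k <;> simp [Matrix.single_apply]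

theorem execute_load (ρ : Matrix (Fin d) (Fin d) ℂ)
    (Y : Matrix (Site d × Site d) (Site d × Site d) ℂ) :
    execute ρ [.reset .second, .gate .second gateX, .load .second] (withAncilla Y) =
      withAncilla (traceSecond Y ⊗ₖ freshSite ρ) := by
  simp only [execute, List.foldl_cons, List.foldl_nil, Instr.apply, resetQubit, Fin.sum_univ_two,
    conjBy_add, conjBy_conjBy, onQubit_second_mul]
  have hX : ∀ k : Fin 2, (gateX : Matrix (Fin 2) (Fin 2) ℂ) * Matrix.single 0 k 1 =
      Matrix.single 1 k 1 := by
    intro k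
    ext i j
    fin_cases k <;> fin_cases i <;> fin_cases j <;>
      simp [gateX, pauliX, Matrix.mul_apply, Matrix.single_apply]
  rw [hX, hX, conjBy_onQubit_second, conjBy_onQubit_second, ← withAncilla_add]
  ext ⟨a, s, b, y⟩ ⟨a', s', b', y'⟩
  simp only [loadQudit, withAncilla, Matrix.of_apply, Matrix.kroneckerMap_apply, Matrix.add_apply,
    onSite_single_conj_apply, traceSecond, freshSite, Fintype.sum_prod_type, Fin.sum_univ_two]
  fin_cases a <;> fin_cases a' <;> fin_cases b <;> fin_cases b' <;>
    simp [Finset.sum_add_distrib]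

theorem execute_append (ρ : Matrix (Fin d) (Fin d) ℂ) (p q : List Instr) (X : MemOp d) :
    execute ρ (p ++ q) X = execute ρ q (execute ρ p X) :=
  List.foldl_append

/-- An iteration of the circuit is a fractional swap with a fresh copy. -/
theorem execute_fracSwapStep (ρ : Matrix (Fin d) (Fin d) ℂ) (t : ℝ)
    (Y : Matrix (Site d × Site d) (Site d × Site d) ℂ) :
    execute ρ (fracSwapStep t) (withAncilla Y) = withAncilla
      (swapRotation t * (traceSecond Y ⊗ₖ freshSite ρ) * (swapRotation t).conjTranspose) := by
  have hsplit : fracSwapStep t = [.reset .second, .gate .second gateX, .load .second] ++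
      [.gate .ancilla (gateExpX (thetaMinus t)), .cswap,
        .gate .ancilla (gateExpY (thetaPlus t) * gateZ * gateExpY (-thetaPlus t)), .cswap,
        .gate .ancilla (gateExpX (thetaMinus t) * gateZ * gateExpX (-thetaMinus t)), .cswap,
        .gate .ancilla (gateExpY (-thetaPlus t))] := rfl
  rw [hsplit, execute_append, execute_load]
  set M := traceSecond Y ⊗ₖ freshSite ρ
  obtain ⟨hc, hs⟩ := two_mul_cos_theta t
  have hp : ((Real.cos (thetaPlus t) : ℂ)) ^ 2 + (Real.sin (thetaPlus t) : ℂ) ^ 2 = 1 := by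
    exact_mod_cast Real.cos_sq_add_sin_sq (thetaPlus t)
  have hu : ((Real.cos (thetaMinus t) : ℂ)) ^ 2 + (Real.sin (thetaMinus t) : ℂ) ^ 2 = 1 := by
    exact_mod_cast Real.cos_sq_add_sin_sq (thetaMinus t)
  have h : 4 * ((Real.cos (thetaPlus t) : ℂ) ^ 2 * (Real.cos (thetaMinus t) : ℂ) ^ 2) +
      4 * ((Real.sin (thetaPlus t) : ℂ) ^ 2 * (Real.sin (thetaMinus t) : ℂ) ^ 2) = 1 := by
    have := Real.cos_sq_add_sin_sq t
    rw [← hc, ← hs] at this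
    have h' : (4 * (Real.cos (thetaPlus t) ^ 2 * Real.cos (thetaMinus t) ^ 2) +
      4 * (Real.sin (thetaPlus t) ^ 2 * Real.sin (thetaMinus t) ^ 2) : ℝ) = 1 := by
      linear_combination this
    exact_mod_cast h'
  have prod := ancilla_product (d := d) hp hu h
    (G₁ := gateExpX (thetaMinus t))
    (G₃ := (gateExpY (thetaPlus t) * gateZ * gateExpY (-thetaPlus t) : U2))
    (G₅ := (gateExpX (thetaMinus t) * gateZ * gateExpX (-thetaMinus t) : U2))
    (G₇ := gateExpY (-thetaPlus t))
    (expPauli_X _)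
    (by simp only [Submonoid.coe_mul, gateExpY, gateZ, expPauli_Y, Real.cos_neg, Real.sin_neg,
          Complex.ofReal_neg, neg_neg])
    (by simp only [Submonoid.coe_mul, gateExpX, gateZ, expPauli_X, Real.cos_neg, Real.sin_neg,
          Complex.ofReal_neg, neg_mul_neg])
    (by simp only [gateExpY, expPauli_Y, Real.cos_neg, Real.sin_neg, Complex.ofReal_neg, neg_neg])
  -- Inserting the projector onto the ancilla state |0⟩ brings the product into the form of
  -- `ancilla_product`.
  have hM : withAncilla M = conjBy (pairOp (Matrix.single 0 0 1) 0) (withAncilla M) := by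
    simp only [conjBy, pairOp, withAncilla, Matrix.zero_kronecker, add_zero,
      Matrix.conjTranspose_kronecker, Matrix.conjTranspose_one, ← Matrix.mul_kronecker_mul,
      Matrix.one_mul, Matrix.conjTranspose_single, star_one,
      Matrix.single_mul_single_same, mul_one]
  rw [hM]
  simp only [execute, List.foldl_cons, List.foldl_nil, Instr.apply, conjBy_conjBy]
  rw [prod]
  have hF : pairOp (d := d) (-(2 * ((Real.cos (thetaPlus t) : ℂ) * Real.cos (thetaMinus t))) •
        Matrix.single 0 0 1)
      ((Complex.I * (2 * ((Real.sin (thetaPlus t) : ℂ) * Real.sin (thetaMinus t)))) •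
        Matrix.single 0 0 1) = Matrix.single 0 0 1 ⊗ₖ swapRotation t := by
    have hc' : (Real.cos t : ℂ) = 2 * (Real.cos (thetaPlus t) * Real.cos (thetaMinus t)) := by
      exact_mod_cast hc.symm
    have hs' : (Real.sin t : ℂ) = 2 * (Real.sin (thetaPlus t) * Real.sin (thetaMinus t)) := by
      exact_mod_cast hs.symm
    simp only [pairOp, swapRotation, hc', hs', Matrix.kronecker_add, Matrix.smul_kronecker,
      Matrix.kronecker_smul]
  rw [hF]
  simp only [conjBy, withAncilla, Matrix.conjTranspose_kronecker, ← Matrix.mul_kronecker_mul,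
    Matrix.conjTranspose_single, star_one, Matrix.single_mul_single_same, mul_one]

/-- The channel on `S₁` of a fractional swap. -/
theorem traceSecond_swapRotation (t : ℝ) (X τ : Matrix (Site d) (Site d) ℂ) (hτ : τ.trace = 1) :
    traceSecond (swapRotation t * (X ⊗ₖ τ) * (swapRotation t).conjTranspose) =
      ((Real.cos t : ℂ) ^ 2) • X + ((Real.sin t : ℂ) ^ 2 * X.trace) • τ +
        (Complex.I * Real.sin t * Real.cos t) • (X * τ - τ * X) := by
  have hconj : (swapRotation (d := d) t).conjTranspose =
      (-(Real.cos t : ℂ)) • 1 - (Complex.I * Real.sin t) • swapSites d := by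
    rw [swapRotation, neg_smul]
    simp only [Matrix.conjTranspose_add, Matrix.conjTranspose_smul, Matrix.conjTranspose_neg,
      Matrix.conjTranspose_one, swapSites_conjTranspose, star_mul', RCLike.star_def,
      Complex.conj_ofReal, Complex.conj_I, neg_mul, neg_smul, sub_eq_add_neg]
  set M := X ⊗ₖ τ with hM
  have hexp : swapRotation t * M * (swapRotation t).conjTranspose =
      ((Real.cos t : ℂ) ^ 2) • M + ((Real.sin t : ℂ) ^ 2) • (swapSites d * M * swapSites d) +
        (Complex.I * Real.sin t * Real.cos t) • (M * swapSites d) +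
        (-(Complex.I * Real.sin t * Real.cos t)) • (swapSites d * M) := by
    rw [hconj, swapRotation]
    simp only [add_mul, mul_sub, Matrix.smul_mul, Matrix.mul_smul, Matrix.one_mul, Matrix.mul_one,
      smul_smul]
    have : Complex.I * (Real.sin t : ℂ) * (Complex.I * Real.sin t) = -(Real.sin t : ℂ) ^ 2 := by
      linear_combination (Real.sin t : ℂ) ^ 2 * Complex.I_sq
    rw [this]
    module
  rw [hexp, traceSecond_add, traceSecond_add, traceSecond_add, traceSecond_smul, traceSecond_smul,
    traceSecond_smul, traceSecond_smul]
  have t1 : traceSecond M = X := by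
    ext s s'
    simp only [traceSecond, Matrix.of_apply, hM, Matrix.kroneckerMap_apply, ← Finset.mul_sum]
    have : ∑ q, τ q q = 1 := hτ
    rw [this, mul_one]
  have t2 : traceSecond (M * swapSites d) = X * τ := by
    ext s s'
    rw [Matrix.mul_apply]
    simp only [traceSecond, Matrix.of_apply, mul_swapSites_apply, hM, Matrix.kroneckerMap_apply]
  have t3 : traceSecond (swapSites d * M) = τ * X := by
    ext s s'
    rw [Matrix.mul_apply]
    simp only [traceSecond, Matrix.of_apply, swapSites_mul_apply, hM, Matrix.kroneckerMap_apply,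
      mul_comm]
  have t4 : traceSecond (swapSites d * M * swapSites d) = X.trace • τ := by
    ext s s'
    simp [traceSecond, swapSites_mul_apply, mul_swapSites_apply, hM, Matrix.kroneckerMap_apply,
      Matrix.trace, Finset.sum_mul]
  rw [t1, t2, t3, t4]
  module

/-- The effect of a fractional swap on the blocks of the state of `S₁`. -/
theorem traceSecond_step_blocks (ρ : Matrix (Fin d) (Fin d) ℂ) (hρ : ρ.trace = 1) (t : ℝ)
    (Z : Fin 2 → Fin 2 → Matrix (Fin d) (Fin d) ℂ) :
    traceSecond (swapRotation t * (ofBlocks Z ⊗ₖ freshSite ρ) * (swapRotation t).conjTranspose) =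
      ofBlocks fun c c' => ((Real.cos t : ℂ) ^ 2) • Z c c' +
        (if c = 1 ∧ c' = 1 then
          ((Real.sin t : ℂ) ^ 2 * ((Z 0 0).trace + (Z 1 1).trace)) • ρ else 0) +
        (Complex.I * Real.sin t * Real.cos t) • ((if c' = 1 then Z c 1 * ρ else 0) -
          (if c = 1 then ρ * Z 1 c' else 0)) := by
  rw [traceSecond_swapRotation t _ _ (by simp [freshSite, Matrix.trace_kronecker, hρ])]
  have htr : (ofBlocks Z).trace = (Z 0 0).trace + (Z 1 1).trace := by
    simp [Matrix.trace, ofBlocks, Fintype.sum_prod_type, Fin.sum_univ_two]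
  rw [htr]
  ext ⟨c, x⟩ ⟨c', x'⟩
  simp only [Matrix.add_apply, Matrix.smul_apply, Matrix.sub_apply, ofBlocks, Matrix.of_apply,
    freshSite, Matrix.kroneckerMap_apply, Matrix.mul_apply, Fintype.sum_prod_type,
    Fin.sum_univ_two]
  fin_cases c <;> fin_cases c' <;> simp [Matrix.mul_apply]

end fractionalSwap

/-! ### Reduction to a Markov kernel on the eigenvectors of ρ -/

section diagonal

variable {d : ℕ}

/-- The operator that is diagonal with entries `w` in the basis given by the columns of `U`. -/
def diagIn (U : Matrix.unitaryGroup (Fin d) ℂ) (w : Fin d → ℂ) : Matrix (Fin d) (Fin d) ℂ :=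
  (U : Matrix (Fin d) (Fin d) ℂ) * Matrix.diagonal w * (U : Matrix (Fin d) (Fin d) ℂ).conjTranspose

variable (U : Matrix.unitaryGroup (Fin d) ℂ)

theorem unitary_conjTranspose_mul_self :
    (U : Matrix (Fin d) (Fin d) ℂ).conjTranspose * (U : Matrix (Fin d) (Fin d) ℂ) = 1 := by
  have := Matrix.mem_unitaryGroup_iff'.1 U.2
  rwa [Matrix.star_eq_conjTranspose] at this

theorem diagIn_mul (w w' : Fin d → ℂ) : diagIn U w * diagIn U w' = diagIn U (w * w') := by
  have h := unitary_conjTranspose_mul_self U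
  unfold diagIn
  calc _ = (U : Matrix (Fin d) (Fin d) ℂ) * Matrix.diagonal w *
        ((U : Matrix (Fin d) (Fin d) ℂ).conjTranspose * (U : Matrix (Fin d) (Fin d) ℂ)) *
        Matrix.diagonal w' * (U : Matrix (Fin d) (Fin d) ℂ).conjTranspose := by
        simp only [Matrix.mul_assoc]
    _ = _ := by
        rw [h, Matrix.mul_one, Matrix.mul_assoc _ (Matrix.diagonal w), Matrix.diagonal_mul_diagonal]
        rfl

theorem diagIn_add (w w' : Fin d → ℂ) : diagIn U w + diagIn U w' = diagIn U (w + w') := by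
  rw [diagIn, diagIn, diagIn, ← Matrix.add_mul, ← Matrix.mul_add, Matrix.diagonal_add]
  rfl

theorem diagIn_smul (a : ℂ) (w : Fin d → ℂ) : a • diagIn U w = diagIn U (a • w) := by
  rw [diagIn, diagIn, Matrix.diagonal_smul, Matrix.mul_smul, Matrix.smul_mul]

theorem diagIn_zero : diagIn U 0 = 0 := by
  simp [diagIn]

theorem diagIn_sub (w w' : Fin d → ℂ) : diagIn U w - diagIn U w' = diagIn U (w - w') := by
  have h := diagIn_smul U (-1) w'
  simp only [neg_smul, one_smul] at h
  rw [sub_eq_add_neg, h, diagIn_add, ← sub_eq_add_neg]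

theorem trace_diagIn (w : Fin d → ℂ) : (diagIn U w).trace = ∑ j, w j := by
  rw [diagIn, Matrix.trace_mul_comm, ← Matrix.mul_assoc, unitary_conjTranspose_mul_self,
    Matrix.one_mul, Matrix.trace_diagonal]

/-- The blocks of the state of `S₁` after `n` fractional swaps. -/
def blockWeights (lam v : Fin d → ℂ) (t : ℝ) (n : ℕ) (c c' : Fin 2) : Fin d → ℂ :=
  if c = 0 then
    if c' = 0 then ((Real.cos t : ℂ) ^ (2 * n) / 2) • v
    else fun j => (Real.cos t * (Real.cos t + Complex.I * lam j * Real.sin t)) ^ n * v j / 2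
  else
    if c' = 0 then fun j => (Real.cos t * (Real.cos t - Complex.I * lam j * Real.sin t)) ^ n * v j / 2
    else ((Real.cos t : ℂ) ^ (2 * n) / 2) • v + ((1 - (Real.cos t : ℂ) ^ (2 * n)) * ∑ j, v j) • lam

/-- Everything is diagonal in one basis, so the commutator vanishes on the block (1,1) and acts on
the off-diagonal blocks as multiplication by ± lam. Only block (1,1) receives replaced copies, and
only there is cos² + sin² = 1 needed. -/
theorem blockWeights_succ (lam v : Fin d → ℂ) (hlam : ∑ j, lam j = 1) (t : ℝ) (n : ℕ)
    (c c' : Fin 2) :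
    ((Real.cos t : ℂ) ^ 2) • diagIn U (blockWeights lam v t n c c') +
        (if c = 1 ∧ c' = 1 then
          ((Real.sin t : ℂ) ^ 2 * ((diagIn U (blockWeights lam v t n 0 0)).trace +
            (diagIn U (blockWeights lam v t n 1 1)).trace)) • diagIn U lam else 0) +
        (Complex.I * Real.sin t * Real.cos t) •
          ((if c' = 1 then diagIn U (blockWeights lam v t n c 1) * diagIn U lam else 0) -
          (if c = 1 then diagIn U lam * diagIn U (blockWeights lam v t n 1 c') else 0)) =
      diagIn U (blockWeights lam v t (n + 1) c c') := by
  have hcs : (Real.sin t : ℂ) ^ 2 + (Real.cos t : ℂ) ^ 2 = 1 := by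
    exact_mod_cast Real.sin_sq_add_cos_sq t
  have htr : (diagIn U (blockWeights lam v t n 0 0)).trace +
      (diagIn U (blockWeights lam v t n 1 1)).trace = ∑ j, v j := by
    simp only [trace_diagIn, blockWeights, if_true, one_ne_zero, if_false, Pi.add_apply,
      Pi.smul_apply, smul_eq_mul, Finset.sum_add_distrib, ← Finset.mul_sum, hlam]
    ring
  rw [htr]
  set T := ∑ j, v j with hT
  fin_cases c <;> fin_cases c' <;>
    simp only [Fin.zero_eta, Fin.mk_one, Fin.isValue, zero_ne_one, and_self,
      and_false, and_true, if_true, if_false, sub_zero, zero_sub, smul_zero, add_zero,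
      diagIn_mul, diagIn_smul, diagIn_add, diagIn_sub, ← diagIn_zero U] <;>
    congr 1 <;> ext j <;>
    simp only [blockWeights, if_true, one_ne_zero, if_false, Pi.add_apply, Pi.sub_apply,
      Pi.smul_apply, Pi.mul_apply, smul_eq_mul, ← hT, Pi.neg_apply] <;>
    first
      | ring1
      | linear_combination (T * lam j) * hcs

theorem execute_replicate {ρ : Matrix (Fin d) (Fin d) ℂ} {lam : Fin d → ℂ}
    (hρ : ρ = diagIn U lam) (hlam : ∑ j, lam j = 1) (v : Fin d → ℂ) (t : ℝ)
    {Y : Matrix (Site d × Site d) (Site d × Site d) ℂ}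
    (hY : traceSecond Y = ofBlocks fun _ _ => (1 / 2 : ℂ) • diagIn U v) (n : ℕ) :
    ∃ Y', execute ρ (List.replicate n (fracSwapStep t)).flatten (withAncilla Y) = withAncilla Y' ∧
      traceSecond Y' = ofBlocks fun c c' => diagIn U (blockWeights lam v t n c c') := by
  induction n with
  | zero =>
    refine ⟨Y, rfl, ?_⟩
    rw [hY]
    congr 1
    ext c c' : 2
    rw [diagIn_smul]
    congr 1
    ext j
    fin_cases c <;> fin_cases c' <;> simp [blockWeights] <;> ring
  | succ n ih =>
    obtain ⟨Y', h1, h2⟩ := ih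
    rw [List.replicate_succ', List.flatten_append, execute_append, h1, List.flatten_singleton,
      execute_fracSwapStep, h2]
    refine ⟨_, rfl, ?_⟩
    rw [traceSecond_step_blocks ρ (by rw [hρ, trace_diagIn, hlam]), hρ]
    congr 1
    ext c c' : 2
    exact blockWeights_succ U lam v hlam t n c c'

/-- The effect of the fractional-swap circuit and the measurement on the qudit of `S₁`. -/
theorem readQudit_fracSwapCircuit {ρ : Matrix (Fin d) (Fin d) ℂ} {lam : Fin d → ℝ}
    (hρ : ρ = diagIn U fun j => (lam j : ℂ)) (hlam : ∑ j, lam j = 1) {X : MemOp d}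
    {v : Fin d → ℝ} (hX : readQudit X = diagIn U fun j => (v j : ℂ)) (R : Round) (o : Bool) :
    readQudit (measureFirst o (execute ρ (fracSwapCircuit R.r R.t) X)) =
      diagIn U fun j => ((Matrix.vecMul v (stepKernel lam R o) j : ℝ) : ℂ) := by
  obtain ⟨Y, h1, h2⟩ := execute_preparation ρ X
  rw [hX] at h2
  obtain ⟨Y', h3, h4⟩ := execute_replicate U hρ (by exact_mod_cast hlam) _ R.t h2 R.r
  rw [fracSwapCircuit, execute_append, execute_append, h1, h3, readQudit_measure ρ o Y' h4,
    diagIn_add, diagIn_add, diagIn_smul, diagIn_add, diagIn_smul]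
  congr 1
  ext j
  -- The two coherences are conjugate, so their sum, which the |±⟩ measurement sees, is twice the
  -- real part.
  have hconj : ((Real.cos R.t : ℂ) * (Real.cos R.t - Complex.I * lam j * Real.sin R.t)) ^ R.r =
      (starRingEnd ℂ) (((Real.cos R.t : ℂ) *
        (Real.cos R.t + Complex.I * lam j * Real.sin R.t)) ^ R.r) := by
    simp only [map_pow, map_mul, map_add, Complex.conj_ofReal, Complex.conj_I]
    ring
  have hre : ((Real.cos R.t : ℂ) * (Real.cos R.t + Complex.I * lam j * Real.sin R.t)) ^ R.r +
      ((Real.cos R.t : ℂ) * (Real.cos R.t - Complex.I * lam j * Real.sin R.t)) ^ R.r =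
      2 * (R.interference (lam j) : ℂ) := by
    rw [hconj, Complex.add_conj, Complex.ofReal_mul, Complex.ofReal_ofNat]
    rfl
  have hk : Matrix.vecMul v (stepKernel lam R o) j =
      ((R.damping + outcomeSign o * R.interference (lam j)) * v j +
        (1 - R.damping) * (∑ k, v k) * lam j) / 2 := by
    simp only [Matrix.vecMul, dotProduct, stepKernel, Matrix.of_apply, mul_div_assoc', mul_add,
      ← Finset.sum_div, Finset.sum_add_distrib, mul_ite, mul_zero, Finset.sum_ite_eq',
      Finset.mem_univ, if_true, Finset.sum_mul, Finset.mul_sum]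
    congr 2
    · ring
    · exact Finset.sum_congr rfl fun k _ => by ring
  have hd : (R.damping : ℂ) = (Real.cos R.t : ℂ) ^ (2 * R.r) := by
    rw [Round.damping]; push_cast; rfl
  rw [hk]
  simp only [blockWeights, if_true, one_ne_zero, if_false, Pi.add_apply, Pi.smul_apply, smul_eq_mul]
  push_cast
  push_cast at hre hd
  rw [hd]
  linear_combination (1 / 4 * (outcomeSign o : ℂ) * v j) * hre

theorem readQudit_load_first (ρ : Matrix (Fin d) (Fin d) ℂ) (X : MemOp d) :
    readQudit (loadQudit ρ .first X) = (readQudit X).trace • ρ := by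
  ext x x'
  simp only [readQudit, loadQudit, Matrix.of_apply, Matrix.smul_apply, smul_eq_mul, Matrix.trace,
    Matrix.diag_apply, ← Finset.sum_mul]
  congr 1
  conv_rhs => rw [Finset.sum_comm]
  refine Finset.sum_congr rfl fun a _ => ?_
  conv_rhs => rw [Finset.sum_comm]
  exact Finset.sum_congr rfl fun c _ => Finset.sum_comm

/-- The effect of a round on the qudit of `S₁`. -/
theorem readQudit_round {ρ : Matrix (Fin d) (Fin d) ℂ} {lam : Fin d → ℝ}
    (hρ : ρ = diagIn U fun j => (lam j : ℂ)) (hlam : ∑ j, lam j = 1) {X : MemOp d}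
    {v : Fin d → ℝ} (R : Round)
    (hX : readQudit X = diagIn U (fun j => (v j : ℂ)) ∨
      (R.fresh = true ∧ (readQudit X).trace = ∑ j, (v j : ℂ))) (o : Bool) :
    readQudit (measureFirst o (execute ρ R.program X)) =
      diagIn U fun j => ((Matrix.vecMul v (roundKernel lam R o) j : ℝ) : ℂ) := by
  by_cases hR : R.fresh = true
  · have htr : (readQudit X).trace = ∑ j, (v j : ℂ) := by
      rcases hX with h | h
      · rw [h, trace_diagIn]
      · exact h.2
    have hprog : R.program = [.load .first] ++ fracSwapCircuit R.r R.t := by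
      simp [Round.program, hR]
    have hload : readQudit (loadQudit ρ .first X) =
        diagIn U fun j => (((∑ k, v k) * lam j : ℝ) : ℂ) := by
      rw [readQudit_load_first, htr, hρ, diagIn_smul]
      congr 1
      ext j
      simp
    rw [hprog, execute_append]
    refine (readQudit_fracSwapCircuit U hρ hlam (X := loadQudit ρ .first X) hload R o).trans ?_
    congr 1
    ext j
    congr 1
    simp only [Matrix.vecMul, dotProduct, roundKernel, hR, if_true, Matrix.of_apply,
      Finset.mul_sum, Finset.sum_mul]
    rw [Finset.sum_comm]
    simp only [mul_assoc]
  · have hprog : R.program = fracSwapCircuit R.r R.t := by simp [Round.program, hR]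
    rw [hprog]
    simp only [roundKernel, hR]
    rcases hX with h | h
    · exact readQudit_fracSwapCircuit U hρ hlam h R o
    · exact absurd h.1 hR

theorem trace_readQudit (X : MemOp d) : (readQudit X).trace = X.trace := by
  simp only [readQudit, Matrix.trace, Matrix.diag_apply, Matrix.of_apply, Fintype.sum_prod_type]
  rw [Finset.sum_comm]
  exact Finset.sum_congr rfl fun a _ => Finset.sum_comm

end diagonal

/-! ## Sums over outcome sequences -/

/-- The outcome sequences of length `n`. -/
def outcomeLevel : ℕ → Finset (List Bool)
  | 0 => {[]}
  | n + 1 => (outcomeLevel n ×ˢ Finset.univ).image fun q => q.2 :: q.1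

theorem mem_outcomeLevel {n : ℕ} {h : List Bool} : h ∈ outcomeLevel n ↔ h.length = n := by
  induction n generalizing h with
  | zero => simp [outcomeLevel]
  | succ n ih =>
    simp only [outcomeLevel, Finset.mem_image, Finset.mem_product, ih, Finset.mem_univ, and_true,
      Prod.exists]
    constructor
    · rintro ⟨l, o, hl, rfl⟩
      simp [hl]
    · intro hh
      cases h with
      | nil => simp at hh
      | cons o l => exact ⟨l, o, by simpa using hh, rfl⟩

theorem sum_outcomeLevel_succ (n : ℕ) (F : List Bool → ℝ) :
    ∑ h ∈ outcomeLevel (n + 1), F h = ∑ h ∈ outcomeLevel n, ∑ o, F (o :: h) := by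
  rw [outcomeLevel, Finset.sum_image, Finset.sum_product]
  rintro ⟨l, o⟩ - ⟨l', o'⟩ - hq
  simp only [List.cons.injEq] at hq
  exact Prod.ext hq.2 hq.1

theorem exists_subset_biUnion_outcomeLevel (s : Finset (List Bool)) :
    ∃ n, s ⊆ (Finset.range n).biUnion outcomeLevel := by
  refine ⟨s.sup List.length + 1, fun h hh => ?_⟩
  simp only [Finset.mem_biUnion, Finset.mem_range, mem_outcomeLevel]
  exact ⟨_, Nat.lt_succ_of_le (Finset.le_sup (f := List.length) hh), rfl⟩

theorem sum_biUnion_outcomeLevel (n : ℕ) (F : List Bool → ℝ) :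
    ∑ h ∈ (Finset.range n).biUnion outcomeLevel, F h =
      ∑ m ∈ Finset.range n, ∑ h ∈ outcomeLevel m, F h := by
  refine Finset.sum_biUnion fun m _ m' _ hmm => Finset.disjoint_left.2 fun h h1 h2 => hmm ?_
  rw [mem_outcomeLevel] at h1 h2
  exact h1.symm.trans h2

/-! ### Summation by a value function on outcome sequences -/

section value

variable {V a : List Bool → ℝ}

/-- Iterating the balance equation: gains collected so far plus the value still outstanding are
conserved from level to level. -/
theorem sum_levels_add (hV : ∀ h, V h = a h + ∑ o, V (o :: h)) (n : ℕ) :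
    ∑ m ∈ Finset.range n, ∑ h ∈ outcomeLevel m, a h + ∑ h ∈ outcomeLevel n, V h = V [] := by
  induction n with
  | zero => simp [outcomeLevel]
  | succ n ih =>
    rw [Finset.sum_range_succ, sum_outcomeLevel_succ, add_assoc, ← Finset.sum_add_distrib, ← ih]
    simp only [← hV]

theorem sum_le_value (hV : ∀ h, V h = a h + ∑ o, V (o :: h)) (hV0 : ∀ h, 0 ≤ V h)
    (ha : ∀ h, 0 ≤ a h) (s : Finset (List Bool)) : ∑ h ∈ s, a h ≤ V [] := by
  obtain ⟨n, hn⟩ := exists_subset_biUnion_outcomeLevel s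
  refine (Finset.sum_le_sum_of_subset_of_nonneg hn fun h _ _ => ha h).trans ?_
  rw [sum_biUnion_outcomeLevel, ← sum_levels_add hV n]
  exact le_add_of_nonneg_right (Finset.sum_nonneg fun h _ => hV0 h)

/-- Equality needs the outstanding value to vanish in the limit. Nonnegativity of the gains makes
the order of summation irrelevant. -/
theorem hasSum_value (hV : ∀ h, V h = a h + ∑ o, V (o :: h)) (hV0 : ∀ h, 0 ≤ V h)
    (ha : ∀ h, 0 ≤ a h)
    (hlim : Filter.Tendsto (fun n => ∑ h ∈ outcomeLevel n, V h) Filter.atTop (nhds 0)) :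
    HasSum a (V []) := by
  have hs : Summable a := summable_of_sum_le ha (sum_le_value hV hV0 ha)
  have ht : Filter.Tendsto (fun n => (Finset.range n).biUnion outcomeLevel) Filter.atTop
      Filter.atTop := by
    refine Filter.tendsto_atTop_finset_of_monotone
      (fun m n hmn => Finset.biUnion_subset_biUnion_of_subset_left _ (Finset.range_mono hmn))
      fun h => ?_
    obtain ⟨n, hn⟩ := exists_subset_biUnion_outcomeLevel {h}
    exact ⟨n, hn (Finset.mem_singleton_self h)⟩
  have h1 := hs.hasSum.comp ht
  have h2 : Filter.Tendsto (fun n => V [] - ∑ h ∈ outcomeLevel n, V h) Filter.atTop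
      (nhds (V [] - 0)) := tendsto_const_nhds.sub hlim
  have h3 : ((fun s => ∑ h ∈ s, a h) ∘ fun n => (Finset.range n).biUnion outcomeLevel) =
      fun n => V [] - ∑ h ∈ outcomeLevel n, V h := by
    ext n
    simp only [Function.comp_apply, sum_biUnion_outcomeLevel]
    rw [← sum_levels_add hV n]
    ring
  rw [h3] at h1
  have := tendsto_nhds_unique h1 h2
  rw [sub_zero] at this
  rw [← this]
  exact hs.hasSum

end value

/-! ## Repeating an attempt until it succeeds -/

/-- A round that only replaces the qudit of `S₁` by a fresh copy. -/
def restartRound : Round where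
  fresh := true
  r := 1
  t := Real.pi / 2
  r_pos := one_pos
  t_pos := by positivity

/-- An attempt with a fresh copy. -/
def freshAttempt (body : Strategy Bool) : Strategy Bool := .run restartRound fun _ => body

/-- Start over after a rejection. -/
def orRestart (body : Strategy Bool) : Strategy Bool → Strategy Bool
  | .done true => .done true
  | .done false => freshAttempt body
  | .run R f => .run R f

/-- What is left to be done after the outcomes `h`. -/
def remaining (body : Strategy Bool) : List Bool → Strategy Bool
  | [] => freshAttempt body
  | o :: h =>
    match remaining body h with
    | .done b => .done b
    | .run _ f => orRestart body (f o)

/-- The protocol that repeats an attempt until it succeeds. -/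
def repeatUntilSuccess (body : Strategy Bool) : Protocol := fun h =>
  match remaining body h with
  | .done _ => none
  | .run R _ => some R

/-- Rejections are turned into restarts at once, so every final outcome sequence ends in acceptance.
-/
theorem remaining_ne_reject (body : Strategy Bool) (h : List Bool) :
    remaining body h ≠ .done false := by
  induction h with
  | nil => simp [remaining, freshAttempt]
  | cons o h ih =>
    rw [remaining]
    split
    · rename_i b hb
      rwa [hb] at ih
    · rename_i R f _
      rcases f o with (_ | _) | ⟨R', f'⟩ <;> simp [orRestart, freshAttempt]

/-! ### Value function of the repeated attempt -/

section weights

variable {ι : Type*} [Fintype ι] [DecidableEq ι] {lam : ι → ℝ} {body : Strategy Bool}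

/-- The weights of the eigenvectors in the subnormalised state after the outcomes `h`. -/
def weights (lam : ι → ℝ) (body : Strategy Bool) : List Bool → ι → ℝ
  | [] => lam
  | o :: h =>
    match remaining body h with
    | .done _ => 0
    | .run R _ => Matrix.vecMul (weights lam body h) (roundKernel lam R o)

theorem weights_nonneg (hl : IsDistribution lam) (h : List Bool) (j : ι) :
    0 ≤ weights lam body h j := by
  induction h generalizing j with
  | nil => exact hl.nonneg j
  | cons o h ih =>
    rcases hr : remaining body h with b | ⟨R, f⟩ <;> simp only [weights, hr]
    · exact le_rfl
    · exact Finset.sum_nonneg fun k _ => mul_nonneg (ih k) (roundKernel_nonneg hl _ _ _ _)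

/-- At t = π/2 the swap is complete and cos t = 0, so the outcome is a fair coin and the qudit is a
fresh copy. -/
theorem restartRound_mulVec (hl : IsDistribution lam) (o : Bool) (u : ι → ℝ) (j : ι) :
    (roundKernel lam restartRound o).mulVec u j = (∑ k, lam k * u k) / 2 := by
  have h1 : restartRound.damping = 0 := by simp [Round.damping, restartRound]
  have h2 : ∀ x, restartRound.interference x = 0 := by
    simp [Round.interference, restartRound]
  rw [roundKernel_mulVec_fresh rfl]
  simp only [stepKernel_mulVec, h1, h2, mul_zero, add_zero, zero_mul, sub_zero, one_mul, zero_add,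
    ← Finset.sum_mul, hl.sum_eq_one]

/-- The terminal value `u` on acceptance, and `b` on rejection. -/
def terminalValue (u : ι → ℝ) (b : ℝ) : Bool → ι → ℝ :=
  onAccept u + b • ((fun _ _ => 1) + (-1 : ℝ) • onAccept 1)

theorem terminalValue_apply {ι : Type*} (u : ι → ℝ) (b : ℝ) (x : Bool) (j : ι) :
    terminalValue u b x j = if x then u j else b := by
  cases x <;> simp [terminalValue, onAccept]

/-- The expectation of the cost and of the terminal value `u` if the attempt is repeated until it
succeeds. -/
def repeatedValue (lam : ι → ℝ) (body : Strategy Bool) (c : Round → ℝ) (u : ι → ℝ) : ℝ :=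
  (c restartRound + body.meanCost lam c + body.accepted lam u) / body.accepted lam 1

/-- The repeated value b is the fixed point of the renewal equation b = (cost and gain of one
attempt) + b (1 - p), with p the acceptance probability. -/
theorem eval_freshAttempt (hl : IsDistribution lam) (hp : 0 < body.accepted lam 1)
    (c : Round → ℝ) (u : ι → ℝ) (j : ι) :
    (freshAttempt body).eval lam c (terminalValue u (repeatedValue lam body c u)) j =
      repeatedValue lam body c u := by
  set b := repeatedValue lam body c u with hb
  -- The terminal value is a linear combination of acceptance terms and a constant, so linearity of
  -- `eval` applies.
  have e1 : body.eval lam c (terminalValue u b) = body.eval lam c 0 +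
      body.eval lam 0 (onAccept u) + b • ((fun _ => 1) + (-1 : ℝ) • body.eval lam 0 (onAccept 1)) := by
    have s1 := Strategy.eval_add (lam := lam) c 0 0 (terminalValue u b) body
    have s2 := Strategy.eval_add (lam := lam) 0 0 (onAccept u)
      (b • ((fun (_ : Bool) (_ : ι) => (1 : ℝ)) + (-1 : ℝ) • onAccept 1)) body
    have s3 := Strategy.eval_smul (lam := lam) b 0
      ((fun (_ : Bool) (_ : ι) => (1 : ℝ)) + (-1 : ℝ) • onAccept 1) body
    have s4 := Strategy.eval_add (lam := lam) 0 0 (fun (_ : Bool) (_ : ι) => (1 : ℝ))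
      ((-1 : ℝ) • onAccept 1) body
    have s5 := Strategy.eval_smul (lam := lam) (-1) 0 (onAccept 1) body
    simp only [add_zero, zero_add, smul_zero] at s1 s2 s3 s4 s5
    rw [s1, terminalValue, s2, s3, s4, s5, Strategy.eval_zero_const hl, add_assoc]
  have e2 : ∑ k, lam k * body.eval lam c (terminalValue u b) k =
      body.meanCost lam c + body.accepted lam u + b * (1 - body.accepted lam 1) := by
    rw [e1]
    simp only [Strategy.meanCost, Strategy.accepted, Pi.add_apply, Pi.smul_apply, smul_eq_mul]
    rw [mul_sub, mul_one, Finset.mul_sum]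
    have : b = ∑ k, lam k * b := by rw [← Finset.sum_mul, hl.sum_eq_one, one_mul]
    nth_rw 2 [this]
    simp only [← Finset.sum_add_distrib, ← Finset.sum_sub_distrib]
    exact Finset.sum_congr rfl fun k _ => by ring
  simp only [freshAttempt, Strategy.eval, restartRound_mulVec hl, Finset.sum_const,
    Finset.card_univ, Fintype.card_bool, e2]
  have : b * body.accepted lam 1 = c restartRound + body.meanCost lam c + body.accepted lam u := by
    rw [hb, repeatedValue, div_mul_cancel₀ _ hp.ne']
  simp only [nsmul_eq_mul]
  push_cast
  linarith

theorem eval_orRestart (hl : IsDistribution lam) (hp : 0 < body.accepted lam 1)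
    (c : Round → ℝ) (u : ι → ℝ) (t : Strategy Bool) :
    (orRestart body t).eval lam c (terminalValue u (repeatedValue lam body c u)) =
      t.eval lam c (terminalValue u (repeatedValue lam body c u)) := by
  rcases t with (_ | _) | ⟨R', f'⟩
  · ext j
    rw [orRestart, eval_freshAttempt hl hp]
    simp [Strategy.eval, terminalValue_apply]
  · rfl
  · rfl

/-- The value function of the repeated attempt. -/
def valueAt (lam : ι → ℝ) (body : Strategy Bool) (c : Round → ℝ) (u : ι → ℝ) (h : List Bool) : ℝ :=
  ∑ j, weights lam body h j *
    (remaining body h).eval lam c (terminalValue u (repeatedValue lam body c u)) j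

/-- The expected gain at the outcomes `h`: the terminal value, or the cost of the next round. -/
def gainAt (lam : ι → ℝ) (body : Strategy Bool) (c : Round → ℝ) (u : ι → ℝ) (h : List Bool) : ℝ :=
  match remaining body h with
  | .done _ => ∑ j, weights lam body h j * u j
  | .run R _ => c R * ∑ j, weights lam body h j

/-- The balance equation of the value function. Replacing a rejection by a restart does not disturb
it, since a rejection is already valued at the fixed point. -/
theorem valueAt_eq (hl : IsDistribution lam) (hp : 0 < body.accepted lam 1)
    (c : Round → ℝ) (u : ι → ℝ) (h : List Bool) :
    valueAt lam body c u h = gainAt lam body c u h + ∑ o, valueAt lam body c u (o :: h) := by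
  rcases hr : remaining body h with (_ | _) | ⟨R, f⟩
  · exact absurd hr (remaining_ne_reject body h)
  · have h0 : ∀ o, valueAt lam body c u (o :: h) = 0 := fun o => by
      simp [valueAt, weights, hr]
    simp only [h0]
    rw [valueAt, gainAt, hr]
    simp [Strategy.eval, terminalValue_apply]
  · have h0 : ∀ o, valueAt lam body c u (o :: h) = ∑ j, weights lam body h j *
        (roundKernel lam R o).mulVec ((f o).eval lam c
          (terminalValue u (repeatedValue lam body c u))) j := fun o => by
      have e : weights lam body (o :: h) =
          Matrix.vecMul (weights lam body h) (roundKernel lam R o) := by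
        rw [weights, hr]
      have e' : remaining body (o :: h) = orRestart body (f o) := by rw [remaining, hr]
      rw [valueAt, e, e', eval_orRestart hl hp]
      exact (Matrix.dotProduct_mulVec _ _ _).symm
    simp only [h0]
    rw [valueAt, gainAt, hr]
    simp only [Strategy.eval]
    rw [Finset.sum_comm, Finset.mul_sum, ← Finset.sum_add_distrib]
    refine Finset.sum_congr rfl fun j _ => ?_
    rw [mul_add, Finset.mul_sum, mul_comm]

theorem valueAt_nil (hl : IsDistribution lam) (hp : 0 < body.accepted lam 1)
    (c : Round → ℝ) (u : ι → ℝ) : valueAt lam body c u [] = repeatedValue lam body c u := by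
  simp only [valueAt, weights, remaining, eval_freshAttempt hl hp, ← Finset.sum_mul,
    hl.sum_eq_one, one_mul]

theorem meanCost_nonneg (hl : IsDistribution lam) {c : Round → ℝ} (hc : ∀ R, 0 ≤ c R)
    (t : Strategy Bool) : 0 ≤ t.meanCost lam c :=
  Finset.sum_nonneg fun j _ => mul_nonneg (hl.nonneg j)
    (Strategy.eval_nonneg hl hc (fun _ _ => le_rfl) t j)

theorem repeatedValue_nonneg (hl : IsDistribution lam) {c : Round → ℝ} (hc : ∀ R, 0 ≤ c R)
    {u : ι → ℝ} (hu : 0 ≤ u) : 0 ≤ repeatedValue lam body c u :=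
  div_nonneg (add_nonneg (add_nonneg (hc _) (meanCost_nonneg hl hc _))
    (Strategy.accepted_nonneg hl _ hu)) (Strategy.accepted_nonneg hl _ zero_le_one)

theorem valueAt_nonneg (hl : IsDistribution lam) {c : Round → ℝ} (hc : ∀ R, 0 ≤ c R)
    {u : ι → ℝ} (hu : 0 ≤ u) (h : List Bool) : 0 ≤ valueAt lam body c u h := by
  refine Finset.sum_nonneg fun j _ => mul_nonneg (weights_nonneg hl h j)
    (Strategy.eval_nonneg hl hc (fun x j => ?_) _ j)
  rw [terminalValue_apply]
  split_ifs
  exacts [hu j, repeatedValue_nonneg hl hc hu]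

theorem gainAt_nonneg (hl : IsDistribution lam) {c : Round → ℝ} (hc : ∀ R, 0 ≤ c R)
    {u : ι → ℝ} (hu : 0 ≤ u) (h : List Bool) : 0 ≤ gainAt lam body c u h := by
  unfold gainAt
  split
  · exact Finset.sum_nonneg fun j _ => mul_nonneg (weights_nonneg hl h j) (hu j)
  · exact mul_nonneg (hc _) (Finset.sum_nonneg fun j _ => weights_nonneg hl h j)

theorem sum_weights_cons (hl : IsDistribution lam) {h : List Bool} {R : Round}
    {f : Bool → Strategy Bool} (hr : remaining body h = .run R f) :
    ∑ o, ∑ j, weights lam body (o :: h) j = ∑ j, weights lam body h j := by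
  have e : ∀ o, ∑ j, weights lam body (o :: h) j =
      ∑ j, weights lam body h j * (roundKernel lam R o).mulVec (fun _ => 1) j := fun o => by
    have := Matrix.dotProduct_mulVec (weights lam body h) (roundKernel lam R o) fun _ => 1
    simp only [weights, hr]
    simp only [dotProduct] at this
    rw [this]
    simp
  simp only [e]
  rw [Finset.sum_comm]
  simp only [← Finset.mul_sum, sum_roundKernel_mulVec_const hl, mul_one]

/-- The probability that the protocol is still running tends to `0`. -/
theorem tendsto_level_weights (hl : IsDistribution lam) (hp : 0 < body.accepted lam 1) :
    Filter.Tendsto (fun n => ∑ h ∈ outcomeLevel n, ∑ j, weights lam body h j) Filter.atTop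
      (nhds 0) := by
  have hc : ∀ R : Round, (0 : ℝ) ≤ (1 : Round → ℝ) R := fun _ => zero_le_one
  have h1 := sum_levels_add (valueAt_eq hl hp 1 (0 : ι → ℝ))
  have hs : Summable fun n => ∑ h ∈ outcomeLevel n, gainAt lam body 1 (0 : ι → ℝ) h := by
    refine summable_of_sum_range_le (c := valueAt lam body 1 (0 : ι → ℝ) [])
      (fun n => Finset.sum_nonneg fun h _ => gainAt_nonneg hl hc le_rfl h) fun n => ?_
    rw [← h1 n]
    exact le_add_of_nonneg_right (Finset.sum_nonneg fun h _ => valueAt_nonneg hl hc le_rfl h)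
  have ht := hs.tendsto_atTop_zero
  -- With unit cost and u = 0, the gain at level n is the mass still running there, which equals the
  -- whole mass at level n + 1. Its sum, the expected number of rounds, is finite.
  rw [← Filter.tendsto_add_atTop_iff_nat 1]
  refine ht.congr fun n => ?_
  rw [sum_outcomeLevel_succ]
  refine Finset.sum_congr rfl fun h _ => ?_
  rcases hr : remaining body h with b | ⟨R, f⟩
  · simp [gainAt, weights, hr]
  · rw [sum_weights_cons hl hr, gainAt, hr]
    simp

/-- The expectation of a terminal value. -/
theorem hasSum_terminal (hl : IsDistribution lam) (hp : 0 < body.accepted lam 1)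
    {u : ι → ℝ} (hu : 0 ≤ u) (hu1 : u ≤ 1) :
    HasSum (gainAt lam body 0 u) (body.accepted lam u / body.accepted lam 1) := by
  have hc : ∀ R : Round, (0 : ℝ) ≤ (0 : Round → ℝ) R := fun _ => le_rfl
  have e : valueAt lam body 0 u [] = body.accepted lam u / body.accepted lam 1 := by
    rw [valueAt_nil hl hp, repeatedValue]
    have : body.meanCost lam 0 = 0 := by
      simp only [Strategy.meanCost]
      have := Strategy.eval_zero_const hl 0 body
      have e : body.eval lam 0 0 = fun _ => 0 := this
      simp [e]
    rw [this]
    simp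
  rw [← e]
  refine hasSum_value (valueAt_eq hl hp 0 u) (fun h => valueAt_nonneg hl hc hu h)
    (fun h => gainAt_nonneg hl hc hu h) ?_
  refine squeeze_zero (fun n => Finset.sum_nonneg fun h _ => valueAt_nonneg hl hc hu h)
    (fun n => Finset.sum_le_sum fun h _ => ?_) (tendsto_level_weights hl hp)
  refine Finset.sum_le_sum fun j _ => ?_
  refine mul_le_of_le_one_right (weights_nonneg hl h j) ?_
  refine Strategy.eval_le_of_le hl (fun x k => ?_) _ j
  rw [terminalValue_apply]
  split_ifs
  · exact hu1 k
  · rw [← valueAt_nil hl hp, e, div_le_one hp]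
    exact Strategy.accepted_mono hl _ hu1

end weights

/-! ## Costs -/

theorem sum_map_flatten_replicate (f : Instr → ℕ) (l : List Instr) (r : ℕ) :
    ((List.replicate r l).flatten.map f).sum = r * (l.map f).sum := by
  induction r with
  | zero => simp
  | succ r ih => rw [List.replicate_succ, List.flatten_cons, List.map_append, List.sum_append, ih]; ring

/-- The worst case is the gate count, 5r + 2: five gates per iteration and two Hadamard gates. The
others are at most r + 1 copies and 3r controlled swaps. -/
theorem program_cost_le {cost : Instr → ℕ}
    (hcost : cost = copyCost ∨ cost = cswapCost ∨ cost = oneQubitCost) (R : Round) :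
    (R.program.map cost).sum ≤ 7 * R.r := by
  have h1 := R.r_pos
  have h2 : (R.program.map cost).sum = (if R.fresh then cost (.load .first) else 0) +
      (([Instr.reset .ancilla, .reset .first, .gate .first gateH].map cost).sum +
        R.r * ((fracSwapStep R.t).map cost).sum + cost (.gate .first gateH)) := by
    rw [Round.program, fracSwapCircuit, List.map_append, List.sum_append, List.map_append,
      List.sum_append, List.map_append, List.sum_append, sum_map_flatten_replicate]
    split_ifs <;> simp
  rw [h2]
  rcases hcost with rfl | rfl | rfl <;>
    simp only [fracSwapStep, List.map_cons, List.map_nil, List.sum_cons, List.sum_nil, copyCost,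
      cswapCost, oneQubitCost] <;> split_ifs <;> omega

/-- The cost of a round as a real number. -/
def roundCost (cost : Instr → ℕ) (R : Round) : ℝ := ((R.program.map cost).sum : ℕ)

theorem repeatedValue_roundCost_le {ι : Type*} [Fintype ι] [DecidableEq ι] {lam : ι → ℝ}
    (hl : IsDistribution lam) {body : Strategy Bool} (hp : 0 < body.accepted lam 1)
    {cost : Instr → ℕ} (hcost : cost = copyCost ∨ cost = cswapCost ∨ cost = oneQubitCost) {b : ℝ}
    (hb : 2 + body.meanCost lam (fun R => (R.r : ℝ)) ≤ b * body.accepted lam 1) :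
    repeatedValue lam body (roundCost cost) 0 ≤ 7 * b := by
  have h1 : ∀ R, roundCost cost R ≤ 7 * (R.r : ℝ) := fun R => by
    unfold roundCost
    exact_mod_cast program_cost_le hcost R
  have h2 : body.meanCost lam (roundCost cost) ≤ 7 * body.meanCost lam fun R => (R.r : ℝ) := by
    have e := Strategy.eval_smul (lam := lam) 7 (fun R => (R.r : ℝ)) 0 body
    rw [smul_zero] at e
    rw [Strategy.meanCost, Strategy.meanCost, Finset.mul_sum]
    refine Finset.sum_le_sum fun j _ => ?_
    have e' := Strategy.eval_mono hl (c' := (7 : ℝ) • fun R : Round => (R.r : ℝ)) (φ := 0) (ψ := 0)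
      h1 (fun _ => le_rfl) body j
    rw [e, Pi.smul_apply, smul_eq_mul] at e'
    nlinarith [hl.nonneg j, mul_le_mul_of_nonneg_left e' (hl.nonneg j)]
  have h3 : body.accepted lam 0 = 0 := by
    have := body.accepted_smul (lam := lam) 0 0
    rwa [zero_smul, zero_mul] at this
  have h4 := h1 restartRound
  have h5 : (restartRound.r : ℝ) = 1 := by simp [restartRound]
  rw [repeatedValue, div_le_iff₀ hp, h3]
  rw [h5] at h4
  linarith

/-! ## The protocol -/

section protocol

variable {d : ℕ} {lam : Fin d → ℝ} {body : Strategy Bool} {ρ : Matrix (Fin d) (Fin d) ℂ}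
  {σ : MemOp d} (U : Matrix.unitaryGroup (Fin d) ℂ)

theorem repeatUntilSuccess_eq_none {h : List Bool} :
    repeatUntilSuccess body h = none ↔ ∃ b, remaining body h = .done b := by
  unfold repeatUntilSuccess
  rcases remaining body h with b | ⟨R, f⟩ <;> simp

/-- The reduced state of the output qudit is diagonal in the eigenbasis of the input state. -/
theorem readQudit_state (hρ : ρ = diagIn U fun j => (lam j : ℂ)) (hl : IsDistribution lam)
    (hσ : σ.trace = 1) (h : List Bool) :
    (h ≠ [] → readQudit ((repeatUntilSuccess body).state ρ σ h) =
      diagIn U fun j => (weights lam body h j : ℂ)) ∧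
    (readQudit ((repeatUntilSuccess body).state ρ σ h)).trace =
      ∑ j, (weights lam body h j : ℂ) := by
  induction h with
  | nil =>
    refine ⟨fun h => absurd rfl h, ?_⟩
    rw [trace_readQudit, Protocol.state, hσ]
    have := hl.sum_eq_one
    simp only [weights]
    exact_mod_cast this.symm
  | cons o h ih =>
    have key : readQudit ((repeatUntilSuccess body).state ρ σ (o :: h)) =
        diagIn U fun j => (weights lam body (o :: h) j : ℂ) := by
      rcases hr : remaining body h with b | ⟨R, f⟩
      · simp only [Protocol.state, repeatUntilSuccess, weights, hr]
        have : (fun j : Fin d => (((0 : Fin d → ℝ) j : ℝ) : ℂ)) = 0 := by ext; simp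
        rw [this, diagIn_zero]
        ext x x'
        simp [readQudit]
      · have e : repeatUntilSuccess body h = some R := by simp [repeatUntilSuccess, hr]
        simp only [Protocol.state, weights, hr, e]
        refine readQudit_round U hρ hl.sum_eq_one R ?_ o
        -- The initial memory need not be diagonal in the eigenbasis. Its trace suffices, because
        -- the first round is a restart.
        by_cases hh : h = []
        · right
          refine ⟨?_, ih.2⟩
          subst hh
          simp only [remaining, freshAttempt, Strategy.run.injEq] at hr
          rw [← hr.1]
          rfl
        · exact Or.inl (ih.1 hh)
    exact ⟨fun _ => key, by rw [key, trace_diagIn]⟩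

theorem prob_eq (hρ : ρ = diagIn U fun j => (lam j : ℂ)) (hl : IsDistribution lam)
    (hσ : σ.trace = 1) (h : List Bool) :
    (repeatUntilSuccess body).prob ρ σ h = ENNReal.ofReal (∑ j, weights lam body h j) := by
  rw [Protocol.prob, ← trace_readQudit, (readQudit_state U hρ hl hσ h).2, ← Complex.ofReal_sum,
    Complex.ofReal_re]

theorem ne_nil_of_final {h : List Bool} (hh : repeatUntilSuccess body h = none) : h ≠ [] := by
  rintro rfl
  simp [repeatUntilSuccess, remaining, freshAttempt] at hh

/-- The expectation of a terminal value over the final outcome sequences. -/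
theorem hasSum_final (hl : IsDistribution lam) (hp : 0 < body.accepted lam 1)
    {u : Fin d → ℝ} (hu : 0 ≤ u) (hu1 : u ≤ 1) :
    HasSum (fun h : (repeatUntilSuccess body).Final => ∑ j, weights lam body h.1 j * u j)
      (body.accepted lam u / body.accepted lam 1) := by
  have h1 := hasSum_terminal hl hp hu hu1
  have h2 : gainAt lam body 0 u = Set.indicator {h | repeatUntilSuccess body h = none}
      fun h => ∑ j, weights lam body h j * u j := by
    ext h
    rcases hr : remaining body h with b | ⟨R, f⟩
    · rw [Set.indicator_of_mem (show h ∈ {h | repeatUntilSuccess body h = none} from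
        repeatUntilSuccess_eq_none.2 ⟨b, hr⟩), gainAt, hr]
    · rw [Set.indicator_of_notMem, gainAt, hr]
      · simp
      · simp [repeatUntilSuccess, hr]
  rw [h2] at h1
  exact hasSum_subtype_iff_indicator.2 h1

theorem stopProb_eq_one (hρ : ρ = diagIn U fun j => (lam j : ℂ)) (hl : IsDistribution lam)
    (hσ : σ.trace = 1) (hp : 0 < body.accepted lam 1) :
    (repeatUntilSuccess body).stopProb ρ σ = 1 := by
  have h1 := hasSum_final hl hp (u := 1) zero_le_one le_rfl
  simp only [Pi.one_apply, mul_one, div_self hp.ne'] at h1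
  rw [Protocol.stopProb]
  simp only [prob_eq U hρ hl hσ]
  rw [← ENNReal.ofReal_tsum_of_nonneg (fun h => Finset.sum_nonneg fun j _ => weights_nonneg hl _ j)
    h1.summable, h1.tsum_eq, ENNReal.ofReal_one]

/-- The spectrum of the output state. -/
def outputSpectrum (lam : Fin d → ℝ) (body : Strategy Bool) (j : Fin d) : ℝ :=
  body.accepted lam (Pi.single j 1) / body.accepted lam 1

theorem continuous_diagIn : Continuous (diagIn U) :=
  (continuous_const.matrix_mul (Continuous.matrix_diagonal continuous_id)).matrix_mul
    continuous_const

theorem hasOutput (hρ : ρ = diagIn U fun j => (lam j : ℂ)) (hl : IsDistribution lam)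
    (hσ : σ.trace = 1) (hp : 0 < body.accepted lam 1) :
    (repeatUntilSuccess body).HasOutput ρ σ
      (diagIn U fun j => (outputSpectrum lam body j : ℂ)) := by
  have h1 : ∀ j, HasSum (fun h : (repeatUntilSuccess body).Final =>
      (weights lam body h.1 j : ℂ)) (outputSpectrum lam body j : ℂ) := fun j => by
    have := hasSum_final hl hp (u := Pi.single j 1)
      (by simp) (fun k => by simp only [Pi.single_apply, Pi.one_apply]; split_ifs <;> norm_num)
    simp only [Pi.single_apply, mul_ite, mul_one, mul_zero, Finset.sum_ite_eq', Finset.mem_univ,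
      if_true] at this
    exact Complex.hasSum_ofReal.2 this
  have h2 := Pi.hasSum.2 h1
  have h3 := h2.map (⟨⟨diagIn U, diagIn_zero U⟩, fun v w => (diagIn_add U v w).symm⟩ :
    (Fin d → ℂ) →+ Matrix (Fin d) (Fin d) ℂ) (continuous_diagIn U)
  unfold Protocol.HasOutput
  refine (congrArg (fun F => HasSum F _) (funext fun h => ?_)).mpr h3
  exact (readQudit_state U hρ hl hσ h.1).1 (ne_nil_of_final h.2)

/-- The value function is accumulated cost times current mass, plus expected remaining cost. Its
gain is the total cost at final sequences and zero elsewhere. Only an upper bound is needed, so no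
limit has to be controlled. -/
theorem expectedCost_le (hρ : ρ = diagIn U fun j => (lam j : ℂ)) (hl : IsDistribution lam)
    (hσ : σ.trace = 1) (hp : 0 < body.accepted lam 1) (cost : Instr → ℕ) :
    (repeatUntilSuccess body).expectedCost cost ρ σ ≤
      ENNReal.ofReal (repeatedValue lam body (roundCost cost) 0) := by
  have hc : ∀ R, 0 ≤ roundCost cost R := fun R => Nat.cast_nonneg _
  set P := repeatUntilSuccess body with hP
  set m : List Bool → ℝ := fun h => ∑ j, weights lam body h j with hm
  have hm0 : ∀ h, 0 ≤ m h := fun h => Finset.sum_nonneg fun j _ => weights_nonneg hl h j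
  set V : List Bool → ℝ := fun h => m h * P.totalCost cost h + valueAt lam body (roundCost cost) 0 h
    with hVdef
  set a : List Bool → ℝ := fun h => if P h = none then m h * P.totalCost cost h else 0 with hadef
  have hV : ∀ h, V h = a h + ∑ o, V (o :: h) := by
    intro h
    have hv := valueAt_eq hl hp (roundCost cost) 0 h
    rcases hr : remaining body h with b | ⟨R, f⟩
    · have hn : P h = none := repeatUntilSuccess_eq_none.2 ⟨b, hr⟩
      have h0 : ∀ o, m (o :: h) = 0 := fun o => by simp [hm, weights, hr]
      have hg : gainAt lam body (roundCost cost) 0 h = 0 := by simp [gainAt, hr]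
      simp only [hVdef, hadef, hn, if_true, h0, zero_mul, zero_add]
      rw [hv, hg, zero_add]
    · have hs : P h = some R := by simp [hP, repeatUntilSuccess, hr]
      have hg : gainAt lam body (roundCost cost) 0 h = roundCost cost R * m h := by
        simp [gainAt, hr, hm]
      have ht : ∀ o, (P.totalCost cost (o :: h) : ℝ) = P.totalCost cost h + roundCost cost R :=
        fun o => by simp [Protocol.totalCost, hs, roundCost]
      have hsum : ∑ o, m (o :: h) = m h := sum_weights_cons hl hr
      simp only [hVdef, hadef, hs, reduceCtorEq, if_false, ht, Finset.sum_add_distrib,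
        ← Finset.sum_mul, hsum]
      rw [hv, hg]
      ring
  have hV0 : ∀ h, 0 ≤ V h := fun h => add_nonneg (mul_nonneg (hm0 h) (Nat.cast_nonneg _))
    (valueAt_nonneg hl hc le_rfl h)
  have ha : ∀ h, 0 ≤ a h := fun h => by
    simp only [hadef]
    split_ifs
    exacts [mul_nonneg (hm0 h) (Nat.cast_nonneg _), le_rfl]
  have hnil : V [] = repeatedValue lam body (roundCost cost) 0 := by
    simp [hVdef, Protocol.totalCost, valueAt_nil hl hp]
  rw [Protocol.expectedCost]
  rw [ENNReal.tsum_eq_iSup_sum]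
  refine iSup_le fun s => ?_
  have hterm : ∀ h : P.Final, P.prob ρ σ h.1 * (P.totalCost cost h.1 : ℝ≥0∞) =
      ENNReal.ofReal (a h.1) := fun h => by
    have hn : P h.1 = none := h.2
    rw [prob_eq U hρ hl hσ]
    simp only [hadef, hn, if_true]
    rw [ENNReal.ofReal_mul (hm0 _), ENNReal.ofReal_natCast]
  simp only [hterm]
  rw [← ENNReal.ofReal_sum_of_nonneg fun h _ => ha h.1, ← hnil]
  refine ENNReal.ofReal_le_ofReal ?_
  have := sum_le_value hV hV0 ha (s.map (Function.Embedding.subtype _))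
  rwa [Finset.sum_map] at this

end protocol

/-! ## The spectrum of the output state -/

section spectrum

variable {d : ℕ} (U : Matrix.unitaryGroup (Fin d) ℂ)

theorem isDensityOperator_diagIn {v : Fin d → ℝ} (hv : IsDistribution v) :
    IsDensityOperator (diagIn U fun j => (v j : ℂ)) where
  posSemidef := by
    refine Matrix.PosSemidef.mul_mul_conjTranspose_same ?_ _
    exact Matrix.PosSemidef.diagonal fun j => Complex.zero_le_real.2 (hv.nonneg j)
  trace_eq_one := by
    rw [trace_diagIn]
    exact_mod_cast hv.sum_eq_one

theorem commute_diagIn (w w' : Fin d → ℂ) : Commute (diagIn U w) (diagIn U w') := by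
  rw [Commute, SemiconjBy, diagIn_mul, diagIn_mul, mul_comm]

theorem diagIn_mulVec (w Ξ : Fin d → ℂ) :
    (U : Matrix (Fin d) (Fin d) ℂ).conjTranspose.mulVec ((diagIn U w).mulVec Ξ) =
      w * (U : Matrix (Fin d) (Fin d) ℂ).conjTranspose.mulVec Ξ := by
  rw [diagIn, Matrix.mulVec_mulVec, ← Matrix.mul_assoc, ← Matrix.mul_assoc,
    unitary_conjTranspose_mul_self, Matrix.one_mul, ← Matrix.mulVec_mulVec]
  ext j
  rw [Matrix.mulVec_diagonal]
  rfl

theorem star_dotProduct_diagIn_mulVec (w Ξ : Fin d → ℂ) :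
    star Ξ ⬝ᵥ (diagIn U w).mulVec Ξ =
      ∑ j, w j * Complex.normSq ((U : Matrix (Fin d) (Fin d) ℂ).conjTranspose.mulVec Ξ j) := by
  set y := (U : Matrix (Fin d) (Fin d) ℂ).conjTranspose.mulVec Ξ with hy
  have h1 : star y = Matrix.vecMul (star Ξ) (U : Matrix (Fin d) (Fin d) ℂ) := by
    rw [hy, Matrix.star_mulVec, Matrix.conjTranspose_conjTranspose]
  have h2 : (diagIn U w).mulVec Ξ = (U : Matrix (Fin d) (Fin d) ℂ).mulVec (w * y) := by
    rw [diagIn, Matrix.mul_assoc, ← Matrix.mulVec_mulVec, ← Matrix.mulVec_mulVec, ← hy]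
    congr 1
    ext j
    rw [Matrix.mulVec_diagonal]
    rfl
  rw [h2, Matrix.dotProduct_mulVec, ← h1]
  simp only [dotProduct, Pi.star_apply, Pi.mul_apply, Complex.normSq_eq_conj_mul_self,
    RCLike.star_def]
  exact Finset.sum_congr rfl fun j _ => by ring

/-- The eigenvalue is simple, so in the eigenbasis Ξ is supported on coordinate `i`, and its phase
drops out. -/
theorem star_dotProduct_diagIn_of_eigenvector {lam : Fin d → ℝ} {i : Fin d}
    (hi : ∀ j ≠ i, lam j ≠ lam i) {Ξ : Fin d → ℂ} (hΞ : star Ξ ⬝ᵥ Ξ = 1)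
    (he : (diagIn U fun j => (lam j : ℂ)).mulVec Ξ = (lam i : ℂ) • Ξ) (w : Fin d → ℂ) :
    star Ξ ⬝ᵥ (diagIn U w).mulVec Ξ = w i := by
  set y := (U : Matrix (Fin d) (Fin d) ℂ).conjTranspose.mulVec Ξ with hy
  have h1 : ∀ j ≠ i, y j = 0 := by
    intro j hj
    have := congrFun (diagIn_mulVec U (fun j => (lam j : ℂ)) Ξ) j
    rw [he, Matrix.mulVec_smul, ← hy, Pi.smul_apply, Pi.mul_apply, smul_eq_mul] at this
    have h2 : ((lam j : ℂ) - lam i) * y j = 0 := by linear_combination -this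
    refine (mul_eq_zero.1 h2).resolve_left fun h3 => hi j hj ?_
    exact_mod_cast sub_eq_zero.1 h3
  have h2 : ∀ w : Fin d → ℂ, star Ξ ⬝ᵥ (diagIn U w).mulVec Ξ = w i * Complex.normSq (y i) := by
    intro w
    rw [star_dotProduct_diagIn_mulVec, ← hy]
    refine Finset.sum_eq_single i (fun j _ hj => ?_) (by simp)
    rw [h1 j hj]
    simp
  have h3 : diagIn U 1 = 1 := by
    have : Matrix.diagonal (1 : Fin d → ℂ) = 1 := Matrix.diagonal_one
    rw [diagIn, this, Matrix.mul_one]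
    have := Matrix.mem_unitaryGroup_iff.1 U.2
    rwa [Matrix.star_eq_conjTranspose] at this
  have h4 := h2 1
  rw [h3, Matrix.one_mulVec, hΞ, Pi.one_apply, one_mul] at h4
  rw [h2, ← h4, mul_one]

theorem exists_eigenbasis {ρ : Matrix (Fin d) (Fin d) ℂ} (hρ : IsDensityOperator ρ) {a b : ℝ}
    (ha : a ≤ sortedEigenvalue hρ.posSemidef.isHermitian 0)
    (hb : sortedEigenvalue hρ.posSemidef.isHermitian 1 ≤ b) :
    ∃ (U : Matrix.unitaryGroup (Fin d) ℂ) (lam : Fin d → ℝ) (i : Fin d), IsDistribution lam ∧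
      ρ = diagIn U (fun j => (lam j : ℂ)) ∧
      sortedEigenvalue hρ.posSemidef.isHermitian 0 = lam i ∧ a ≤ lam i ∧ ∀ j ≠ i, lam j ≤ b := by
  set hA := hρ.posSemidef.isHermitian
  have hd : 0 < Fintype.card (Fin d) := by
    rcases Nat.eq_zero_or_pos d with rfl | h
    · have := hρ.trace_eq_one
      simp [Matrix.trace] at this
    · simpa using h
  -- The same equivalence as in the definition of `eigenvalues`, so the next identity holds by
  -- `rfl`.
  set e : Fin d ≃ Fin (Fintype.card (Fin d)) :=
    (Fintype.equivOfCardEq (Fintype.card_fin _)).symm with he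
  have hlam : ∀ j, hA.eigenvalues j = hA.eigenvalues₀ (e j) := fun j => rfl
  have hspec : ρ = diagIn hA.eigenvectorUnitary fun j => (hA.eigenvalues j : ℂ) :=
    hA.spectral_theorem
  have h0 : sortedEigenvalue hA 0 = hA.eigenvalues (e.symm ⟨0, hd⟩) := by
    rw [hlam, Equiv.apply_symm_apply, sortedEigenvalue, dif_pos hd]
  refine ⟨hA.eigenvectorUnitary, hA.eigenvalues, e.symm ⟨0, hd⟩,
    ⟨fun j => hρ.posSemidef.eigenvalues_nonneg j, ?_⟩, hspec, h0, h0 ▸ ha, ?_⟩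
  · have := hρ.trace_eq_one
    rw [hspec, trace_diagIn] at this
    exact_mod_cast this
  · intro j hj
    refine le_trans ?_ hb
    have hne : (e j : ℕ) ≠ 0 := fun h => hj (by
      rw [Equiv.eq_symm_apply]
      exact Fin.ext h)
    have h1 : 1 < Fintype.card (Fin d) := by
      have := (e j).2
      omega
    rw [hlam, sortedEigenvalue, dif_pos h1]
    refine hA.eigenvalues₀_antitone ?_
    rw [Fin.le_def]
    simp only
    omega

theorem isDistribution_outputSpectrum {lam : Fin d → ℝ} (hl : IsDistribution lam)
    {body : Strategy Bool} (hp : 0 < body.accepted lam 1) :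
    IsDistribution (outputSpectrum lam body) where
  nonneg j := div_nonneg (Strategy.accepted_nonneg hl _ (by simp)) hp.le
  sum_eq_one := by
    have h : ∀ s : Finset (Fin d), ∑ j ∈ s, body.accepted lam (Pi.single j 1) =
        body.accepted lam (∑ j ∈ s, Pi.single j 1) := by
      intro s
      induction s using Finset.induction_on with
      | empty =>
        have := body.accepted_smul (lam := lam) 0 0
        rw [zero_smul, zero_mul] at this
        simp [this]
      | insert j s hj ih => rw [Finset.sum_insert hj, Finset.sum_insert hj, ih,
          Strategy.accepted_add]
    have h1 : ∑ j, (Pi.single j 1 : Fin d → ℝ) = 1 := by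
      have := Finset.univ_sum_single (1 : Fin d → ℝ)
      simpa using this
    simp only [outputSpectrum, ← Finset.sum_div]
    rw [h, h1, div_self hp.ne']

end spectrum

end FracSwapDistillation

end

/-! ### Assembly of the main theorem -/

open FracSwapDistillation in
theorem mainTheorem2 :
    ∃ C : ℝ, 0 < C ∧
      ∀ γ ε α : ℝ, 0 < γ → γ < 1 → 0 < ε → ε < 1 → 0 < α → α < 1 → ε < 1 - γ →
        ∃ P : FracSwapDistillation.Protocol,
          ∀ (d : ℕ) (ρ : Matrix (Fin d) (Fin d) ℂ)
            (hρ : FracSwapDistillation.IsDensityOperator ρ),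
            γ ≤ FracSwapDistillation.sortedEigenvalue hρ.posSemidef.isHermitian 0 →
            FracSwapDistillation.sortedEigenvalue hρ.posSemidef.isHermitian 1 ≤ α * γ →
            ∀ σ : FracSwapDistillation.MemOp d, FracSwapDistillation.IsDensityOperator σ →
              P.stopProb ρ σ = 1 ∧
              (∃ ρout : Matrix (Fin d) (Fin d) ℂ,
                P.HasOutput ρ σ ρout ∧
                FracSwapDistillation.IsDensityOperator ρout ∧
                Commute ρ ρout ∧
                ∀ Ξ : Fin d → ℂ, star Ξ ⬝ᵥ Ξ = 1 →
                  ρ.mulVec Ξ =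
                    ((FracSwapDistillation.sortedEigenvalue
                      hρ.posSemidef.isHermitian 0 : ℝ) : ℂ) • Ξ →
                  1 - ε ≤ (star Ξ ⬝ᵥ ρout.mulVec Ξ).re) ∧
              P.expectedCost FracSwapDistillation.copyCost ρ σ ≤
                ENNReal.ofReal
                  (C * ((1 - γ) / ((1 - α) ^ 2 * γ ^ 2) * (1 / ε + 1 / γ))) ∧
              P.expectedCost FracSwapDistillation.cswapCost ρ σ ≤
                ENNReal.ofReal
                  (C * ((1 - γ) / ((1 - α) ^ 2 * γ ^ 2) * (1 / ε + 1 / γ))) ∧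
              P.expectedCost FracSwapDistillation.oneQubitCost ρ σ ≤
                ENNReal.ofReal
                  (C * ((1 - γ) / ((1 - α) ^ 2 * γ ^ 2) * (1 / ε + 1 / γ))) := by
  obtain ⟨C, hC, h⟩ := exists_attempt
  refine ⟨7 * C, by positivity, ?_⟩
  intro γ ε α hγ hγ1 hε _ hα hα1 hεγ
  obtain ⟨body, -, hbody⟩ := h γ ε α hγ hγ1 hε hα hα1 hεγ
  refine ⟨repeatUntilSuccess body, ?_⟩
  intro d ρ hρ h1 h2 σ hσ
  obtain ⟨U, lam, i, hl, hspec, hi0, hi, hj⟩ := exists_eigenbasis hρ h1 h2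
  obtain ⟨hp, hoff, hcost⟩ := hbody d lam i hl hi hj
  have hcosts : ∀ cost, (cost = copyCost ∨ cost = cswapCost ∨ cost = oneQubitCost) →
      (repeatUntilSuccess body).expectedCost cost ρ σ ≤ ENNReal.ofReal
        (7 * C * ((1 - γ) / ((1 - α) ^ 2 * γ ^ 2) * (1 / ε + 1 / γ))) := by
    intro cost hc
    refine (expectedCost_le U hspec hl hσ.trace_eq_one hp cost).trans (ENNReal.ofReal_le_ofReal ?_)
    rw [mul_assoc]
    exact repeatedValue_roundCost_le hl hp hc hcost
  refine ⟨stopProb_eq_one U hspec hl hσ.trace_eq_one hp,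
    ⟨diagIn U fun j => (outputSpectrum lam body j : ℂ), hasOutput U hspec hl hσ.trace_eq_one hp,
      isDensityOperator_diagIn U (isDistribution_outputSpectrum hl hp), ?_, ?_⟩,
    hcosts _ (Or.inl rfl), hcosts _ (Or.inr (Or.inl rfl)), hcosts _ (Or.inr (Or.inr rfl))⟩
  · rw [hspec]
    exact commute_diagIn U _ _
  · intro Ξ hΞ he
    rw [hi0, hspec] at he
    -- The largest eigenvalue is simple because αγ < γ, so Ξ is unique up to phase.
    have hne : ∀ j ≠ i, lam j ≠ lam i := fun j hji => by
      have := hj j hji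
      have : α * γ < γ := by nlinarith
      exact ne_of_lt (by linarith)
    rw [star_dotProduct_diagIn_of_eigenvector U hne hΞ he, Complex.ofReal_re, outputSpectrum,
      le_div_iff₀ hp]
    have hsplit : body.accepted lam 1 =
        body.accepted lam (Pi.single i 1) + body.accepted lam (offIndicator i) := by
      rw [← Strategy.accepted_add, single_add_offIndicator]
    linarith
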